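/- Let $f\colon M^n\to\mathbb{R}^{n+p}$, $n\ge 1$, be a smooth immersion of a smooth manifold, endowed with the induced metric, and let $\alpha$ be its second fundamental form. For a normal vector $\eta$ at $x$ put $\mathcal{E}_\eta(x)=\{v\in T_xM:\alpha(v,w)=\langle v,w\rangle\eta\ \text{for all } w\in T_xM\}$. A \emph{principal normal} of $f$ on an open set $U\subset M$ is a smooth normal vector field $\eta$ along $U$ for which $\dim\mathcal{E}_\eta$ is constant and at least $1$; it is \emph{Dupin} if $\nabla^\perp_v\eta=0$ for all $v\in\mathcal{E}_\eta$; it \emph{has integrable conullity} if the distribution $\mathcal{E}_\eta^\perp\subset TU$ is integrable (closed under Lie brackets). The immersion $f$ is a \emph{$k$-Dupin submanifold} if its normal bundle is flat (the curvature of the normal connection $\nabla^\perp$ vanishes), at each $x\in M$ there are exactly $k$ distinct normal vectors $\eta$ with $\mathcal{E}_\eta(x)\neq 0$, and every principal normal of $f$ on every open set is Dupin. It is \emph{locally weakly irreducible} if on no nonempty open subset $U\subset M$ does $f|_U$ have a principal normal with integrable conullity. For an open set $U\neq\emptyset$, the \emph{conformal codimension} $c(f|_U)$ is the number such that $n+c(f|_U)$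 is the least dimension of a round sphere or an affine subspace of $\mathbb{R}^{n+p}$ that contains $f(U)$. \textbf{Proposition.} Let $f\colon M^n\to\mathbb{R}^{n+p}$ be a locally weakly irreducible $k$-Dupin submanifold. Then there is an open dense subset $W\subset M$ such that $$c(f|_C)\le \tfrac23\,k-1$$ for every connected component $C$ of $W$. Moreover, the estimate is sharp: for every integer $\ell\ge 1$ there is a nonempty locally weakly irreducible $3\ell$-Dupin submanifold $f$ such that $c(f|_U)=\tfrac23\,(3\ell)-1=2\ell-1$ for every nonempty open subset $U$. -/

import Mathlib

open scoped Manifold ContDiff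

noncomputable section

namespace DupinSubmanifold

variable (n : ℕ) {d : ℕ} {M : Type*} [TopologicalSpace M]
  [ChartedSpace (EuclideanSpace ℝ (Fin n)) M]

/-- The differential at `x` of a map from the manifold `M` to the Euclidean space `ℝ^d`. -/
def differential (f : M → EuclideanSpace ℝ (Fin d)) (x : M) :
    TangentSpace (𝓡 n) x →L[ℝ] EuclideanSpace ℝ (Fin d) :=
  mfderiv (𝓡 n) 𝓘(ℝ, EuclideanSpace ℝ (Fin d)) f x

/-- A smooth immersion `f : M → ℝ^d`. The manifold `M` is always given the Riemannian metric
induced by `f`, so that `f` is an isometric immersion. -/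
def IsSmoothImmersion (f : M → EuclideanSpace ℝ (Fin d)) : Prop :=
  ContMDiff (𝓡 n) 𝓘(ℝ, EuclideanSpace ℝ (Fin d)) ∞ f ∧
    ∀ x : M, Function.Injective (differential n f x)

/-- The Riemannian metric induced by `f`. -/
def inducedMetric (f : M → EuclideanSpace ℝ (Fin d)) (x : M) (v w : TangentSpace (𝓡 n) x) : ℝ :=
  inner ℝ (differential n f x v) (differential n f x w)

/-- The normal space of `f` at `x`, the orthogonal complement of the image of the differential. -/
def normalSpace (f : M → EuclideanSpace ℝ (Fin d)) (x : M) :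
    Submodule ℝ (EuclideanSpace ℝ (Fin d)) :=
  (LinearMap.range (differential n f x).toLinearMap)ᗮ

/-- The second derivative of `f` at `x`, taken in the preferred chart at `x` (the chart through which
Mathlib identifies `T_xM` with `ℝ^n`). -/
def chartHessian (f : M → EuclideanSpace ℝ (Fin d)) (x : M) :
    TangentSpace (𝓡 n) x →L[ℝ] TangentSpace (𝓡 n) x →L[ℝ] EuclideanSpace ℝ (Fin d) :=
  fderiv ℝ (fderiv ℝ (f ∘ (extChartAt (𝓡 n) x).symm)) (extChartAt (𝓡 n) x x)

/-- The second fundamental form `α(v, w)` of `f` at `x`: the normal component of the second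
derivative of `f`. In contrast to the second derivative itself, it does not depend on the chart, and
`α(v, Y(x))` is the normal component of the derivative of `df(Y)` along `v`, for vector fields
`Y`. -/
def secondFundamentalForm (f : M → EuclideanSpace ℝ (Fin d)) (x : M)
    (v w : TangentSpace (𝓡 n) x) : EuclideanSpace ℝ (Fin d) :=
  (normalSpace n f x).starProjection (chartHessian n f x v w)

/-- `X` is a vector field which is smooth on the set `U`. -/
def IsSmoothVectorFieldOn [IsManifold (𝓡 n) ∞ M]
    (X : (x : M) → TangentSpace (𝓡 n) x) (U : Set M) : Prop :=
  ContMDiffOn (𝓡 n) (𝓡 n).tangent ∞ (fun x => (⟨x, X x⟩ : TangentBundle (𝓡 n) M)) U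

/-- `ξ` is a normal vector field of `f` which is smooth on the set `U`. -/
def IsSmoothNormalFieldOn (f ξ : M → EuclideanSpace ℝ (Fin d)) (U : Set M) : Prop :=
  ContMDiffOn (𝓡 n) 𝓘(ℝ, EuclideanSpace ℝ (Fin d)) ∞ ξ U ∧ ∀ x ∈ U, ξ x ∈ normalSpace n f x

/-- The covariant derivative `∇^⊥_v ξ` of the normal field `ξ` in the normal connection of `f`. -/
def normalDerivative (f ξ : M → EuclideanSpace ℝ (Fin d)) (x : M) (v : TangentSpace (𝓡 n) x) :
    EuclideanSpace ℝ (Fin d) :=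
  (normalSpace n f x).starProjection (differential n ξ x v)

/-- The normal curvature `R^⊥(X, Y) ξ = ∇^⊥_X ∇^⊥_Y ξ - ∇^⊥_Y ∇^⊥_X ξ - ∇^⊥_{[X, Y]} ξ`. -/
def normalCurvature (f : M → EuclideanSpace ℝ (Fin d)) (X Y : (x : M) → TangentSpace (𝓡 n) x)
    (ξ : M → EuclideanSpace ℝ (Fin d)) (x : M) : EuclideanSpace ℝ (Fin d) :=
  normalDerivative n f (fun y => normalDerivative n f ξ y (Y y)) x (X x)
    - normalDerivative n f (fun y => normalDerivative n f ξ y (X y)) x (Y x)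
    - normalDerivative n f ξ x (VectorField.mlieBracket (𝓡 n) X Y x)

/-- `f` has flat normal bundle: the normal curvature vanishes. -/
def HasFlatNormalBundle [IsManifold (𝓡 n) ∞ M] (f : M → EuclideanSpace ℝ (Fin d)) : Prop :=
  ∀ U : Set M, IsOpen U → ∀ X Y : (x : M) → TangentSpace (𝓡 n) x,
    IsSmoothVectorFieldOn n X U → IsSmoothVectorFieldOn n Y U →
    ∀ ξ : M → EuclideanSpace ℝ (Fin d), IsSmoothNormalFieldOn n f ξ U →
    ∀ x ∈ U, normalCurvature n f X Y ξ x = 0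

/-- The (conformal) nullity `E_η(x) = ker (α - ⟨ , ⟩ η)` of a vector `η` at the point `x`. -/
def nullity (f : M → EuclideanSpace ℝ (Fin d)) (x : M) (η : EuclideanSpace ℝ (Fin d)) :
    Submodule ℝ (TangentSpace (𝓡 n) x) where
  carrier := {v | ∀ w, secondFundamentalForm n f x v w = inducedMetric n f x v w • η}
  zero_mem' := fun w => by simp [secondFundamentalForm, inducedMetric]
  add_mem' := fun {u v} hu hv w => by
    have h1 : secondFundamentalForm n f x (u + v) w
        = secondFundamentalForm n f x u w + secondFundamentalForm n f x v w := by
      simp [secondFundamentalForm]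
    have h2 : inducedMetric n f x (u + v) w
        = inducedMetric n f x u w + inducedMetric n f x v w := by
      simp [inducedMetric, inner_add_left]
    rw [h1, h2, hu w, hv w, add_smul]
  smul_mem' := fun c v hv w => by
    have h1 : secondFundamentalForm n f x (c • v) w = c • secondFundamentalForm n f x v w := by
      simp [secondFundamentalForm]
    have h2 : inducedMetric n f x (c • v) w = c * inducedMetric n f x v w := by
      simp [inducedMetric, real_inner_smul_left]
    rw [h1, h2, hv w, mul_smul]

/-- The conullity `E_η(x)^⊥`, the orthogonal complement of the nullity in the tangent space with
respect to the induced metric, as a set of tangent vectors. -/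
def conullity (f : M → EuclideanSpace ℝ (Fin d)) (x : M) (η : EuclideanSpace ℝ (Fin d)) :
    Set (TangentSpace (𝓡 n) x) :=
  {v | ∀ w ∈ nullity n f x η, inducedMetric n f x v w = 0}

/-- The set of principal normals of `f` at the point `x`. -/
def principalNormalsAt (f : M → EuclideanSpace ℝ (Fin d)) (x : M) :
    Set (EuclideanSpace ℝ (Fin d)) :=
  {η | η ∈ normalSpace n f x ∧ nullity n f x η ≠ ⊥}

/-- `η` is a principal normal of the restriction of `f` to the open set `U`: a smooth normal
vector field along `U` whose nullity has constant dimension `s ≥ 1`. -/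
def IsPrincipalNormalOn (f η : M → EuclideanSpace ℝ (Fin d)) (U : Set M) : Prop :=
  IsSmoothNormalFieldOn n f η U ∧
    ∃ s : ℕ, 1 ≤ s ∧ ∀ x ∈ U, Module.finrank ℝ (nullity n f x (η x)) = s

/-- The principal normal `η` on `U` is Dupin: it is parallel in the normal connection along its
nullity. -/
def IsDupinOn (f η : M → EuclideanSpace ℝ (Fin d)) (U : Set M) : Prop :=
  ∀ x ∈ U, ∀ v ∈ nullity n f x (η x), normalDerivative n f η x v = 0

/-- The conullity of `η` is integrable on `U`: the (smooth) distribution `E_η^⊥` is closed under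
Lie brackets. -/
def HasIntegrableConullityOn [IsManifold (𝓡 n) ∞ M]
    (f η : M → EuclideanSpace ℝ (Fin d)) (U : Set M) : Prop :=
  ∀ U' : Set M, IsOpen U' → U' ⊆ U → ∀ X Y : (x : M) → TangentSpace (𝓡 n) x,
    IsSmoothVectorFieldOn n X U' → IsSmoothVectorFieldOn n Y U' →
    (∀ x ∈ U', X x ∈ conullity n f x (η x)) → (∀ x ∈ U', Y x ∈ conullity n f x (η x)) →
    ∀ x ∈ U', VectorField.mlieBracket (𝓡 n) X Y x ∈ conullity n f x (η x)

/-- A `k`-Dupin submanifold: an isometric immersion with flat normal bundle which is proper, with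
exactly `k` distinct principal normals at every point, and all of whose principal normals are
Dupin. Principal normals are considered on open subsets, as they need only be defined locally when
`M` is not simply connected. -/
def IsKDupin [IsManifold (𝓡 n) ∞ M] (k : ℕ) (f : M → EuclideanSpace ℝ (Fin d)) : Prop :=
  IsSmoothImmersion n f ∧ HasFlatNormalBundle n f ∧
    (∀ x : M, (principalNormalsAt n f x).encard = k) ∧
    ∀ (U : Set M) (η : M → EuclideanSpace ℝ (Fin d)), IsOpen U →
      IsPrincipalNormalOn n f η U → IsDupinOn n f η U

/-- The restriction of `f` to the open set `U` is weakly reducible: it has a principal normal with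
integrable conullity. -/
def IsWeaklyReducibleOn [IsManifold (𝓡 n) ∞ M]
    (f : M → EuclideanSpace ℝ (Fin d)) (U : Set M) : Prop :=
  ∃ η : M → EuclideanSpace ℝ (Fin d), IsPrincipalNormalOn n f η U ∧ HasIntegrableConullityOn n f η U

/-- `f` is locally weakly irreducible: no restriction of `f` to a nonempty open subset is weakly
reducible. -/
def IsLocallyWeaklyIrreducible [IsManifold (𝓡 n) ∞ M] (f : M → EuclideanSpace ℝ (Fin d)) : Prop :=
  ∀ U : Set M, IsOpen U → U.Nonempty → ¬ IsWeaklyReducibleOn n f U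

/-- The set `S` is contained in an `m`-dimensional affine subspace of `ℝ^d` or in an
`m`-dimensional round sphere, that is, in the intersection of an `(m + 1)`-dimensional affine
subspace with a sphere of positive radius whose center lies in that subspace. -/
def LiesInSphereOrAffine (m : ℕ) (S : Set (EuclideanSpace ℝ (Fin d))) : Prop :=
  (∃ A : AffineSubspace ℝ (EuclideanSpace ℝ (Fin d)),
      Module.finrank ℝ A.direction = m ∧ S ⊆ A) ∨
    ∃ A : AffineSubspace ℝ (EuclideanSpace ℝ (Fin d)), Module.finrank ℝ A.direction = m + 1 ∧
      ∃ c ∈ A, ∃ r : ℝ, 0 < r ∧ S ⊆ (A : Set (EuclideanSpace ℝ (Fin d))) ∩ Metric.sphere c r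

/-- The conformal codimension `c(f|_U)` of the restriction of `f` to `U`: the number such that
`n + c(f|_U)` is the least dimension of a sphere or an affine subspace that contains `f(U)`. -/
def conformalCodim (f : M → EuclideanSpace ℝ (Fin d)) (U : Set M) : ℤ :=
  (sInf {m : ℕ | LiesInSphereOrAffine m (f '' U)} : ℕ) - (n : ℤ)

end DupinSubmanifold

end

/-! The bound. A flat normal bundle makes the shape operators commute (Ricci equation), so each
tangent space is the orthogonal sum of the nullities E_i of the k principal normals η_i. Since k is
constant, the η_i and the orthogonal projections Q_i onto the E_i can be numbered smoothly near
every point (`exists_smoothPrincipalFrame`). For u in E_b and v in E_a with a, b ≠ c, the Codazzi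
equation becomes ⟨(∂_u Q_c) v, w⟩ (η_a - η_c) = ⟨(∂_v Q_c) u, w⟩ (η_b - η_c). If no two of the
differences η_a - η_c and η_b - η_c are proportional, then ∂Q_c is symmetric on the conullity of
η_c, which is therefore integrable. Weak irreducibility thus puts every η_c on a line through two
other principal normals. In homogeneous coordinates, each (η_c, 1) lies in the span of two others,
and a family of k such vectors has rank r ≤ 2k/3 (`three_mul_finrank_span_le`).

The Codazzi equation and the Dupin condition also place the normal derivatives of η_c in the span of
the differences η_i - η_c. Hence the augmented osculating space, spanned by the tangent vectors (df
v, 0) and by the (η_i, 1), is parallel in the light cone model wherever r is locally constant. It is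
then a constant subspace W of dimension n + r, and it contains the lift (f - f(y₁), |f - f(y₁)|²)
(`IsPrincipalData.exists_lift_mem`). Linear equations for the lift are equations of spheres and
hyperplanes, so f locally takes values in a sphere or an affine subspace of dimension n + r - 1,
where r - 1 ≤ 2k/3 - 1. Open sets with this property occur inside every open set, and a maximal
disjoint family of them has dense union.

Sharpness. Cartan's minimal isoparametric hypersurface of the 4-sphere is an orbit of the rotation
group in the trace free symmetric 3 × 3 matrices. Its three principal normals in ℝ^5 are collinear,
and none of its conullities is integrable, because brackets of left invariant fields do not vanish.
The product of l copies inherits this. It lies in a sphere of ℝ^(5l), but no open piece lies in a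
proper affine subspace, so its conformal codimension is 5l - 1 - 3l = 2l - 1. -/

noncomputable section

open scoped Topology

set_option linter.unusedSectionVars false

namespace DupinSubmanifold

/-! ### Smooth left inverses of injective linear maps. -/

section LeftInverse

variable {E F : Type*} [NormedAddCommGroup E] [InnerProductSpace ℝ E] [FiniteDimensional ℝ E]
  [NormedAddCommGroup F] [InnerProductSpace ℝ F] [FiniteDimensional ℝ F]

/-- The Moore-Penrose left inverse `(A† A)⁻¹ A†` of an injective linear map `A`. -/
def pseudoInverse (A : E →L[ℝ] F) : F →L[ℝ] E :=
  haveI := FiniteDimensional.complete ℝ E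
  haveI := FiniteDimensional.complete ℝ F
  (A.adjoint ∘L A).inverse ∘L A.adjoint

variable [CompleteSpace E] [CompleteSpace F]

lemma isInvertible_adjoint_comp_self {A : E →L[ℝ] F} (hA : Function.Injective A) :
    (A.adjoint ∘L A).IsInvertible := by
  have hinj : Function.Injective (A.adjoint ∘L A) := by
    rw [injective_iff_map_eq_zero]
    intro v hv
    apply hA
    have h : inner ℝ (A v) (A v) = 0 := by
      rw [← ContinuousLinearMap.adjoint_inner_left]
      have : A.adjoint (A v) = 0 := hv
      rw [this, inner_zero_left]
    rw [inner_self_eq_zero.1 h, map_zero]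
  exact ⟨(LinearEquiv.ofInjectiveEndo (A.adjoint ∘L A).toLinearMap hinj).toContinuousLinearEquiv,
    by ext; rfl⟩

lemma pseudoInverse_apply {A : E →L[ℝ] F} (hA : Function.Injective A) (v : E) :
    pseudoInverse A (A v) = v :=
  (isInvertible_adjoint_comp_self hA).inverse_apply_eq.2 rfl

lemma adjoint_sub_pseudoInverse {A : E →L[ℝ] F} (hA : Function.Injective A) (z : F) :
    A.adjoint (z - A (pseudoInverse A z)) = 0 := by
  obtain ⟨e, he⟩ := isInvertible_adjoint_comp_self hA
  have h : (A.adjoint ∘L A) (pseudoInverse A z) = A.adjoint z := by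
    simp only [pseudoInverse]
    rw [← he]
    simp
  rw [map_sub, ← h]
  simp

lemma apply_pseudoInverse {A : E →L[ℝ] F} (hA : Function.Injective A) (z : F) :
    A (pseudoInverse A z) = (LinearMap.range A.toLinearMap).starProjection z := by
  refine (Submodule.eq_starProjection_of_mem_of_inner_eq_zero (LinearMap.mem_range_self _ _) ?_).symm
  rintro _ ⟨w, rfl⟩
  refine (ContinuousLinearMap.adjoint_inner_left A w _).symm.trans ?_
  exact (congrArg (inner ℝ · w) (adjoint_sub_pseudoInverse hA z)).trans (inner_zero_left w)

lemma contDiff_adjoint {m : ℕ∞ω} :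
    ContDiff ℝ m (fun A : E →L[ℝ] F => A.adjoint) := by
  let L : (E →L[ℝ] F) →ₗ[ℝ] (F →L[ℝ] E) :=
    { toFun := fun A => A.adjoint
      map_add' := fun A B => map_add _ A B
      map_smul' := fun c A => by simp }
  exact (LinearMap.toContinuousLinearMap L).contDiff

/-- The closed formula in A is what makes orthogonal projections onto moving tangent spaces, and
coordinates of tangent vectors, depend smoothly on the point. -/
lemma contDiffAt_pseudoInverse {m : ℕ∞ω} {A : E →L[ℝ] F} (hA : Function.Injective A) :
    ContDiffAt ℝ m (pseudoInverse : (E →L[ℝ] F) → (F →L[ℝ] E)) A := by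
  obtain ⟨e, he⟩ := isInvertible_adjoint_comp_self hA
  have h1 : ContDiffAt ℝ m (fun A : E →L[ℝ] F => A.adjoint ∘L A) A :=
    contDiff_adjoint.contDiffAt.clm_comp contDiffAt_id
  have h2 : ContDiffAt ℝ m (ContinuousLinearMap.inverse : (E →L[ℝ] E) → _) (A.adjoint ∘L A) := by
    rw [← he]; exact contDiffAt_map_inverse e
  exact (ContDiffAt.comp (f := fun A : E →L[ℝ] F => A.adjoint ∘L A) A h2 h1).clm_comp contDiff_adjoint.contDiffAt

end LeftInverse

/-! ### Parallel families of subspaces. -/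

section Parallel

variable {E G₁ G₂ : Type*} [NormedAddCommGroup E] [NormedSpace ℝ E]
  [NormedAddCommGroup G₁] [NormedSpace ℝ G₁] [FiniteDimensional ℝ G₁]
  [NormedAddCommGroup G₂] [NormedSpace ℝ G₂] [FiniteDimensional ℝ G₂]

/-- A family of subspaces which is parallel is locally constant. -/
lemma eventually_range_le_of_parallel {S : E → G₁ →L[ℝ] G₂} {y₀ : E}
    (hS : ∀ᶠ y in 𝓝 y₀, DifferentiableAt ℝ S y) (hinj : Function.Injective (S y₀))
    (hpar : ∀ᶠ y in 𝓝 y₀, ∀ v w, fderiv ℝ S y v w ∈ LinearMap.range (S y).toLinearMap) :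
    ∀ᶠ y in 𝓝 y₀, ∀ w, S y w ∈ LinearMap.range (S y₀).toLinearMap := by
  have := FiniteDimensional.complete ℝ G₁
  obtain ⟨l, hl⟩ := LinearMap.exists_leftInverse_of_injective (S y₀).toLinearMap
    (LinearMap.ker_eq_bot.2 hinj)
  let L : G₂ →L[ℝ] G₁ := LinearMap.toContinuousLinearMap l
  have hL : L ∘L S y₀ = 1 := by
    ext w; exact LinearMap.congr_fun hl w
  have hunit : ∀ᶠ y in 𝓝 y₀, IsUnit (L ∘L S y) := by
    have hc : ContinuousAt (fun y => L ∘L S y) y₀ :=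
      (continuousAt_const.clm_comp hS.self_of_nhds.continuousAt)
    refine hc.eventually (Units.isOpen.mem_nhds ?_)
    change IsUnit (L ∘L S y₀)
    rw [hL]; exact isUnit_one
  obtain ⟨r, hr, hball⟩ := Metric.eventually_nhds_iff_ball.1 (hS.and (hunit.and hpar))
  -- T y has the same image as S y and is normalized by L ∘ T = 1. Differentiating, the values of T'
  -- lie in the range of S y by parallelism and in the kernel of L by the normalization. Since L is
  -- injective on that range, T' = 0.
  let T : E → G₁ →L[ℝ] G₂ := fun y => S y ∘L Ring.inverse (L ∘L S y)
  have hLT : ∀ y ∈ Metric.ball y₀ r, L ∘L T y = 1 := fun y hy => by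
    change L ∘L (S y ∘L Ring.inverse (L ∘L S y)) = 1
    rw [← ContinuousLinearMap.comp_assoc]
    exact Ring.mul_inverse_cancel _ (hball y hy).2.1
  have hST : ∀ y ∈ Metric.ball y₀ r, ∀ w, S y w = T y (L (S y w)) := fun y hy w => by
    have := Ring.inverse_mul_cancel _ (hball y hy).2.1
    change _ = S y (Ring.inverse (L ∘L S y) ((L ∘L S y) w))
    rw [← mul_apply_eq_comp, this]; rfl
  have hdinv : ∀ y ∈ Metric.ball y₀ r,
      DifferentiableAt ℝ (fun y => Ring.inverse (L ∘L S y)) y := fun y hy => by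
    obtain ⟨u, hu⟩ := (hball y hy).2.1
    have h1 : DifferentiableAt ℝ (Ring.inverse : (G₁ →L[ℝ] G₁) → _) (L ∘L S y) := by
      rw [← hu]; exact differentiableAt_inverse u.isUnit
    exact h1.comp y ((differentiableAt_const L).clm_comp (hball y hy).1)
  have hdT : ∀ y ∈ Metric.ball y₀ r, DifferentiableAt ℝ T y := fun y hy =>
    (hball y hy).1.clm_comp (hdinv y hy)
  have hT0 : (Metric.ball y₀ r).EqOn (fderiv ℝ T) 0 := fun y hy => by
    ext v w
    have h1 : fderiv ℝ T y v w ∈ LinearMap.range (S y).toLinearMap := by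
      have : fderiv ℝ T y v = fderiv ℝ S y v ∘L Ring.inverse (L ∘L S y)
          + S y ∘L fderiv ℝ (fun y => Ring.inverse (L ∘L S y)) y v := by
        rw [fderiv_clm_comp (hball y hy).1 (hdinv y hy)]
        simp [add_comm]
      rw [this]
      exact Submodule.add_mem _ ((hball y hy).2.2 _ _) (LinearMap.mem_range_self _ _)
    obtain ⟨t, ht⟩ := h1
    have h2 : L (fderiv ℝ T y v w) = 0 := by
      have hconst : (fun y => L ∘L T y) =ᶠ[𝓝 y] fun _ => 1 := by
        filter_upwards [Metric.isOpen_ball.mem_nhds hy] with z hz using hLT z hz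
      have h3 : fderiv ℝ (fun y => L ∘L T y) y = fderiv ℝ (fun _ => (1 : G₁ →L[ℝ] G₁)) y :=
        hconst.fderiv_eq
      rw [fderiv_clm_comp (differentiableAt_const L) (hdT y hy)] at h3
      have h4 := congrArg (fun Z : E →L[ℝ] G₁ →L[ℝ] G₁ => Z v w) h3
      simpa using h4
    have h3 : (L ∘L S y) t = 0 := (congrArg L ht).trans h2
    have h4 : t = 0 := by
      have := Ring.inverse_mul_cancel _ (hball y hy).2.1
      calc t = (Ring.inverse (L ∘L S y) * (L ∘L S y)) t := by rw [this]; rfl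
        _ = 0 := by rw [mul_apply_eq_comp, h3, map_zero]
    rw [← ht, h4]
    simp
  filter_upwards [Metric.ball_mem_nhds y₀ hr] with y hy w
  have hTy : T y = T y₀ :=
    Metric.isOpen_ball.is_const_of_fderiv_eq_zero (convex_ball y₀ r).isPreconnected
      (fun z hz => (hdT z hz).differentiableWithinAt) hT0 hy (Metric.mem_ball_self hr)
  rw [hST y hy w, hTy]
  exact LinearMap.mem_range_self _ _

end Parallel

/-! ### Spheres in the light cone model, a rank estimate, and dense families of open sets. -/

/-- Points whose conformal lift lies in a subspace of dimension `m + 1` lie in a sphere or an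
affine subspace of dimension `m`. -/
lemma liesInSphereOrAffine_of_lift {d m : ℕ} {S : Set (EuclideanSpace ℝ (Fin d))}
    {x₀ x₁ : EuclideanSpace ℝ (Fin d)} (hx₁ : x₁ ∈ S) (hne : x₁ ≠ x₀)
    (W : Submodule ℝ (EuclideanSpace ℝ (Fin d) × ℝ)) (hW : Module.finrank ℝ W = m + 1)
    (hS : ∀ x ∈ S, (x - x₀, ‖x - x₀‖ ^ 2) ∈ W) : LiesInSphereOrAffine m S := by
  set V := W.map (LinearMap.fst ℝ (EuclideanSpace ℝ (Fin d)) ℝ) with hV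
  have hSV : ∀ x ∈ S, x ∈ AffineSubspace.mk' x₀ V := fun x hx => by
    rw [AffineSubspace.mem_mk']
    exact ⟨_, hS x hx, rfl⟩
  let p : W →ₗ[ℝ] V := (LinearMap.fst ℝ (EuclideanSpace ℝ (Fin d)) ℝ).submoduleMap W
  have hp : LinearMap.range p = ⊤ := LinearMap.range_eq_top.2 (LinearMap.submoduleMap_surjective _ _)
  have hrank := p.finrank_range_add_finrank_ker
  rw [hp, finrank_top, hW] at hrank
  -- If W contains the vertical vector, projecting to the first factor loses one dimension, and the
  -- points fill out an affine subspace. Otherwise W is the graph of a linear function over V.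
  by_cases h : ((0 : EuclideanSpace ℝ (Fin d)), (1 : ℝ)) ∈ W
  · left
    refine ⟨AffineSubspace.mk' x₀ V, ?_, hSV⟩
    rw [AffineSubspace.direction_mk']
    have hker : Module.finrank ℝ (LinearMap.ker p) = 1 := by
      refine finrank_eq_one_iff_of_nonzero' (⟨⟨(0, 1), h⟩, ?_⟩ : LinearMap.ker p) ?_ |>.2 ?_
      · rw [LinearMap.mem_ker]; ext1; rfl
      · intro h0
        have := congrArg (fun z : LinearMap.ker p => ((z : W) : EuclideanSpace ℝ (Fin d) × ℝ).2) h0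
        simp at this
      · rintro ⟨⟨⟨a, b⟩, hw⟩, hk⟩
        refine ⟨b, ?_⟩
        have ha : a = 0 := congrArg Subtype.val (LinearMap.mem_ker.1 hk)
        ext1; ext1
        simp [ha]
    omega
  · right
    have hinj : Function.Injective p := by
      rw [injective_iff_map_eq_zero]
      rintro ⟨⟨a, b⟩, hw⟩ hk
      have ha : a = 0 := congrArg Subtype.val hk
      subst ha
      have hb : b = 0 := by
        by_contra hb
        apply h
        have := W.smul_mem b⁻¹ hw
        simpa [hb] using this
      subst hb; rfl
    have hker : LinearMap.ker p = ⊥ := LinearMap.ker_eq_bot.2 hinj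
    rw [hker, finrank_bot, add_zero] at hrank
    let e := LinearEquiv.ofBijective p ⟨hinj, LinearMap.range_eq_top.1 hp⟩
    -- The graph condition reads |v|² = ⟨b, v⟩ for v = x - x₀: a sphere through x₀ with center x₀ +
    -- b/2.
    let l : V →ₗ[ℝ] ℝ := (LinearMap.snd ℝ (EuclideanSpace ℝ (Fin d)) ℝ) ∘ₗ W.subtype ∘ₗ e.symm
    let b := (InnerProductSpace.toDual ℝ V).symm (LinearMap.toContinuousLinearMap l)
    have hb : ∀ v : V, l v = inner ℝ b v := fun v => by
      rw [InnerProductSpace.toDual_symm_apply]; rfl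
    let c : V := (1 / 2 : ℝ) • b
    have key : ∀ x ∈ S, ‖x - (x₀ + c)‖ = ‖c‖ := fun x hx => by
      have hw : e ⟨_, hS x hx⟩ = ⟨x - x₀, ⟨_, hS x hx, rfl⟩⟩ := rfl
      have h1 := hb (e ⟨_, hS x hx⟩)
      have h2 : l (e ⟨_, hS x hx⟩) = ‖x - x₀‖ ^ 2 := by simp [l]
      rw [h2, hw] at h1
      have h3 : inner ℝ (x - x₀) (c : EuclideanSpace ℝ (Fin d)) = 1 / 2 * ‖x - x₀‖ ^ 2 := by
        rw [h1, real_inner_comm]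
        simp [c, real_inner_smul_left]
      have h4 : ‖x - (x₀ + c)‖ ^ 2 = ‖c‖ ^ 2 := by
        rw [← sub_sub, norm_sub_sq_real, h3]
        simp
      exact (pow_left_inj₀ (norm_nonneg _) (norm_nonneg _) two_ne_zero).1 h4
    refine ⟨AffineSubspace.mk' x₀ V, ?_, x₀ + c, ?_, ‖c‖, ?_, ?_⟩
    · rw [AffineSubspace.direction_mk']; exact hrank
    · rw [AffineSubspace.mem_mk']; simp
    -- A vanishing radius would leave x₀ as the only point, which x₁ excludes.
    · rw [norm_pos_iff]
      intro hc
      have := key x₁ hx₁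
      rw [hc] at this
      simp [sub_eq_zero] at this
      exact hne this
    · exact fun x hx => ⟨hSV x hx, by rw [mem_sphere_iff_norm]; exact key x hx⟩

lemma finrank_span_singleton_le_one {V : Type*} [AddCommGroup V] [Module ℝ V] (v : V) :
    Module.finrank ℝ (Submodule.span ℝ {v}) ≤ 1 := by
  simpa using finrank_span_le_card (R := ℝ) {v}

/-- If each vector of a finite family lies in the plane spanned by two others, then the rank of the
family is at most two thirds of its size. -/
lemma three_mul_finrank_span_le {k : ℕ} {V : Type*} [AddCommGroup V] [Module ℝ V]
    [FiniteDimensional ℝ V] (K : Fin k → V)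
    (h : ∀ c, ∃ a b, a ≠ b ∧ a ≠ c ∧ b ≠ c ∧ K c ∈ Submodule.span ℝ {K a, K b}) :
    3 * Module.finrank ℝ (Submodule.span ℝ (Set.range K)) ≤ 2 * k := by
  classical
  let sp : Finset (Fin k) → Submodule ℝ V := fun S => Submodule.span ℝ (K '' S)
  have hstep : ∀ (S : Finset (Fin k)) (b : Fin k),
      Module.finrank ℝ ↥(sp S ⊔ Submodule.span ℝ {K b}) ≤ Module.finrank ℝ (sp S) + 1 := fun S b =>
    (Submodule.finrank_add_le_finrank_add_finrank _ _).trans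
      (Nat.add_le_add_left (finrank_span_singleton_le_one _) _)
  have hsp : ∀ S T : Finset (Fin k), sp (S ∪ T) = sp S ⊔ sp T := fun S T => by
    simp only [sp, Finset.coe_union, Set.image_union, Submodule.span_union]
  -- S is a subfamily of largest size among those that satisfy the estimate; it turns out to span
  -- everything.
  obtain ⟨S, hS, hmax⟩ : ∃ S : Finset (Fin k), 3 * Module.finrank ℝ (sp S) ≤ 2 * S.card ∧
      ∀ T : Finset (Fin k), 3 * Module.finrank ℝ (sp T) ≤ 2 * T.card → T.card ≤ S.card := by
    obtain ⟨S, hS, hm⟩ := (Finset.univ.filter fun S : Finset (Fin k) =>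
      3 * Module.finrank ℝ (sp S) ≤ 2 * S.card).exists_max_image Finset.card
        ⟨∅, by simp [sp]⟩
    exact ⟨S, (Finset.mem_filter.1 hS).2, fun T hT => hm T (by simp [hT])⟩
  have hmem : ∀ i, i ∈ S → K i ∈ sp S := fun i hi => Submodule.subset_span ⟨i, hi, rfl⟩
  -- Adjoining b and c adds two members and at most one to the rank. As 3 ≤ 4, the estimate
  -- survives, against maximality.
  have exch : ∀ a b c, a ≠ b → a ≠ c → b ≠ c → K c ∈ Submodule.span ℝ {K a, K b} →
      K c ∉ sp S → K a ∈ sp S → False := by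
    intro a b c hab hac hbc hc hcS haS
    obtain ⟨s, t, hst⟩ := Submodule.mem_span_pair.1 hc
    have hbS : K b ∉ sp S := fun hb => hcS (by
      rw [← hst]; exact Submodule.add_mem _ (Submodule.smul_mem _ _ haS) (Submodule.smul_mem _ _ hb))
    have hle : sp (S ∪ {b, c}) ≤ sp S ⊔ Submodule.span ℝ {K b} := by
      rw [hsp]
      refine sup_le le_sup_left (Submodule.span_le.2 ?_)
      rintro _ ⟨i, hi, rfl⟩
      have hb' : K b ∈ sp S ⊔ Submodule.span ℝ {K b} :=
        Submodule.mem_sup_right (Submodule.mem_span_singleton_self _)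
      simp only [Finset.coe_insert, Finset.coe_singleton, Set.mem_insert_iff,
        Set.mem_singleton_iff] at hi
      rcases hi with rfl | rfl
      · exact hb'
      · rw [SetLike.mem_coe, ← hst]
        exact Submodule.add_mem _ (Submodule.smul_mem _ _ (Submodule.mem_sup_left haS))
          (Submodule.smul_mem _ _ hb')
    have hcard : (S ∪ {b, c}).card = S.card + 2 := by
      rw [Finset.card_union_of_disjoint, Finset.card_pair hbc]
      rw [Finset.disjoint_right]
      intro i hi hiS
      simp only [Finset.mem_insert, Finset.mem_singleton] at hi
      rcases hi with rfl | rfl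
      · exact hbS (hmem _ hiS)
      · exact hcS (hmem _ hiS)
    have h1 := (Submodule.finrank_mono hle).trans (hstep S b)
    have h2 := hmax (S ∪ {b, c}) (by omega)
    omega
  -- If neither K a nor K b lies in the span of S, adjoining a, b and c adds three members and at
  -- most two to the rank; 6 ≤ 6 is just enough.
  have hall : ∀ c, K c ∈ sp S := by
    intro c
    by_contra hcS
    obtain ⟨a, b, hab, hac, hbc, hc⟩ := h c
    have haS : K a ∉ sp S := fun ha => exch a b c hab hac hbc hc hcS ha
    have hbS : K b ∉ sp S := fun hb => exch b a c hab.symm hbc hac (by rwa [Set.pair_comm]) hcS hb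
    obtain ⟨s, t, hst⟩ := Submodule.mem_span_pair.1 hc
    have hle : sp (S ∪ {a, b, c}) ≤ (sp (S) ⊔ Submodule.span ℝ {K a}) ⊔ Submodule.span ℝ {K b} := by
      rw [hsp]
      refine sup_le (le_sup_left.trans le_sup_left) (Submodule.span_le.2 ?_)
      rintro _ ⟨i, hi, rfl⟩
      have ha' : K a ∈ (sp S ⊔ Submodule.span ℝ {K a}) ⊔ Submodule.span ℝ {K b} :=
        Submodule.mem_sup_left (Submodule.mem_sup_right (Submodule.mem_span_singleton_self _))
      have hb' : K b ∈ (sp S ⊔ Submodule.span ℝ {K a}) ⊔ Submodule.span ℝ {K b} :=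
        Submodule.mem_sup_right (Submodule.mem_span_singleton_self _)
      simp only [Finset.coe_insert, Finset.coe_singleton, Set.mem_insert_iff,
        Set.mem_singleton_iff] at hi
      rcases hi with rfl | rfl | rfl
      · exact ha'
      · exact hb'
      · rw [SetLike.mem_coe, ← hst]
        exact Submodule.add_mem _ (Submodule.smul_mem _ _ ha') (Submodule.smul_mem _ _ hb')
    have hcard : (S ∪ {a, b, c}).card = S.card + 3 := by
      rw [Finset.card_union_of_disjoint, Finset.card_eq_three.2 ⟨a, b, c, hab, hac, hbc, rfl⟩]
      rw [Finset.disjoint_right]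
      intro i hi hiS
      simp only [Finset.mem_insert, Finset.mem_singleton] at hi
      rcases hi with rfl | rfl | rfl
      · exact haS (hmem _ hiS)
      · exact hbS (hmem _ hiS)
      · exact hcS (hmem _ hiS)
    have h1 := Submodule.finrank_mono hle
    have h2 : Module.finrank ℝ ↥((sp S ⊔ Submodule.span ℝ {K a}) ⊔ Submodule.span ℝ {K b}) ≤
        Module.finrank ℝ ↥(sp S ⊔ Submodule.span ℝ {K a}) + 1 :=
      (Submodule.finrank_add_le_finrank_add_finrank _ _).trans
        (Nat.add_le_add_left (finrank_span_singleton_le_one _) _)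
    have h3 := hstep S a
    have h4 := hmax (S ∪ {a, b, c}) (by omega)
    omega
  have hle : Submodule.span ℝ (Set.range K) ≤ sp S :=
    Submodule.span_le.2 (by rintro _ ⟨i, rfl⟩; exact hall i)
  have h1 := Submodule.finrank_mono hle
  have h2 : S.card ≤ k := by simpa using Finset.card_le_univ S
  omega

/-- If every nonempty open set contains a nonempty good open set, then there is an open dense set
each of whose components is contained in a good open set. -/
lemma exists_isOpen_dense_components {X : Type*} [TopologicalSpace X] (good : Set X → Prop)
    (h : ∀ U : Set X, IsOpen U → U.Nonempty → ∃ V ⊆ U, IsOpen V ∧ V.Nonempty ∧ good V) :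
    ∃ W : Set X, IsOpen W ∧ Dense W ∧
      ∀ x ∈ W, ∃ V, IsOpen V ∧ good V ∧ connectedComponentIn W x ⊆ V := by
  let P : Set (Set (Set X)) :=
    {C | (∀ V ∈ C, IsOpen V ∧ V.Nonempty ∧ good V) ∧ C.PairwiseDisjoint id}
  -- Disjointness is essential: it makes each component of the union stay inside a single member.
  obtain ⟨C, hC⟩ : ∃ C, Maximal (· ∈ P) C := by
    refine zorn_subset P ?_
    intro c hc hchain
    refine ⟨⋃₀ c, ⟨?_, ?_⟩, fun s hs => Set.subset_sUnion_of_mem hs⟩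
    · rintro V ⟨s, hs, hV⟩
      exact (hc hs).1 V hV
    · exact (Set.pairwiseDisjoint_sUnion hchain.directedOn).2 fun s hs => (hc hs).2
  have hCo : ∀ V ∈ C, IsOpen V := fun V hV => (hC.prop.1 V hV).1
  refine ⟨⋃₀ C, isOpen_sUnion hCo, ?_, ?_⟩
  · by_contra hd
    have hne : (closure (⋃₀ C))ᶜ.Nonempty := by
      rw [Set.nonempty_compl]
      exact fun hh => hd (dense_iff_closure_eq.2 hh)
    obtain ⟨V, hVU, hVo, hVn, hVg⟩ := h _ isClosed_closure.isOpen_compl hne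
    have hdisj : ∀ A ∈ C, Disjoint V A := fun A hA =>
      Set.disjoint_left.2 fun x hx hxA => hVU hx (subset_closure ⟨A, hA, hxA⟩)
    have hmem : insert V C ∈ P := by
      refine ⟨?_, ?_⟩
      · rintro A (rfl | hA)
        · exact ⟨hVo, hVn, hVg⟩
        · exact hC.prop.1 A hA
      · exact hC.prop.2.insert fun A hA _ => hdisj A hA
    have hVC : V ∈ C := hC.le_of_ge hmem (Set.subset_insert _ _) (Set.mem_insert _ _)
    obtain ⟨x, hx⟩ := hVn
    exact Set.disjoint_left.1 (hdisj V hVC) hx hx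
  · rintro x ⟨V, hV, hxV⟩
    refine ⟨V, hCo V hV, (hC.prop.1 V hV).2.2, ?_⟩
    -- V and the union of the other members separate the union into two open sets, and the component
    -- meets V.
    have hV' : IsOpen (⋃₀ (C \ {V})) := isOpen_sUnion fun A hA => hCo A hA.1
    refine IsPreconnected.subset_left_of_subset_union (hCo V hV) hV' ?_ ?_ ?_
      isPreconnected_connectedComponentIn
    · rw [Set.disjoint_sUnion_right]
      exact fun A hA => hC.prop.2 hV hA.1 fun hh => hA.2 hh.symm
    · intro y hy
      obtain ⟨A, hA, hyA⟩ := connectedComponentIn_subset _ _ hy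
      by_cases hAV : A = V
      · exact Or.inl (hAV ▸ hyA)
      · exact Or.inr ⟨A, ⟨hA, hAV⟩, hyA⟩
    · exact ⟨x, mem_connectedComponentIn ⟨V, hV, hxV⟩, hxV⟩

/-! ### Smooth dependence of simple zeros. -/

section Roots

variable {E : Type*} [NormedAddCommGroup E] [NormedSpace ℝ E] [CompleteSpace E]

lemma isInvertible_of_apply_one_ne_zero {L : ℝ →L[ℝ] ℝ} (h : L 1 ≠ 0) : L.IsInvertible := by
  refine ⟨ContinuousLinearEquiv.unitsEquivAut ℝ (Units.mk0 (L 1) h), ?_⟩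
  ext
  simp

/-- A simple zero of a smooth function extends to a smooth family of zeros. -/
lemma exists_contDiffOn_root {G : E × ℝ → ℝ} {Ω : Set E} (hΩ : IsOpen Ω)
    (hG : ContDiffOn ℝ ∞ G (Ω ×ˢ Set.univ)) {y₀ : E} (hy₀ : y₀ ∈ Ω) {t₀ : ℝ}
    (h₀ : G (y₀, t₀) = 0) (hd : fderiv ℝ G (y₀, t₀) (0, 1) ≠ 0) :
    ∃ Ω' ⊆ Ω, IsOpen Ω' ∧ y₀ ∈ Ω' ∧ ∃ ρ : E → ℝ, ContDiffOn ℝ ∞ ρ Ω' ∧ ρ y₀ = t₀ ∧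
      ∀ y ∈ Ω', G (y, ρ y) = 0 := by
  have hGat : ∀ y ∈ Ω, ∀ t, ContDiffAt ℝ ∞ G (y, t) := fun y hy t =>
    hG.contDiffAt ((hΩ.prod isOpen_univ).mem_nhds ⟨hy, Set.mem_univ _⟩)
  have hinv : ∀ u : E × ℝ, fderiv ℝ G u (0, 1) ≠ 0 →
      (fderiv ℝ G u ∘L .inr ℝ E ℝ).IsInvertible := fun u hu =>
    isInvertible_of_apply_one_ne_zero (by simpa using hu)
  have htop : (∞ : ℕ∞ω) ≠ 0 := by simp
  let ρ := (hGat y₀ hy₀ t₀).implicitFunction htop (hinv _ hd)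
  have hρ₀ : ρ y₀ = t₀ := (hGat y₀ hy₀ t₀).implicitFunction_apply_self htop (hinv _ hd)
  have hρG : ∀ᶠ y in 𝓝 y₀, G (y, ρ y) = 0 := by
    have := (hGat y₀ hy₀ t₀).eventually_apply_implicitFunction htop (hinv _ hd)
    rw [h₀] at this
    exact this
  have hρc : ∀ᶠ y in 𝓝 y₀, ContinuousAt ρ y := by
    have h1 : ContDiffAt ℝ 1 ρ y₀ :=
      ((hGat y₀ hy₀ t₀).contDiffAt_implicitFunction htop (hinv _ hd)).of_le (by simp)
    filter_upwards [h1.eventually (by simp)] with y hy using hy.continuousAt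
  have hdc : ∀ᶠ y in 𝓝 y₀, fderiv ℝ G (y, ρ y) (0, 1) ≠ 0 := by
    have h1 : ContinuousAt (fun u => fderiv ℝ G u (0, 1)) (y₀, ρ y₀) := by
      rw [hρ₀]
      have := ((hGat y₀ hy₀ t₀).fderiv_right (m := 0) (by simp)).continuousAt
      exact this.clm_apply continuousAt_const
    have h2 : ContinuousAt (fun y => fderiv ℝ G (y, ρ y) (0, 1)) y₀ :=
      ContinuousAt.comp (f := fun y => (y, ρ y)) h1
        (continuousAt_id.prodMk hρc.self_of_nhds)
    refine h2.eventually_ne ?_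
    rw [hρ₀]; exact hd
  obtain ⟨Ω', hsub, hΩ', hy₀'⟩ := eventually_nhds_iff.1
    ((hΩ.eventually_mem hy₀).and (hρG.and (hρc.and hdc)))
  refine ⟨Ω', fun y hy => (hsub y hy).1, hΩ', hy₀', ρ, ?_, hρ₀, fun y hy => (hsub y hy).2.1⟩
  intro y hy
  obtain ⟨hyΩ, hGy, hcy, hdy⟩ := hsub y hy
  -- Being C^∞ at y₀ alone does not give one neighborhood for all orders. At every y, ρ is therefore
  -- compared with the implicit function based at (y, ρ y); they agree near y by local uniqueness
  -- and continuity of ρ.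
  have hψ := (hGat y hyΩ (ρ y)).contDiffAt_implicitFunction htop (hinv _ hdy)
  refine (hψ.congr_of_eventuallyEq ?_).contDiffWithinAt
  have h1 := (hGat y hyΩ (ρ y)).eventually_apply_eq_iff_implicitFunction htop (hinv _ hdy)
  have h2 : Filter.Tendsto (fun z => (z, ρ z)) (𝓝 y) (𝓝 (y, ρ y)) :=
    continuousAt_id.prodMk hcy
  filter_upwards [h2.eventually h1, hΩ'.mem_nhds hy] with z hz hzΩ
  exact (hz.1 (by rw [(hsub z hzΩ).2.1, hGy])).symm

end Roots

/-! ### Spectral decompositions and Krylov maps. -/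

section Spectral

variable {F : Type*} [NormedAddCommGroup F] [InnerProductSpace ℝ F] {k : ℕ}

/-- `A = ∑ μ i • Q i`, where the `Q i` are mutually annihilating projections with sum `P`. -/
structure IsSpectralDecomposition (A P : F →L[ℝ] F) (μ : Fin k → ℝ) (Q : Fin k → F →L[ℝ] F) :
    Prop where
  idem : ∀ i z, Q i (Q i z) = Q i z
  ortho : ∀ i j, i ≠ j → ∀ z, Q i (Q j z) = 0
  sum : ∀ z, ∑ i, Q i z = P z
  eig : ∀ z, ∑ i, μ i • Q i z = A z

lemma IsSpectralDecomposition.apply_sum {A P : F →L[ℝ] F} {μ : Fin k → ℝ}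
    {Q : Fin k → F →L[ℝ] F} (h : IsSpectralDecomposition A P μ Q) (w : Fin k → ℝ) (z : F)
    (i : Fin k) : Q i (∑ j, w j • Q j z) = w i • Q i z := by
  rw [map_sum, Finset.sum_eq_single i]
  · rw [map_smul, h.idem]
  · intro j _ hj
    rw [map_smul, h.ortho i j hj.symm, smul_zero]
  · simp

lemma IsSpectralDecomposition.pow_apply {A P : F →L[ℝ] F} {μ : Fin k → ℝ}
    {Q : Fin k → F →L[ℝ] F} (h : IsSpectralDecomposition A P μ Q) (j : ℕ) (z : F) :
    (A ^ j) (P z) = ∑ i, μ i ^ j • Q i z := by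
  induction j with
  | zero => simp [h.sum]
  | succ j ih =>
    rw [pow_succ', mul_apply_eq_comp, ih, ← h.eig]
    refine Finset.sum_congr rfl fun i _ => ?_
    rw [h.apply_sum, smul_smul, pow_succ']

lemma IsSpectralDecomposition.list_prod_apply {A P : F →L[ℝ] F} {μ : Fin k → ℝ}
    {Q : Fin k → F →L[ℝ] F} (h : IsSpectralDecomposition A P μ Q) {ι : Type*} (ρ : ι → ℝ)
    (l : List ι) (z : F) :
    (l.map fun j => A - ρ j • P).prod (P z) = ∑ i, (l.map fun j => μ i - ρ j).prod • Q i z := by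
  induction l with
  | nil => simp [h.sum]
  | cons a l ih =>
    rw [List.map_cons, List.prod_cons, mul_apply_eq_comp, ih, sub_apply,
      smul_apply, ← h.eig, ← h.sum, Finset.smul_sum, ← Finset.sum_sub_distrib]
    refine Finset.sum_congr rfl fun i _ => ?_
    rw [h.apply_sum, smul_smul, smul_smul, ← sub_smul, List.map_cons, List.prod_cons, sub_mul]

/-- The map `c ↦ ∑ j, c j • A ^ j (P a)`. -/
def krylov (k : ℕ) (A P : F →L[ℝ] F) (a : F) : EuclideanSpace ℝ (Fin k) →L[ℝ] F :=
  ∑ j : Fin k, (EuclideanSpace.proj j).smulRight ((A ^ (j : ℕ)) (P a))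

lemma krylov_apply (A P : F →L[ℝ] F) (a : F) (c : EuclideanSpace ℝ (Fin k)) :
    krylov k A P a c = ∑ j : Fin k, c j • (A ^ (j : ℕ)) (P a) := by
  simp [krylov]

lemma IsSpectralDecomposition.krylov_apply {A P : F →L[ℝ] F} {μ : Fin k → ℝ}
    {Q : Fin k → F →L[ℝ] F} (h : IsSpectralDecomposition A P μ Q) (a : F)
    (c : EuclideanSpace ℝ (Fin k)) :
    krylov k A P a c = ∑ i, (Matrix.vandermonde μ).mulVec c i • Q i a := by
  rw [DupinSubmanifold.krylov_apply]
  simp only [h.pow_apply, Finset.smul_sum, Matrix.mulVec, dotProduct, Finset.sum_smul,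
    Matrix.vandermonde_apply, smul_smul]
  rw [Finset.sum_comm]
  simp only [mul_comm]

/-- In the independent vectors Q i a, the Krylov map is the Vandermonde matrix of the eigenvalues.
-/
lemma IsSpectralDecomposition.krylov_injective {A P : F →L[ℝ] F} {μ : Fin k → ℝ}
    {Q : Fin k → F →L[ℝ] F} (h : IsSpectralDecomposition A P μ Q) {a : F}
    (hμ : Function.Injective μ) (ha : ∀ i, Q i a ≠ 0) : Function.Injective (krylov k A P a) := by
  rw [injective_iff_map_eq_zero]
  intro c hc
  rw [h.krylov_apply] at hc
  have h1 : (Matrix.vandermonde μ).mulVec c = 0 := by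
    ext i
    have := congrArg (Q i) hc
    rw [h.apply_sum, map_zero, smul_eq_zero] at this
    exact this.resolve_right (ha i)
  have h2 := Matrix.eq_zero_of_mulVec_eq_zero (Matrix.det_vandermonde_ne_zero_iff.2 hμ) h1
  ext j
  exact congrFun h2 j

/-- Injectivity of the Krylov map is an open condition, so this converse carries distinctness of the
eigenvalues and nonvanishing of the components of a from one point to its neighbors. No continuity
of μ or Q is needed. -/
lemma IsSpectralDecomposition.of_krylov_injective {A P : F →L[ℝ] F} {μ : Fin k → ℝ}
    {Q : Fin k → F →L[ℝ] F} (h : IsSpectralDecomposition A P μ Q) {a : F}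
    (hk : Function.Injective (krylov k A P a)) :
    Function.Injective μ ∧ (∀ i, Q i a ≠ 0) ∧
      (A ^ k) (P a) ∈ LinearMap.range (krylov k A P a).toLinearMap := by
  have hdet : (Matrix.vandermonde μ).det ≠ 0 := by
    intro h0
    obtain ⟨v, hv, hv0⟩ := Matrix.exists_mulVec_eq_zero_iff.2 h0
    apply hv
    have : krylov k A P a (WithLp.toLp 2 v) = 0 := by
      rw [h.krylov_apply]
      simp [hv0]
    have h2 := hk (this.trans (map_zero _).symm)
    exact congrArg WithLp.ofLp h2
  have hsurj : ∀ w : Fin k → ℝ, ∃ c : EuclideanSpace ℝ (Fin k),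
      (Matrix.vandermonde μ).mulVec c = w := fun w =>
    ⟨WithLp.toLp 2 ((Matrix.vandermonde μ)⁻¹.mulVec w), by
      simp [Matrix.mulVec_mulVec, Matrix.mul_nonsing_inv _ (isUnit_iff_ne_zero.2 hdet)]⟩
  refine ⟨Matrix.det_vandermonde_ne_zero_iff.1 hdet, fun i hi => ?_, ?_⟩
  · obtain ⟨c, hc⟩ := hsurj (Pi.single i 1)
    have : krylov k A P a c = 0 := by
      rw [h.krylov_apply, hc, Finset.sum_eq_single i]
      · simp [hi]
      · intro j _ hj; simp [hj]
      · simp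
    have h2 := hk (this.trans (map_zero _).symm)
    rw [h2] at hc
    have := congrFun hc i
    simp at this
  · obtain ⟨c, hc⟩ := hsurj fun i => μ i ^ k
    refine ⟨c, ?_⟩
    change krylov k A P a c = _
    rw [h.krylov_apply, hc, h.pow_apply]

/-- A polynomial of degree `k` vanishing on `k` distinct points is the nodal polynomial. -/
lemma pow_sub_sum_eq_prod {μ c : Fin k → ℝ} (hμ : Function.Injective μ)
    (h : ∀ i, μ i ^ k - ∑ j : Fin k, c j * μ i ^ (j : ℕ) = 0) (t : ℝ) :
    t ^ k - ∑ j : Fin k, c j * t ^ (j : ℕ) = ∏ i, (t - μ i) := by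
  open Polynomial in
  let r : ℝ[X] := ∑ j : Fin k, C (c j) * X ^ (j : ℕ)
  let p : ℝ[X] := X ^ k - r
  have hr : r.degree < k := by
    refine (Polynomial.degree_sum_le _ _).trans_lt ((Finset.sup_lt_iff ?_).2 fun j _ => ?_)
    · exact WithBot.bot_lt_coe k
    · exact (Polynomial.degree_C_mul_X_pow_le _ _).trans_lt (by exact_mod_cast j.2)
  have hev : ∀ s, p.eval s = s ^ k - ∑ j : Fin k, c j * s ^ (j : ℕ) := fun s => by
    simp [p, r, Polynomial.eval_finsetSum]
  have hnod : ∀ s, (Lagrange.nodal Finset.univ μ).eval s = ∏ i, (s - μ i) := fun s =>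
    Lagrange.eval_nodal
  have hpm : p.Monic := Polynomial.monic_X_pow_sub (n := k) hr
  have hpd : p.degree = k := by
    simp only [p]
    rw [Polynomial.degree_sub_eq_left_of_degree_lt (by rwa [Polynomial.degree_X_pow])]
    exact Polynomial.degree_X_pow _
  have heq : p = Lagrange.nodal Finset.univ μ := by
    refine Polynomial.eq_of_degree_sub_lt_of_eval_index_eq Finset.univ hμ.injOn ?_ ?_
    · have h1 : (Lagrange.nodal Finset.univ μ).degree = k := by
        simp [Lagrange.degree_nodal]
      have := Polynomial.degree_sub_lt_left (hpd.trans h1.symm) hpm.ne_zero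
        (hpm.leadingCoeff.trans (Lagrange.nodal_monic (s := Finset.univ) (v := μ)).leadingCoeff.symm)
      rw [hpd] at this
      simpa using this
    · intro i _
      rw [hev, h, hnod]
      exact (Finset.prod_eq_zero (Finset.mem_univ i) (sub_self _)).symm
  rw [← hev, heq, hnod]

lemma contDiffOn_list_prod {E ι : Type*} [NormedAddCommGroup E]
    [NormedSpace ℝ E] {Ω : Set E} {B : ι → E → F →L[ℝ] F} (l : List ι)
    (h : ∀ j ∈ l, ContDiffOn ℝ ∞ (B j) Ω) :
    ContDiffOn ℝ ∞ (fun y => (l.map fun j => B j y).prod) Ω := by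
  induction l with
  | nil => simpa using contDiffOn_const
  | cons a l ih =>
    simp only [List.map_cons, List.prod_cons]
    exact (h a (by simp)).mul (ih fun j hj => h j (by simp [hj]))

end Spectral

/-! ### Smooth spectral projections. -/

section SmoothSpectral

variable {E : Type*} [NormedAddCommGroup E] [NormedSpace ℝ E] [CompleteSpace E]
  {F : Type*} [NormedAddCommGroup F] [InnerProductSpace ℝ F] [FiniteDimensional ℝ F] {k : ℕ}

/-- A smooth family of diagonalizable operators with a constant number of eigenvalues has smooth
spectral projections, up to the numbering of the eigenvalues. -/
theorem exists_contDiffOn_spectral {Ω : Set E} (hΩ : IsOpen Ω) {y₀ : E} (hy₀ : y₀ ∈ Ω)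
    {A P : E → F →L[ℝ] F} (hA : ContDiffOn ℝ ∞ A Ω) (hP : ContDiffOn ℝ ∞ P Ω)
    {μ : E → Fin k → ℝ} {Q : E → Fin k → F →L[ℝ] F}
    (h : ∀ y ∈ Ω, IsSpectralDecomposition (A y) (P y) (μ y) (Q y))
    (hμ₀ : Function.Injective (μ y₀)) (hQ₀ : ∀ i, Q y₀ i ≠ 0) :
    ∃ Ω' ⊆ Ω, IsOpen Ω' ∧ y₀ ∈ Ω' ∧ ∃ σ : E → Equiv.Perm (Fin k),
      ∀ i, ContDiffOn ℝ ∞ (fun y => Q y (σ y i)) Ω' := by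
  have hex : ∀ i, ∃ z, Q y₀ i z ≠ 0 := fun i => by
    by_contra! hz
    exact hQ₀ i (ContinuousLinearMap.ext hz)
  choose b hb using hex
  -- A cyclic vector: it has a nonzero component in each eigenspace at y₀.
  let a := ∑ i, Q y₀ i (b i)
  have ha : ∀ i, Q y₀ i a ≠ 0 := fun i => by
    simp only [a, map_sum]
    rw [Finset.sum_eq_single i]
    · rw [(h y₀ hy₀).idem]; exact hb i
    · intro j _ hj; exact (h y₀ hy₀).ortho i j hj.symm _
    · simp
  have hpow : ∀ j, ContDiffOn ℝ ∞ (fun y => (A y ^ j) (P y a)) Ω := fun j =>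
    (hA.pow j).clm_apply (hP.clm_apply contDiffOn_const)
  let S : E → EuclideanSpace ℝ (Fin k) →L[ℝ] F := fun y => krylov k (A y) (P y) a
  have hS : ContDiffOn ℝ ∞ S Ω := by
    refine ContDiffOn.sum fun j _ => ?_
    exact (ContinuousLinearMap.smulRightL ℝ _ F (EuclideanSpace.proj j)).contDiff.comp_contDiffOn
      (hpow j)
  have hS₀ : Function.Injective (S y₀) := (h y₀ hy₀).krylov_injective hμ₀ ha
  have hSev : ∀ᶠ y in 𝓝 y₀, Function.Injective (S y) :=
    (hS.contDiffAt (hΩ.mem_nhds hy₀)).continuousAt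
      (ContinuousLinearMap.isOpen_injective.mem_nhds hS₀)
  obtain ⟨Ω₁, hΩ₁, hΩ₁o, hy₁⟩ := eventually_nhds_iff.1 ((hΩ.eventually_mem hy₀).and hSev)
  have hSinj : ∀ y ∈ Ω₁, Function.Injective (S y) := fun y hy => (hΩ₁ y hy).2
  have hΩ₁sub : Ω₁ ⊆ Ω := fun y hy => (hΩ₁ y hy).1
  -- The coefficients of A^k (P a) in the basis A^j (P a), j < k. They are smooth in y, and applying
  -- Q i shows that the monic polynomial they define vanishes at every eigenvalue.
  let c : E → EuclideanSpace ℝ (Fin k) := fun y => pseudoInverse (S y) ((A y ^ k) (P y a))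
  have hc : ContDiffOn ℝ ∞ c Ω₁ := by
    intro y hy
    have h1 : ContDiffAt ℝ ∞ (fun y => pseudoInverse (S y)) y :=
      (contDiffAt_pseudoInverse (hSinj y hy)).comp y
        (hS.contDiffAt (hΩ.mem_nhds (hΩ₁sub hy)))
    exact (h1.clm_apply ((hpow k).contDiffAt (hΩ.mem_nhds (hΩ₁sub hy)))).contDiffWithinAt
  have hroot : ∀ y ∈ Ω₁, ∀ i, μ y i ^ k - ∑ j : Fin k, c y j * μ y i ^ (j : ℕ) = 0 := by
    intro y hy i
    obtain ⟨-, hne, c', hc'⟩ := (h y (hΩ₁sub hy)).of_krylov_injective (hSinj y hy)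
    have h1 : S y (c y) = (A y ^ k) (P y a) := by
      simp only [c]
      rw [← hc']
      exact congrArg (S y) (pseudoInverse_apply (hSinj y hy) c')
    have h2 := congrArg (Q y i) h1
    rw [(h y (hΩ₁sub hy)).krylov_apply, (h y (hΩ₁sub hy)).apply_sum,
      (h y (hΩ₁sub hy)).pow_apply, (h y (hΩ₁sub hy)).apply_sum] at h2
    have h3 := smul_left_injective ℝ (hne i) h2
    rw [← h3, sub_eq_zero]
    simp [Matrix.mulVec, dotProduct, Matrix.vandermonde_apply, mul_comm]
  have hμinj : ∀ y ∈ Ω₁, Function.Injective (μ y) := fun y hy =>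
    ((h y (hΩ₁sub hy)).of_krylov_injective (hSinj y hy)).1
  -- The characteristic polynomial on the range of P, smooth in the parameter and with simple roots.
  let G : E × ℝ → ℝ := fun u => u.2 ^ k - ∑ j : Fin k, c u.1 j * u.2 ^ (j : ℕ)
  have hGprod : ∀ y ∈ Ω₁, ∀ t, G (y, t) = ∏ i, (t - μ y i) := fun y hy t =>
    pow_sub_sum_eq_prod (hμinj y hy) (hroot y hy) t
  have hG : ContDiffOn ℝ ∞ G (Ω₁ ×ˢ Set.univ) := by
    refine (contDiff_snd.pow k).contDiffOn.sub (ContDiffOn.sum fun j _ => ?_)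
    refine ContDiffOn.mul ?_ (contDiff_snd.pow _).contDiffOn
    have h1 : ContDiffOn ℝ ∞ (fun u : E × ℝ => c u.1) (Ω₁ ×ˢ Set.univ) :=
      hc.comp contDiff_fst.contDiffOn fun u hu => hu.1
    exact (EuclideanSpace.proj (𝕜 := ℝ) j).contDiff.comp_contDiffOn h1
  have hGd : ∀ i, fderiv ℝ G (y₀, μ y₀ i) (0, 1) ≠ 0 := by
    intro i
    have h1 : DifferentiableAt ℝ G (y₀, μ y₀ i) :=
      (hG.contDiffAt ((hΩ₁o.prod isOpen_univ).mem_nhds ⟨hy₁, Set.mem_univ _⟩)).differentiableAt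
        (by simp)
    have h2 : HasDerivAt (fun t => G (y₀, t)) (fderiv ℝ G (y₀, μ y₀ i) (0, 1)) (μ y₀ i) :=
      h1.hasFDerivAt.comp_hasDerivAt (μ y₀ i)
        ((hasDerivAt_const _ y₀).prodMk (hasDerivAt_id _))
    have h3 : HasDerivAt (fun t => G (y₀, t))
        (∏ j ∈ Finset.univ.erase i, (μ y₀ i - μ y₀ j)) (μ y₀ i) := by
      have h4 : (fun t => G (y₀, t))
          = fun t => (t - μ y₀ i) * ∏ j ∈ Finset.univ.erase i, (t - μ y₀ j) := by
        funext t
        rw [hGprod y₀ hy₁, Finset.mul_prod_erase _ (fun j => t - μ y₀ j) (Finset.mem_univ i)]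
      have h5 : DifferentiableAt ℝ (fun t : ℝ => ∏ j ∈ Finset.univ.erase i, (t - μ y₀ j))
          (μ y₀ i) := by fun_prop
      rw [h4]
      have h6 := ((hasDerivAt_id (μ y₀ i)).sub_const (μ y₀ i)).mul h5.hasDerivAt
      refine h6.congr_deriv ?_
      simp
    rw [h2.unique h3]
    exact Finset.prod_ne_zero_iff.2 fun j hj =>
      sub_ne_zero.2 (hμ₀.ne (Finset.ne_of_mem_erase hj).symm)
  have hρ := fun i => exists_contDiffOn_root hΩ₁o hG hy₁
    (t₀ := μ y₀ i) (by
      rw [hGprod y₀ hy₁]; exact Finset.prod_eq_zero (Finset.mem_univ i) (sub_self _)) (hGd i)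
  choose Ω₂ hΩ₂ hΩ₂o hy₂ ρ hρs hρ₀ hρG using hρ
  have hdist : ∀ᶠ y in 𝓝 y₀, ∀ i j, i ≠ j → ρ i y ≠ ρ j y := by
    refine Filter.eventually_all.2 fun i => Filter.eventually_all.2 fun j => ?_
    by_cases hij : i = j
    · simp [hij]
    · have hci : ∀ i, ContinuousAt (ρ i) y₀ := fun i =>
        ((hρs i).contDiffAt ((hΩ₂o i).mem_nhds (hy₂ i))).continuousAt
      have h1 : ∀ᶠ y in 𝓝 y₀, ρ i y - ρ j y ≠ 0 :=
        ((hci i).sub (hci j)).eventually_ne (by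
          rw [Pi.sub_apply, hρ₀, hρ₀]; exact sub_ne_zero.2 (hμ₀.ne hij))
      filter_upwards [h1] with y hy _ using sub_ne_zero.1 hy
  obtain ⟨Ω₃, hΩ₃, hΩ₃o, hy₃⟩ := eventually_nhds_iff.1 (hdist.and
    ((hΩ₁o.eventually_mem hy₁).and
      (Filter.eventually_all.2 fun i => (hΩ₂o i).eventually_mem (hy₂ i))))
  -- The given numbering of the eigenvalues may jump from point to point; σ y matches it with the
  -- smooth roots ρ. These are k distinct roots of a polynomial with k roots, so the matching is a
  -- bijection.
  have hσ : ∀ y ∈ Ω₃, ∃ σ : Equiv.Perm (Fin k), ∀ i, ρ i y = μ y (σ i) := by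
    intro y hy
    have h1 : ∀ i, ∃ m, ρ i y = μ y m := fun i => by
      have h2 := hρG i y ((hΩ₃ y hy).2.2 i)
      rw [hGprod y (hΩ₃ y hy).2.1] at h2
      obtain ⟨m, -, hm⟩ := Finset.prod_eq_zero_iff.1 h2
      exact ⟨m, sub_eq_zero.1 hm⟩
    choose s hs using h1
    have hsinj : Function.Injective s := fun i j hij => by
      by_contra hne
      exact (hΩ₃ y hy).1 i j hne (by rw [hs, hs, hij])
    exact ⟨Equiv.ofBijective s (Finite.injective_iff_bijective.1 hsinj), hs⟩
  classical
  choose! σ hσ using hσ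
  refine ⟨Ω₃, fun y hy => hΩ₁sub (hΩ₃ y hy).2.1, hΩ₃o, hy₃, σ, fun i => ?_⟩
  have hsub : ∀ j, Ω₃ ⊆ Ω₂ j := fun j y hy => (hΩ₃ y hy).2.2 j
  have hsubΩ : Ω₃ ⊆ Ω := fun y hy => hΩ₁sub (hΩ₃ y hy).2.1
  let l := (Finset.univ.erase i).toList
  -- Lagrange interpolation: the projection onto one eigenspace is the product of the A - ρ j P over
  -- the other roots, divided by its value at that eigenvalue.
  have hform : ∀ y ∈ Ω₃, Q y (σ y i) = (l.map fun j => ρ i y - ρ j y).prod⁻¹ •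
      (l.map fun j => A y - ρ j y • P y).prod ∘L P y := by
    intro y hy
    ext z
    have hlp : ∀ t : ℝ, (l.map fun j => t - ρ j y).prod
        = ∏ j ∈ Finset.univ.erase i, (t - ρ j y) := fun t => Finset.prod_map_toList _ _
    have hne : (l.map fun j => ρ i y - ρ j y).prod ≠ 0 := by
      rw [hlp]
      exact Finset.prod_ne_zero_iff.2 fun j hj =>
        sub_ne_zero.2 ((hΩ₃ y hy).1 i j (Finset.ne_of_mem_erase hj).symm)
    rw [smul_apply, ContinuousLinearMap.comp_apply,
      (h y (hsubΩ hy)).list_prod_apply (fun j => ρ j y), Finset.sum_eq_single (σ y i)]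
    · rw [← hσ y hy i, smul_smul, inv_mul_cancel₀ hne, one_smul]
    · intro m _ hm
      rw [hlp, Finset.prod_eq_zero (i := (σ y).symm m), zero_smul]
      · refine Finset.mem_erase.2 ⟨?_, Finset.mem_univ _⟩
        rintro rfl
        simp at hm
      · rw [hσ y hy, Equiv.apply_symm_apply, sub_self]
    · simp
  refine ContDiffOn.congr ?_ hform
  have hρ' : ∀ j, ContDiffOn ℝ ∞ (ρ j) Ω₃ := fun j => (hρs j).mono (hsub j)
  have hprod : ContDiffOn ℝ ∞ (fun y => (l.map fun j => ρ i y - ρ j y).prod) Ω₃ := by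
    have : (fun y => (l.map fun j => ρ i y - ρ j y).prod)
        = fun y => ∏ j ∈ Finset.univ.erase i, (ρ i y - ρ j y) := by
      funext y; exact Finset.prod_map_toList _ _
    rw [this]
    exact contDiffOn_prod fun j _ => (hρ' i).sub (hρ' j)
  refine (hprod.inv fun y hy => ?_).smul ((contDiffOn_list_prod l fun j _ =>
    (hA.mono hsubΩ).sub ((hρ' j).smul (hP.mono hsubΩ))).clm_comp (hP.mono hsubΩ))
  rw [Finset.prod_map_toList]
  exact Finset.prod_ne_zero_iff.2 fun j hj =>
    sub_ne_zero.2 ((hΩ₃ y hy).1 i j (Finset.ne_of_mem_erase hj).symm)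

end SmoothSpectral

/-! ### Calculus on the manifold in charts. -/

section Derivatives

variable {n : ℕ} {M : Type*} [TopologicalSpace M] [ChartedSpace (EuclideanSpace ℝ (Fin n)) M]
  {G : Type*} [NormedAddCommGroup G] [NormedSpace ℝ G]
  {G' : Type*} [NormedAddCommGroup G'] [NormedSpace ℝ G']

variable (n) in
/-- The differential at `x` of a map from the manifold `M` to a normed space. -/
def mdiff (h : M → G) (x : M) : EuclideanSpace ℝ (Fin n) →L[ℝ] G :=
  mfderiv (𝓡 n) 𝓘(ℝ, G) h x

variable (n) in
/-- The map `h` read in the preferred chart at `x`. -/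
def inChart (h : M → G) (x : M) : EuclideanSpace ℝ (Fin n) → G :=
  h ∘ (extChartAt (𝓡 n) x).symm

/-- A vector field as a map to the model space, through the identification of each tangent space
with `ℝ^n`. -/
def vec (X : (x : M) → TangentSpace (𝓡 n) x) (x : M) : EuclideanSpace ℝ (Fin n) := X x

lemma inChart_apply_self (h : M → G) (x : M) : inChart n h x (extChartAt (𝓡 n) x x) = h x := by
  simp [inChart]

variable (n) in
/-- The isomorphism from `ℝ^n` to the tangent space induced by the chart at `x`. -/
def tangentChart (x : M) (y : EuclideanSpace ℝ (Fin n)) :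
    EuclideanSpace ℝ (Fin n) →L[ℝ] EuclideanSpace ℝ (Fin n) :=
  mfderivWithin 𝓘(ℝ, EuclideanSpace ℝ (Fin n)) (𝓡 n) (extChartAt (𝓡 n) x).symm (Set.range (𝓡 n)) y

lemma mdiff_eq_fderiv {h : M → G} {x : M} (hh : MDifferentiableAt (𝓡 n) 𝓘(ℝ, G) h x) :
    mdiff n h x = fderiv ℝ (inChart n h x) (extChartAt (𝓡 n) x x) := by
  have h1 : mdiff n h x = fderivWithin ℝ (writtenInExtChartAt (𝓡 n) 𝓘(ℝ, G) x h)
      (Set.range (𝓡 n)) (extChartAt (𝓡 n) x x) := if_pos hh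
  rw [h1, ModelWithCorners.range_eq_univ, fderivWithin_univ]
  rfl

lemma isOpen_target (x : M) : IsOpen (extChartAt (𝓡 n) x).target := isOpen_extChartAt_target x

variable [IsManifold (𝓡 n) ∞ M]

lemma isInvertible_tangentChart {x : M} {y : EuclideanSpace ℝ (Fin n)}
    (hy : y ∈ (extChartAt (𝓡 n) x).target) : (tangentChart n x y).IsInvertible :=
  isInvertible_mfderivWithin_extChartAt_symm hy

variable (n) in
lemma tangentChart_self (x : M) :
    tangentChart n x (extChartAt (𝓡 n) x x) = ContinuousLinearMap.id ℝ _ :=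
  mfderivWithin_range_extChartAt_symm

lemma surjective_tangentChart {x : M} {y : EuclideanSpace ℝ (Fin n)}
    (hy : y ∈ (extChartAt (𝓡 n) x).target) : Function.Surjective (tangentChart n x y) := by
  obtain ⟨e, he⟩ := isInvertible_tangentChart hy
  rw [← he]
  exact e.surjective

lemma injective_tangentChart {x : M} {y : EuclideanSpace ℝ (Fin n)}
    (hy : y ∈ (extChartAt (𝓡 n) x).target) : Function.Injective (tangentChart n x y) := by
  obtain ⟨e, he⟩ := isInvertible_tangentChart hy
  rw [← he]
  exact e.injective

/-- `mdiff` at a point refers to the preferred chart of that point, which varies with y, whereas the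
left side uses the fixed chart at x. `tangentChart` is the change between the two. -/
lemma fderiv_inChart {h : M → G} {x : M} {y : EuclideanSpace ℝ (Fin n)}
    (hy : y ∈ (extChartAt (𝓡 n) x).target)
    (hh : MDifferentiableAt (𝓡 n) 𝓘(ℝ, G) h ((extChartAt (𝓡 n) x).symm y)) (v) :
    fderiv ℝ (inChart n h x) y v
      = mdiff n h ((extChartAt (𝓡 n) x).symm y) (tangentChart n x y v) := by
  have h1 := mdifferentiableWithinAt_extChartAt_symm (I := 𝓡 n) hy
  rw [ModelWithCorners.range_eq_univ, mdifferentiableWithinAt_univ] at h1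
  have h2 := mfderiv_comp y hh h1
  rw [mfderiv_eq_fderiv] at h2
  simp only [inChart, tangentChart, mdiff, ModelWithCorners.range_eq_univ, mfderivWithin_univ]
  rw [h2]; rfl

lemma contDiffOn_inChart {h : M → G} {U : Set M} (hh : ContMDiffOn (𝓡 n) 𝓘(ℝ, G) ∞ h U) (x : M) :
    ContDiffOn ℝ ∞ (inChart n h x)
      ((extChartAt (𝓡 n) x).target ∩ (extChartAt (𝓡 n) x).symm ⁻¹' U) := by
  rw [← contMDiffOn_iff_contDiffOn]
  exact hh.comp ((contMDiffOn_extChartAt_symm x).mono Set.inter_subset_left) fun y hy => hy.2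

lemma isOpen_target_inter {U : Set M} (hU : IsOpen U) (x : M) :
    IsOpen ((extChartAt (𝓡 n) x).target ∩ (extChartAt (𝓡 n) x).symm ⁻¹' U) :=
  (continuousOn_extChartAt_symm x).isOpen_inter_preimage (isOpen_target x) hU

lemma mem_preimage_symm {U : Set M} {x : M} (hx : x ∈ U) :
    extChartAt (𝓡 n) x x ∈ (extChartAt (𝓡 n) x).symm ⁻¹' U := by
  rwa [Set.mem_preimage, extChartAt_to_inv]

lemma isOpen_source_inter {V : Set (EuclideanSpace ℝ (Fin n))} (hV : IsOpen V) (x : M) :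
    IsOpen ((extChartAt (𝓡 n) x).source ∩ extChartAt (𝓡 n) x ⁻¹' V) :=
  (continuousOn_extChartAt x).isOpen_inter_preimage (isOpen_extChartAt_source x) hV

lemma contMDiffOn_comp_chart {g : EuclideanSpace ℝ (Fin n) → G} {V : Set (EuclideanSpace ℝ (Fin n))}
    (hg : ContDiffOn ℝ ∞ g V) (x : M) :
    ContMDiffOn (𝓡 n) 𝓘(ℝ, G) ∞ (g ∘ extChartAt (𝓡 n) x)
      ((extChartAt (𝓡 n) x).source ∩ extChartAt (𝓡 n) x ⁻¹' V) := by
  refine (contMDiffOn_iff_contDiffOn.2 hg).comp ?_ fun y hy => hy.2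
  refine (contMDiffOn_extChartAt (I := 𝓡 n) (x := x)).mono fun y hy => ?_
  rw [← extChartAt_source (𝓡 n)]; exact hy.1

lemma contMDiffAt_of_inChart {h : M → G} {x : M} {m : ℕ∞ω} [IsManifold (𝓡 n) m M]
    (hh : ContDiffAt ℝ m (inChart n h x) (extChartAt (𝓡 n) x x)) :
    ContMDiffAt (𝓡 n) 𝓘(ℝ, G) m h x := by
  have h1 : ContMDiffAt (𝓡 n) 𝓘(ℝ, G) m (inChart n h x ∘ extChartAt (𝓡 n) x) x :=
    (contMDiffAt_iff_contDiffAt.2 hh).comp x contMDiffAt_extChartAt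
  refine h1.congr_of_eventuallyEq ?_
  filter_upwards [extChartAt_source_mem_nhds (I := 𝓡 n) x] with z hz
  exact congrArg h ((extChartAt (𝓡 n) x).left_inv hz).symm

lemma mdifferentiableAt_of_inChart {h : M → G} {x : M}
    (hh : DifferentiableAt ℝ (inChart n h x) (extChartAt (𝓡 n) x x)) :
    MDifferentiableAt (𝓡 n) 𝓘(ℝ, G) h x := by
  have h1 : MDifferentiableAt (𝓡 n) 𝓘(ℝ, G) (inChart n h x ∘ extChartAt (𝓡 n) x) x :=
    (mdifferentiableAt_iff_differentiableAt.2 hh).comp x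
      (mdifferentiableAt_extChartAt (mem_chart_source _ x))
  refine h1.congr_of_eventuallyEq ?_
  filter_upwards [extChartAt_source_mem_nhds (I := 𝓡 n) x] with z hz
  exact congrArg h ((extChartAt (𝓡 n) x).left_inv hz).symm

lemma differentiableAt_inChart {h : M → G} {x : M}
    (hh : MDifferentiableAt (𝓡 n) 𝓘(ℝ, G) h x) :
    DifferentiableAt ℝ (inChart n h x) (extChartAt (𝓡 n) x x) := by
  have h1 : DifferentiableWithinAt ℝ (writtenInExtChartAt (𝓡 n) 𝓘(ℝ, G) x h)
      (Set.range (𝓡 n)) (extChartAt (𝓡 n) x x) := hh.differentiableWithinAt_writtenInExtChartAt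
  rw [ModelWithCorners.range_eq_univ, differentiableWithinAt_univ] at h1
  exact h1

lemma mdiff_congr {h h' : M → G} {x : M} (hh : h =ᶠ[𝓝 x] h') : mdiff n h x = mdiff n h' x :=
  hh.mfderiv_eq

/-- The product rule for the application of linear maps. -/
lemma mdiff_clm_apply {A : M → G →L[ℝ] G'} {g : M → G} {x : M}
    (hA : MDifferentiableAt (𝓡 n) 𝓘(ℝ, G →L[ℝ] G') A x)
    (hg : MDifferentiableAt (𝓡 n) 𝓘(ℝ, G) g x) (v : EuclideanSpace ℝ (Fin n)) :
    mdiff n (fun z => A z (g z)) x v = mdiff n A x v (g x) + A x (mdiff n g x v) := by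
  have hA' := differentiableAt_inChart hA
  have hg' := differentiableAt_inChart hg
  have h1 : inChart n (fun z => A z (g z)) x = fun y => inChart n A x y (inChart n g x y) := rfl
  have h2 : MDifferentiableAt (𝓡 n) 𝓘(ℝ, G') (fun z => A z (g z)) x :=
    mdifferentiableAt_of_inChart (by rw [h1]; exact hA'.clm_apply hg')
  rw [mdiff_eq_fderiv h2, mdiff_eq_fderiv hA, mdiff_eq_fderiv hg, h1, fderiv_clm_apply hA' hg',
    inChart_apply_self, inChart_apply_self]
  exact add_comm _ _

lemma IsSmoothVectorFieldOn.mdifferentiableAt {X : (x : M) → TangentSpace (𝓡 n) x} {U : Set M}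
    (hX : IsSmoothVectorFieldOn n X U) (hU : IsOpen U) {x : M} (hx : x ∈ U) :
    MDifferentiableAt (𝓡 n) (𝓡 n).tangent (fun z => (⟨z, X z⟩ : TangentBundle (𝓡 n) M)) x :=
  (hX.contMDiffAt (hU.mem_nhds hx)).mdifferentiableAt (by simp)

/-- A vector field read in the chart at `x`. -/
def fieldInChart (X : (x : M) → TangentSpace (𝓡 n) x) (x : M) :
    EuclideanSpace ℝ (Fin n) → EuclideanSpace ℝ (Fin n) :=
  VectorField.mpullbackWithin 𝓘(ℝ, EuclideanSpace ℝ (Fin n)) (𝓡 n) (extChartAt (𝓡 n) x).symm X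
    (Set.range (𝓡 n))

lemma fieldInChart_self (X : (x : M) → TangentSpace (𝓡 n) x) (x : M) :
    fieldInChart X x (extChartAt (𝓡 n) x x) = vec X x := by
  have h1 : fieldInChart X x (extChartAt (𝓡 n) x x)
      = (tangentChart n x (extChartAt (𝓡 n) x x)).inverse
        (vec X ((extChartAt (𝓡 n) x).symm (extChartAt (𝓡 n) x x))) := rfl
  rw [h1, tangentChart_self, ContinuousLinearMap.inverse_id, extChartAt_to_inv]
  rfl

lemma tangentChart_fieldInChart (X : (x : M) → TangentSpace (𝓡 n) x) {x : M}
    {y : EuclideanSpace ℝ (Fin n)} (hy : y ∈ (extChartAt (𝓡 n) x).target) :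
    tangentChart n x y (fieldInChart X x y) = vec X ((extChartAt (𝓡 n) x).symm y) := by
  obtain ⟨e, he⟩ := isInvertible_tangentChart hy
  have : fieldInChart X x y
      = (tangentChart n x y).inverse (vec X ((extChartAt (𝓡 n) x).symm y)) := rfl
  rw [this, ← he]
  simp

lemma differentiableAt_fieldInChart {X : (x : M) → TangentSpace (𝓡 n) x} {x : M}
    (hX : MDifferentiableAt (𝓡 n) (𝓡 n).tangent (fun z => (⟨z, X z⟩ : TangentBundle (𝓡 n) M)) x) :
    DifferentiableAt ℝ (fieldInChart X x) (extChartAt (𝓡 n) x x) := by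
  have h1 : DifferentiableWithinAt ℝ (fieldInChart X x)
      ((extChartAt (𝓡 n) x).symm ⁻¹' Set.univ ∩ Set.range (𝓡 n)) (extChartAt (𝓡 n) x x) :=
    MDifferentiableWithinAt.differentiableWithinAt_mpullbackWithin_vectorField
      (I := 𝓡 n) (s := Set.univ) hX.mdifferentiableWithinAt
  have h2 : (extChartAt (𝓡 n) x).symm ⁻¹' Set.univ ∩ Set.range (𝓡 n) = Set.univ := by
    rw [ModelWithCorners.range_eq_univ, Set.preimage_univ, Set.univ_inter]
  rw [h2, differentiableWithinAt_univ] at h1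
  exact h1

/-- The chart at x identifies the tangent space at x by the identity, so at x the bracket is that of
the coordinate fields. -/
lemma mlieBracket_eq (X Y : (x : M) → TangentSpace (𝓡 n) x) (x : M) :
    vec (VectorField.mlieBracket (𝓡 n) X Y) x
      = fderiv ℝ (fieldInChart Y x) (extChartAt (𝓡 n) x x) (vec X x)
        - fderiv ℝ (fieldInChart X x) (extChartAt (𝓡 n) x x) (vec Y x) := by
  let L : EuclideanSpace ℝ (Fin n) →L[ℝ] EuclideanSpace ℝ (Fin n) :=
    mfderiv (𝓡 n) 𝓘(ℝ, EuclideanSpace ℝ (Fin n)) (extChartAt (𝓡 n) x) x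
  have hL : L = ContinuousLinearMap.id ℝ _ := mfderiv_extChartAt_self
  have h1 : vec (VectorField.mlieBracket (𝓡 n) X Y) x
      = L.inverse (VectorField.lieBracketWithin ℝ (fieldInChart X x) (fieldInChart Y x)
        ((extChartAt (𝓡 n) x).symm ⁻¹' Set.univ ∩ Set.range (𝓡 n)) (extChartAt (𝓡 n) x x)) := rfl
  have h2 : (extChartAt (𝓡 n) x).symm ⁻¹' Set.univ ∩ Set.range (𝓡 n) = Set.univ := by
    rw [ModelWithCorners.range_eq_univ, Set.preimage_univ, Set.univ_inter]
  rw [h1, hL, ContinuousLinearMap.inverse_id, h2, VectorField.lieBracketWithin_univ,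
    ← fieldInChart_self X x, ← fieldInChart_self Y x]
  rfl

section SecondOrder

variable {h : M → G} {U : Set M} (hU : IsOpen U) (hh : ContMDiffOn (𝓡 n) 𝓘(ℝ, G) ∞ h U)
  {x : M} (hx : x ∈ U)

include hU hh hx

lemma mdifferentiableAt_of_contMDiffOn : MDifferentiableAt (𝓡 n) 𝓘(ℝ, G) h x :=
  (hh.contMDiffAt (hU.mem_nhds hx)).mdifferentiableAt (by simp)

lemma contDiffAt_inChart : ContDiffAt ℝ ∞ (inChart n h x) (extChartAt (𝓡 n) x x) :=
  (contDiffOn_inChart hh x).contDiffAt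
    ((isOpen_target_inter hU x).mem_nhds ⟨mem_extChartAt_target x, mem_preimage_symm hx⟩)

lemma differentiableAt_fderiv_inChart :
    DifferentiableAt ℝ (fderiv ℝ (inChart n h x)) (extChartAt (𝓡 n) x x) :=
  ((contDiffAt_inChart hU hh hx).fderiv_right (m := 1)
    (by norm_num; exact ENat.LEInfty.out)).differentiableAt (by simp)

lemma inChart_mdiff_eventuallyEq (Y : (x : M) → TangentSpace (𝓡 n) x) :
    inChart n (fun z => mdiff n h z (vec Y z)) x =ᶠ[𝓝 (extChartAt (𝓡 n) x x)]
      fun y => fderiv ℝ (inChart n h x) y (fieldInChart Y x y) := by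
  filter_upwards [(isOpen_target_inter hU x).mem_nhds
    ⟨mem_extChartAt_target x, mem_preimage_symm hx⟩] with y hy
  rw [fderiv_inChart hy.1 (mdifferentiableAt_of_contMDiffOn hU hh hy.2),
    tangentChart_fieldInChart Y hy.1]
  rfl

lemma fderiv_fderiv_inChart_comm (v w : EuclideanSpace ℝ (Fin n)) :
    fderiv ℝ (fderiv ℝ (inChart n h x)) (extChartAt (𝓡 n) x x) v w
      = fderiv ℝ (fderiv ℝ (inChart n h x)) (extChartAt (𝓡 n) x x) w v :=
  ((contDiffAt_inChart hU hh hx).isSymmSndFDerivAt (by simp; exact ENat.LEInfty.out)).eq v w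

variable {Y : (x : M) → TangentSpace (𝓡 n) x}
  (hY : MDifferentiableAt (𝓡 n) (𝓡 n).tangent (fun z => (⟨z, Y z⟩ : TangentBundle (𝓡 n) M)) x)

include hY

lemma mdifferentiableAt_mdiff_apply :
    MDifferentiableAt (𝓡 n) 𝓘(ℝ, G) (fun z => mdiff n h z (vec Y z)) x :=
  mdifferentiableAt_of_inChart <|
    ((differentiableAt_fderiv_inChart hU hh hx).clm_apply
      (differentiableAt_fieldInChart hY)).congr_of_eventuallyEq
        (inChart_mdiff_eventuallyEq hU hh hx Y)

/-- The first term is symmetric in v and `vec Y x`, so it drops out of commutators and leaves the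
bracket. -/
lemma mdiff_mdiff_apply (v : EuclideanSpace ℝ (Fin n)) :
    mdiff n (fun z => mdiff n h z (vec Y z)) x v
      = fderiv ℝ (fderiv ℝ (inChart n h x)) (extChartAt (𝓡 n) x x) v (vec Y x)
        + mdiff n h x (fderiv ℝ (fieldInChart Y x) (extChartAt (𝓡 n) x x) v) := by
  rw [mdiff_eq_fderiv (mdifferentiableAt_mdiff_apply hU hh hx hY),
    (inChart_mdiff_eventuallyEq hU hh hx Y).fderiv_eq,
    fderiv_clm_apply (differentiableAt_fderiv_inChart hU hh hx) (differentiableAt_fieldInChart hY),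
    mdiff_eq_fderiv (mdifferentiableAt_of_contMDiffOn hU hh hx)]
  rw [← fieldInChart_self]
  exact add_comm _ _

/-- The Lie bracket acts on functions as the commutator of derivations. -/
lemma mdiff_mlieBracket {X : (x : M) → TangentSpace (𝓡 n) x}
    (hX : MDifferentiableAt (𝓡 n) (𝓡 n).tangent (fun z => (⟨z, X z⟩ : TangentBundle (𝓡 n) M)) x) :
    mdiff n h x (vec (VectorField.mlieBracket (𝓡 n) X Y) x)
      = mdiff n (fun z => mdiff n h z (vec Y z)) x (vec X x)
        - mdiff n (fun z => mdiff n h z (vec X z)) x (vec Y x) := by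
  rw [mdiff_mdiff_apply hU hh hx hX, mdiff_mdiff_apply hU hh hx hY, mlieBracket_eq, map_sub,
    fderiv_fderiv_inChart_comm hU hh hx (vec X x) (vec Y x)]
  abel

end SecondOrder

/-- Every tangent vector extends to a smooth local vector field. -/
lemma exists_smooth_vectorField (x : M) (v : EuclideanSpace ℝ (Fin n)) :
    ∃ U : Set M, IsOpen U ∧ x ∈ U ∧ ∃ X : (x : M) → TangentSpace (𝓡 n) x,
      IsSmoothVectorFieldOn n X U ∧ vec X x = v := by
  let e := trivializationAt (EuclideanSpace ℝ (Fin n)) (TangentSpace (𝓡 n) (M := M)) x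
  let w : TangentSpace (𝓡 n) x := v
  refine ⟨e.baseSet, e.open_baseSet, FiberBundle.mem_baseSet_trivializationAt' x,
    FiberBundle.extend (EuclideanSpace ℝ (Fin n)) w, ?_,
    FiberBundle.extend_apply_self (F := EuclideanSpace ℝ (Fin n)) w⟩
  refine (e.contMDiffOn_section_baseSet_iff (IB := 𝓡 n) (n := ∞)).2 ?_
  -- The extension has constant components in the trivialization.
  refine (contMDiffOn_const (c := (e ⟨x, w⟩).2)).congr fun z hz => ?_
  have h := e.apply_mk_symm hz (e ⟨x, w⟩).2
  exact (congrArg Prod.snd h :)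

end Derivatives

lemma starProjection_congr {V : Type*} [NormedAddCommGroup V] [InnerProductSpace ℝ V]
    {K L : Submodule ℝ V} [K.HasOrthogonalProjection] [L.HasOrthogonalProjection] (h : K = L)
    (z : V) : K.starProjection z = L.starProjection z := by
  subst h; rfl

/-! ### The Gauss map of an immersion and the Ricci equation. -/

section Immersion

variable {n d : ℕ} {M : Type*} [TopologicalSpace M] [ChartedSpace (EuclideanSpace ℝ (Fin n)) M]
  {f : M → EuclideanSpace ℝ (Fin d)}

variable (n f) in
/-- The orthogonal projection onto the normal space. -/
def nrm (x : M) : EuclideanSpace ℝ (Fin d) →L[ℝ] EuclideanSpace ℝ (Fin d) :=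
  (normalSpace n f x).starProjection

lemma mem_normalSpace {x : M} {z : EuclideanSpace ℝ (Fin d)} :
    z ∈ normalSpace n f x ↔ ∀ v, inner ℝ (mdiff n f x v) z = 0 := by
  rw [normalSpace, Submodule.mem_orthogonal]
  constructor
  · exact fun h v => h _ ⟨v, rfl⟩
  · rintro h _ ⟨v, rfl⟩
    exact h v

lemma nrm_mem (x : M) (z : EuclideanSpace ℝ (Fin d)) : nrm n f x z ∈ normalSpace n f x :=
  Submodule.starProjection_apply_mem _ _

lemma nrm_eq_self {x : M} {z : EuclideanSpace ℝ (Fin d)} (hz : z ∈ normalSpace n f x) :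
    nrm n f x z = z :=
  Submodule.starProjection_eq_self_iff.2 hz

lemma nrm_nrm (x : M) (z : EuclideanSpace ℝ (Fin d)) : nrm n f x (nrm n f x z) = nrm n f x z :=
  nrm_eq_self (nrm_mem x z)

lemma inner_nrm (x : M) (z w : EuclideanSpace ℝ (Fin d)) :
    inner ℝ (nrm n f x z) w = inner ℝ z (nrm n f x w) :=
  Submodule.inner_starProjection_left_eq_right _ _ _

lemma nrm_mdiff (x : M) (v : EuclideanSpace ℝ (Fin n)) : nrm n f x (mdiff n f x v) = 0 := by
  rw [nrm, Submodule.starProjection_apply_eq_zero_iff]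
  exact (Submodule.le_orthogonal_orthogonal _) ⟨v, rfl⟩

lemma sub_nrm_eq (x : M) (z : EuclideanSpace ℝ (Fin d)) :
    ∃ v, z - nrm n f x z = mdiff n f x v := by
  have h : z - nrm n f x z ∈ (normalSpace n f x)ᗮ := Submodule.sub_starProjection_mem_orthogonal _
  rw [normalSpace, Submodule.orthogonal_orthogonal] at h
  obtain ⟨v, hv⟩ := h
  exact ⟨v, hv.symm⟩

lemma exists_mdiff_of_nrm_eq_zero {x : M} {z : EuclideanSpace ℝ (Fin d)} (hz : nrm n f x z = 0) :
    ∃ v, mdiff n f x v = z := by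
  obtain ⟨v, hv⟩ := sub_nrm_eq (n := n) (f := f) x z
  exact ⟨v, by rw [← hv, hz, sub_zero]⟩

variable [IsManifold (𝓡 n) ∞ M]

lemma IsSmoothImmersion.contMDiffOn (hf : IsSmoothImmersion n f) (U : Set M) :
    ContMDiffOn (𝓡 n) 𝓘(ℝ, EuclideanSpace ℝ (Fin d)) ∞ f U := hf.1.contMDiffOn

lemma IsSmoothImmersion.mdifferentiableAt (hf : IsSmoothImmersion n f) (x : M) :
    MDifferentiableAt (𝓡 n) 𝓘(ℝ, EuclideanSpace ℝ (Fin d)) f x :=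
  (hf.1 x).mdifferentiableAt (by simp)

lemma IsSmoothImmersion.mdiff_injective (hf : IsSmoothImmersion n f) (x : M) :
    Function.Injective (mdiff n f x) := hf.2 x

lemma IsSmoothImmersion.contDiffOn_inChart (hf : IsSmoothImmersion n f) (x : M) :
    ContDiffOn ℝ ∞ (inChart n f x) (extChartAt (𝓡 n) x).target := by
  simpa using DupinSubmanifold.contDiffOn_inChart (hf.contMDiffOn Set.univ) x

lemma IsSmoothImmersion.contDiffOn_fderiv (hf : IsSmoothImmersion n f) (x : M) :
    ContDiffOn ℝ ∞ (fderiv ℝ (inChart n f x)) (extChartAt (𝓡 n) x).target :=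
  (hf.contDiffOn_inChart x).fderiv_of_isOpen (isOpen_target x) (by simp)

lemma IsSmoothImmersion.fderiv_eq (hf : IsSmoothImmersion n f) {x : M}
    {y : EuclideanSpace ℝ (Fin n)} (hy : y ∈ (extChartAt (𝓡 n) x).target) (v) :
    fderiv ℝ (inChart n f x) y v
      = mdiff n f ((extChartAt (𝓡 n) x).symm y) (tangentChart n x y v) :=
  fderiv_inChart hy (hf.mdifferentiableAt _) v

lemma IsSmoothImmersion.fderiv_injective (hf : IsSmoothImmersion n f) {x : M}
    {y : EuclideanSpace ℝ (Fin n)} (hy : y ∈ (extChartAt (𝓡 n) x).target) :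
    Function.Injective (fderiv ℝ (inChart n f x) y) := fun v w h => by
  rw [hf.fderiv_eq hy, hf.fderiv_eq hy] at h
  exact injective_tangentChart hy (hf.mdiff_injective _ h)

/-- The chart differential has the same image as the intrinsic one, and A A⁺ is the orthogonal
projection onto the image of A. -/
lemma IsSmoothImmersion.inChart_nrm (hf : IsSmoothImmersion n f) {x : M}
    {y : EuclideanSpace ℝ (Fin n)} (hy : y ∈ (extChartAt (𝓡 n) x).target) :
    inChart n (nrm n f) x y = ContinuousLinearMap.id ℝ _ -
      fderiv ℝ (inChart n f x) y ∘L pseudoInverse (fderiv ℝ (inChart n f x) y) := by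
  have h1 : LinearMap.range (fderiv ℝ (inChart n f x) y).toLinearMap
      = LinearMap.range (mdiff n f ((extChartAt (𝓡 n) x).symm y)).toLinearMap := by
    ext z
    constructor
    · rintro ⟨v, rfl⟩
      exact ⟨tangentChart n x y v, (hf.fderiv_eq hy v).symm⟩
    · rintro ⟨w, rfl⟩
      obtain ⟨v, rfl⟩ := surjective_tangentChart hy w
      exact ⟨v, hf.fderiv_eq hy v⟩
  ext1 z
  have h2 := apply_pseudoInverse (hf.fderiv_injective hy) z
  have h3 : inChart n (nrm n f) x y z
      = ((LinearMap.range (mdiff n f ((extChartAt (𝓡 n) x).symm y)).toLinearMap)ᗮ).starProjection z :=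
    rfl
  rw [h3, Submodule.starProjection_orthogonal]
  have h4 := starProjection_congr h1 z
  simp only [sub_apply, ContinuousLinearMap.comp_apply]
  rw [h2, h4]

lemma IsSmoothImmersion.contDiffOn_nrm (hf : IsSmoothImmersion n f) (x : M) :
    ContDiffOn ℝ ∞ (inChart n (nrm n f) x) (extChartAt (𝓡 n) x).target := by
  refine ContDiffOn.congr ?_ fun y hy => hf.inChart_nrm hy
  refine contDiffOn_const.sub ((hf.contDiffOn_fderiv x).clm_comp fun y hy => ?_)
  exact ((contDiffAt_pseudoInverse (hf.fderiv_injective hy)).comp y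
    ((hf.contDiffOn_fderiv x).contDiffAt ((isOpen_target x).mem_nhds hy))).contDiffWithinAt

lemma IsSmoothImmersion.contMDiff_nrm (hf : IsSmoothImmersion n f) :
    ContMDiff (𝓡 n) 𝓘(ℝ, EuclideanSpace ℝ (Fin d) →L[ℝ] EuclideanSpace ℝ (Fin d)) ∞
      (nrm n f) := fun x =>
  contMDiffAt_of_inChart <|
    (hf.contDiffOn_nrm x).contDiffAt ((isOpen_target x).mem_nhds (mem_extChartAt_target x))

lemma IsSmoothImmersion.mdifferentiableAt_nrm (hf : IsSmoothImmersion n f) (x : M) :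
    MDifferentiableAt (𝓡 n) 𝓘(ℝ, EuclideanSpace ℝ (Fin d) →L[ℝ] EuclideanSpace ℝ (Fin d))
      (nrm n f) x := (hf.contMDiff_nrm x).mdifferentiableAt (by simp)

/-- The second fundamental form in terms of the derivative of the Gauss map. -/
lemma IsSmoothImmersion.secondFundamentalForm_eq (hf : IsSmoothImmersion n f) (x : M)
    (v w : EuclideanSpace ℝ (Fin n)) :
    secondFundamentalForm n f x v w = - mdiff n (nrm n f) x v (mdiff n f x w) := by
  have hU : (extChartAt (𝓡 n) x).target ∈ 𝓝 (extChartAt (𝓡 n) x x) :=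
    (isOpen_target x).mem_nhds (mem_extChartAt_target x)
  -- With N the normal projection, differentiating N(∂_w f) = 0 gives (∂_v N)(∂_w f) = -N(∂_v ∂_w
  -- f).
  have h0 : (fun y => inChart n (nrm n f) x y (fderiv ℝ (inChart n f x) y w))
      =ᶠ[𝓝 (extChartAt (𝓡 n) x x)] fun _ => 0 := by
    filter_upwards [hU] with y hy
    rw [hf.fderiv_eq hy]
    exact nrm_mdiff _ _
  have hd1 : DifferentiableAt ℝ (inChart n (nrm n f) x) (extChartAt (𝓡 n) x x) :=
    differentiableAt_inChart (hf.mdifferentiableAt_nrm x)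
  have hd2 : DifferentiableAt ℝ (fderiv ℝ (inChart n f x)) (extChartAt (𝓡 n) x x) :=
    ((hf.contDiffOn_fderiv x).contDiffAt hU).differentiableAt (by simp)
  have h1 : fderiv ℝ (fun y => inChart n (nrm n f) x y (fderiv ℝ (inChart n f x) y w))
      (extChartAt (𝓡 n) x x)
      = fderiv ℝ (fun _ => (0 : EuclideanSpace ℝ (Fin d))) (extChartAt (𝓡 n) x x) := h0.fderiv_eq
  rw [fderiv_clm_apply hd1 (hd2.clm_apply (differentiableAt_const w)),
    fderiv_clm_apply hd2 (differentiableAt_const w)] at h1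
  have h2 := congrArg (fun L : EuclideanSpace ℝ (Fin n) →L[ℝ] EuclideanSpace ℝ (Fin d) => L v) h1
  simp only [fderiv_fun_const, Pi.zero_apply, ContinuousLinearMap.comp_zero, zero_add,
    add_apply, ContinuousLinearMap.comp_apply, ContinuousLinearMap.flip_apply, zero_apply] at h2
  rw [← mdiff_eq_fderiv (hf.mdifferentiableAt_nrm x), ← mdiff_eq_fderiv (hf.mdifferentiableAt x),
    inChart_apply_self] at h2
  exact eq_neg_of_add_eq_zero_left h2

lemma IsSmoothImmersion.secondFundamentalForm_comm (hf : IsSmoothImmersion n f) (x : M)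
    (v w : EuclideanSpace ℝ (Fin n)) :
    secondFundamentalForm n f x v w = secondFundamentalForm n f x w v :=
  congrArg (nrm n f x)
    (fderiv_fderiv_inChart_comm isOpen_univ (hf.contMDiffOn Set.univ) (Set.mem_univ x) v w)

lemma IsSmoothImmersion.mdiff_nrm_comm (hf : IsSmoothImmersion n f) (x : M)
    (v w : EuclideanSpace ℝ (Fin n)) :
    mdiff n (nrm n f) x v (mdiff n f x w) = mdiff n (nrm n f) x w (mdiff n f x v) := by
  have := hf.secondFundamentalForm_comm x v w
  rw [hf.secondFundamentalForm_eq, hf.secondFundamentalForm_eq] at this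
  exact neg_injective this

lemma mdiff_const (c : EuclideanSpace ℝ (Fin d)) (x : M) : mdiff n (fun _ : M => c) x = 0 :=
  mfderiv_const

lemma IsSmoothImmersion.mdiff_nrm_apply (hf : IsSmoothImmersion n f) (x : M)
    (v : EuclideanSpace ℝ (Fin n)) (z : EuclideanSpace ℝ (Fin d)) :
    mdiff n (fun y => nrm n f y z) x v = mdiff n (nrm n f) x v z := by
  rw [mdiff_clm_apply (hf.mdifferentiableAt_nrm x) mdifferentiableAt_const, mdiff_const]
  simp

/-- The derivative of N² = N. It makes ∂N off-diagonal with respect to tangent and normal vectors: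
one block is -α, the other gives the shape operators. -/
lemma IsSmoothImmersion.mdiff_nrm_add (hf : IsSmoothImmersion n f) (x : M)
    (v : EuclideanSpace ℝ (Fin n)) (z : EuclideanSpace ℝ (Fin d)) :
    mdiff n (nrm n f) x v (nrm n f x z) + nrm n f x (mdiff n (nrm n f) x v z)
      = mdiff n (nrm n f) x v z := by
  have hd : MDifferentiableAt (𝓡 n) 𝓘(ℝ, EuclideanSpace ℝ (Fin d)) (fun y => nrm n f y z) x :=
    (hf.mdifferentiableAt_nrm x).clm_apply mdifferentiableAt_const
  have h := mdiff_clm_apply (hf.mdifferentiableAt_nrm x) hd v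
  rw [hf.mdiff_nrm_apply] at h
  rw [← h, ← hf.mdiff_nrm_apply]
  simp only [nrm_nrm]

/-- The derivative of the Gauss map sends tangent vectors to normal vectors. -/
lemma IsSmoothImmersion.nrm_mdiff_nrm_tangent (hf : IsSmoothImmersion n f) (x : M)
    (v w : EuclideanSpace ℝ (Fin n)) :
    nrm n f x (mdiff n (nrm n f) x v (mdiff n f x w)) = mdiff n (nrm n f) x v (mdiff n f x w) := by
  have := hf.mdiff_nrm_add x v (mdiff n f x w)
  rwa [nrm_mdiff, map_zero, zero_add] at this

/-- The derivative of the Gauss map sends normal vectors to tangent vectors. -/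
lemma IsSmoothImmersion.nrm_mdiff_nrm_normal (hf : IsSmoothImmersion n f) {x : M}
    (v : EuclideanSpace ℝ (Fin n)) {z : EuclideanSpace ℝ (Fin d)} (hz : z ∈ normalSpace n f x) :
    nrm n f x (mdiff n (nrm n f) x v z) = 0 := by
  have := hf.mdiff_nrm_add x v z
  rwa [nrm_eq_self hz, add_eq_left] at this

/-- The derivative of a family of symmetric operators is symmetric. -/
lemma IsSmoothImmersion.inner_mdiff_nrm (hf : IsSmoothImmersion n f) (x : M)
    (v : EuclideanSpace ℝ (Fin n)) (z w : EuclideanSpace ℝ (Fin d)) :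
    inner ℝ (mdiff n (nrm n f) x v z) w = inner ℝ z (mdiff n (nrm n f) x v w) := by
  have key : ∀ a b : EuclideanSpace ℝ (Fin d),
      fderiv ℝ (fun y => inner ℝ (inChart n (nrm n f) x y a) b) (extChartAt (𝓡 n) x x) v
        = inner ℝ (mdiff n (nrm n f) x v a) b := fun a b => by
    have hd1 := differentiableAt_inChart (hf.mdifferentiableAt_nrm x)
    rw [fderiv_inner_apply ℝ (hd1.clm_apply (differentiableAt_const a)) (differentiableAt_const b),
      fderiv_clm_apply hd1 (differentiableAt_const a), ← mdiff_eq_fderiv (hf.mdifferentiableAt_nrm x)]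
    simp
  rw [← key z w, real_inner_comm, ← key w z]
  congr 2
  funext y
  rw [real_inner_comm]
  exact (inner_nrm (n := n) (f := f) ((extChartAt (𝓡 n) x).symm y) w z).symm

lemma IsSmoothImmersion.normalDerivative_normalDerivative (hf : IsSmoothImmersion n f)
    {U : Set M} (hU : IsOpen U) {ξ : M → EuclideanSpace ℝ (Fin d)}
    (hξ : ContMDiffOn (𝓡 n) 𝓘(ℝ, EuclideanSpace ℝ (Fin d)) ∞ ξ U) {x : M} (hx : x ∈ U)
    {X Y : (x : M) → TangentSpace (𝓡 n) x} (hY : IsSmoothVectorFieldOn n Y U) :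
    normalDerivative n f (fun y => normalDerivative n f ξ y (Y y)) x (X x)
      = nrm n f x (mdiff n (nrm n f) x (vec X x) (mdiff n ξ x (vec Y x)))
        + nrm n f x (mdiff n (fun z => mdiff n ξ z (vec Y z)) x (vec X x)) := by
  have hd := mdifferentiableAt_mdiff_apply hU hξ hx (hY.mdifferentiableAt hU hx)
  have h1 := mdiff_clm_apply (hf.mdifferentiableAt_nrm x) hd (vec X x)
  have h2 : normalDerivative n f (fun y => normalDerivative n f ξ y (Y y)) x (X x)
      = nrm n f x (mdiff n (fun z => nrm n f z (mdiff n ξ z (vec Y z))) x (vec X x)) := rfl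
  rw [h2, h1, map_add, nrm_nrm]

/-- The Ricci equation. -/
lemma IsSmoothImmersion.normalCurvature_eq (hf : IsSmoothImmersion n f)
    {U : Set M} (hU : IsOpen U) {ξ : M → EuclideanSpace ℝ (Fin d)}
    (hξ : IsSmoothNormalFieldOn n f ξ U) {x : M} (hx : x ∈ U)
    {X Y : (x : M) → TangentSpace (𝓡 n) x} (hX : IsSmoothVectorFieldOn n X U)
    (hY : IsSmoothVectorFieldOn n Y U) :
    normalCurvature n f X Y ξ x
      = nrm n f x (mdiff n (nrm n f) x (vec X x) (mdiff n (nrm n f) x (vec Y x) (ξ x)))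
        - nrm n f x (mdiff n (nrm n f) x (vec Y x) (mdiff n (nrm n f) x (vec X x) (ξ x))) := by
  -- Differentiate Nξ = ξ: the tangent part of ∂_v ξ is (∂_v N) ξ.
  have hB : ∀ v, mdiff n ξ x v = mdiff n (nrm n f) x v (ξ x) + nrm n f x (mdiff n ξ x v) := by
    intro v
    rw [← mdiff_clm_apply (hf.mdifferentiableAt_nrm x)
      (mdifferentiableAt_of_contMDiffOn hU hξ.1 hx)]
    refine congrArg (fun L : EuclideanSpace ℝ (Fin n) →L[ℝ] EuclideanSpace ℝ (Fin d) => L v)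
      (mdiff_congr ?_)
    filter_upwards [hU.mem_nhds hx] with z hz using (nrm_eq_self (hξ.2 z hz)).symm
  -- The normal part of ∂_v ξ is sent by ∂_u N to a tangent vector, which N kills.
  have hBB : ∀ u v, nrm n f x (mdiff n (nrm n f) x u (mdiff n ξ x v))
      = nrm n f x (mdiff n (nrm n f) x u (mdiff n (nrm n f) x v (ξ x))) := by
    intro u v
    rw [hB v, map_add, map_add, hf.nrm_mdiff_nrm_normal u (nrm_mem x (mdiff n ξ x v)), add_zero]
  have hbr : normalDerivative n f ξ x (VectorField.mlieBracket (𝓡 n) X Y x)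
      = nrm n f x (mdiff n ξ x (vec (VectorField.mlieBracket (𝓡 n) X Y) x)) := rfl
  rw [normalCurvature, hf.normalDerivative_normalDerivative hU hξ.1 hx hY,
    hf.normalDerivative_normalDerivative hU hξ.1 hx hX, hbr,
    mdiff_mlieBracket hU hξ.1 hx (hY.mdifferentiableAt hU hx) (hX.mdifferentiableAt hU hx),
    map_sub, hBB, hBB]
  abel

lemma IsSmoothVectorFieldOn.mono {X : (x : M) → TangentSpace (𝓡 n) x} {U V : Set M}
    (hX : IsSmoothVectorFieldOn n X U) (h : V ⊆ U) : IsSmoothVectorFieldOn n X V :=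
  ContMDiffOn.mono hX h

/-- Shape operators of a submanifold with flat normal bundle commute. -/
lemma IsSmoothImmersion.commute_of_flat (hf : IsSmoothImmersion n f)
    (hflat : HasFlatNormalBundle n f) (x : M) (u v : EuclideanSpace ℝ (Fin n))
    {ξ ζ : EuclideanSpace ℝ (Fin d)} (hξ : ξ ∈ normalSpace n f x) (hζ : ζ ∈ normalSpace n f x) :
    inner ℝ (mdiff n (nrm n f) x u ξ) (mdiff n (nrm n f) x v ζ)
      = inner ℝ (mdiff n (nrm n f) x v ξ) (mdiff n (nrm n f) x u ζ) := by
  obtain ⟨U, hU, hxU, X, hX, rfl⟩ := exists_smooth_vectorField x u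
  obtain ⟨V, hV, hxV, Y, hY, rfl⟩ := exists_smooth_vectorField x v
  -- Projecting a constant vector extends ξ to a smooth normal field.
  have hξs : IsSmoothNormalFieldOn n f (fun y => nrm n f y ξ) (U ∩ V) :=
    ⟨(hf.contMDiff_nrm.clm_apply contMDiff_const).contMDiffOn, fun y _ => nrm_mem y ξ⟩
  have hX' := hX.mono (Set.inter_subset_left (t := V))
  have hY' := hY.mono (Set.inter_subset_right (s := U))
  have h1 := hflat (U ∩ V) (hU.inter hV) X Y hX' hY' _ hξs x ⟨hxU, hxV⟩
  rw [hf.normalCurvature_eq (hU.inter hV) hξs ⟨hxU, hxV⟩ hX' hY', nrm_eq_self hξ,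
    sub_eq_zero] at h1
  have h2 := congrArg (inner ℝ · ζ) h1
  simp only [inner_nrm, nrm_eq_self hζ, hf.inner_mdiff_nrm x _ (mdiff n (nrm n f) x _ ξ)] at h2
  exact h2.symm

end Immersion

/-! ### Pointwise diagonalization by principal normals. -/

/-- Simultaneous diagonalization of a symmetric bilinear form with values in `ℝ^d` whose shape
operators commute. -/
lemma iSup_eq_top_of_shape_commute {d : ℕ} {V : Type*} [NormedAddCommGroup V]
    [InnerProductSpace ℝ V] [FiniteDimensional ℝ V]
    (A : EuclideanSpace ℝ (Fin d) → V →ₗ[ℝ] V) (β : V → V → EuclideanSpace ℝ (Fin d))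
    (hβ : ∀ ξ a b, inner ℝ (A ξ a) b = inner ℝ (β a b) ξ)
    (hsymm : ∀ ξ a b, inner ℝ (A ξ a) b = inner ℝ a (A ξ b))
    (hcomm : ∀ ξ ζ a b, inner ℝ (A ξ a) (A ζ b) = inner ℝ (A ζ a) (A ξ b))
    (p : EuclideanSpace ℝ (Fin d) → Submodule ℝ V)
    (hp : ∀ χ a, (∀ b, β a b = inner ℝ a b • χ) → a ∈ p χ) : ⨆ χ, p χ = ⊤ := by
  let T : Fin d → V →ₗ[ℝ] V := fun i => A (EuclideanSpace.single i 1)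
  have hT : ∀ i, (T i).IsSymmetric := fun i a b => hsymm _ a b
  have hC : Pairwise (Function.onFun Commute T) := fun i j _ => by
    ext a
    refine ext_inner_right ℝ fun b => ?_
    exact (hsymm _ _ _).trans ((hcomm _ _ a b).trans (hsymm _ _ _).symm)
  rw [eq_top_iff, ← LinearMap.IsSymmetric.iSup_iInf_eq_top_of_commute hT hC]
  -- The joint eigenvalues of the shape operators in the d coordinate directions are the coordinates
  -- of the principal normal χ.
  refine iSup_le fun γ a ha => Submodule.mem_iSup_of_mem (WithLp.toLp 2 γ) (hp _ _ fun b => ?_)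
  rw [Submodule.mem_iInf] at ha
  ext i
  have h1 : A (EuclideanSpace.single i 1) a = γ i • a := Module.End.mem_eigenspace_iff.1 (ha i)
  have h2 := hβ (EuclideanSpace.single i 1) a b
  rw [h1, real_inner_smul_left, EuclideanSpace.inner_single_right] at h2
  simp only [one_mul, conj_trivial] at h2
  rw [← h2]
  simp [mul_comm]

lemma sum_starProjection {k : ℕ} {V : Type*} [NormedAddCommGroup V] [InnerProductSpace ℝ V]
    [FiniteDimensional ℝ V] {W : Fin k → Submodule ℝ V} {T : Submodule ℝ V}
    (hW : ∀ i j, i ≠ j → ∀ a ∈ W i, ∀ b ∈ W j, inner ℝ a b = 0) (hT : ⨆ i, W i = T) (z : V) :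
    ∑ i, (W i).starProjection z = T.starProjection z := by
  refine (Submodule.eq_starProjection_of_mem_of_inner_eq_zero ?_ ?_).symm
  · rw [← hT]
    exact Submodule.sum_mem _ fun i _ =>
      Submodule.mem_iSup_of_mem i (Submodule.starProjection_apply_mem _ _)
  · intro w hw
    rw [← hT] at hw
    induction hw using Submodule.iSup_induction' with
    | mem j w hw =>
      rw [inner_sub_left, sum_inner, Finset.sum_eq_single j, ← inner_sub_left]
      · rw [real_inner_comm]
        exact (Submodule.mem_orthogonal _ _).1
          (Submodule.sub_starProjection_mem_orthogonal z) w hw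
      · exact fun i _ hij => hW i j hij _ (Submodule.starProjection_apply_mem _ _) _ hw
      · simp
    | zero => simp
    | add a b _ _ ha hb => rw [inner_add_right, ha, hb, add_zero]

section Pointwise

variable {n d : ℕ} {M : Type*} [TopologicalSpace M] [ChartedSpace (EuclideanSpace ℝ (Fin n)) M]
  {f : M → EuclideanSpace ℝ (Fin d)}

variable (n f) in
/-- The image in `ℝ^d` of the nullity of `η` at `x` under the differential. -/
def nul (x : M) (η : EuclideanSpace ℝ (Fin d)) : Submodule ℝ (EuclideanSpace ℝ (Fin d)) where
  carrier := {a | ∃ v, mdiff n f x v = a ∧ ∀ w, mdiff n (nrm n f) x v (mdiff n f x w)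
    = -(inner ℝ (mdiff n f x v) (mdiff n f x w) • η)}
  zero_mem' := ⟨0, by simp, by simp⟩
  add_mem' := by
    rintro _ _ ⟨v, rfl, hv⟩ ⟨v', rfl, hv'⟩
    refine ⟨v + v', map_add _ _ _, fun w => ?_⟩
    rw [map_add, map_add, add_apply, hv, hv', inner_add_left, add_smul, neg_add]
  smul_mem' := by
    rintro c _ ⟨v, rfl, hv⟩
    refine ⟨c • v, map_smul _ _ _, fun w => ?_⟩
    rw [map_smul, map_smul, smul_apply, hv, real_inner_smul_left, smul_neg, mul_smul]

variable (n f) in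
/-- The orthogonal projection onto the nullity of `η`, regarded as a subspace of `ℝ^d`. -/
def proj (x : M) (η : EuclideanSpace ℝ (Fin d)) :
    EuclideanSpace ℝ (Fin d) →L[ℝ] EuclideanSpace ℝ (Fin d) := (nul n f x η).starProjection

lemma proj_mem (x : M) (η z : EuclideanSpace ℝ (Fin d)) : proj n f x η z ∈ nul n f x η :=
  Submodule.starProjection_apply_mem _ _

lemma proj_eq_self {x : M} {η z : EuclideanSpace ℝ (Fin d)} (hz : z ∈ nul n f x η) :
    proj n f x η z = z := Submodule.starProjection_eq_self_iff.2 hz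

lemma inner_proj (x : M) (η z w : EuclideanSpace ℝ (Fin d)) :
    inner ℝ (proj n f x η z) w = inner ℝ z (proj n f x η w) :=
  Submodule.inner_starProjection_left_eq_right _ _ _

lemma nrm_of_mem_nul {x : M} {η z : EuclideanSpace ℝ (Fin d)} (hz : z ∈ nul n f x η) :
    nrm n f x z = 0 := by
  obtain ⟨v, rfl, -⟩ := hz
  exact nrm_mdiff x v

lemma proj_eq_zero_of_forall_inner {x : M} {η z : EuclideanSpace ℝ (Fin d)}
    (h : ∀ a ∈ nul n f x η, inner ℝ a z = 0) : proj n f x η z = 0 :=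
  (Submodule.starProjection_apply_eq_zero_iff _).2 ((Submodule.mem_orthogonal _ _).2 h)

variable [IsManifold (𝓡 n) ∞ M]

lemma IsSmoothImmersion.mdiff_mem_nul_iff (hf : IsSmoothImmersion n f) {x : M}
    {η : EuclideanSpace ℝ (Fin d)} {v : EuclideanSpace ℝ (Fin n)} :
    mdiff n f x v ∈ nul n f x η ↔ ∀ w, mdiff n (nrm n f) x v (mdiff n f x w)
      = -(inner ℝ (mdiff n f x v) (mdiff n f x w) • η) := by
  constructor
  · rintro ⟨v', hv', h⟩
    rwa [← hf.mdiff_injective x hv']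
  · exact fun h => ⟨v, rfl, h⟩

lemma IsSmoothImmersion.mem_nullity_iff (hf : IsSmoothImmersion n f) {x : M}
    {η : EuclideanSpace ℝ (Fin d)} (v : TangentSpace (𝓡 n) x) :
    v ∈ nullity n f x η ↔ mdiff n f x v ∈ nul n f x η := by
  refine Iff.trans ?_ (hf.mdiff_mem_nul_iff (v := v)).symm
  have h1 : v ∈ nullity n f x η ↔
      ∀ w : EuclideanSpace ℝ (Fin n), secondFundamentalForm n f x v w
        = inner ℝ (mdiff n f x v) (mdiff n f x w) • η := Iff.rfl
  rw [h1]
  refine forall_congr' fun w => ?_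
  have h2 := hf.secondFundamentalForm_eq x v w
  exact ⟨fun h => neg_eq_iff_eq_neg.1 (h2.symm.trans h), fun h => h2.trans (neg_eq_iff_eq_neg.2 h)⟩

lemma IsSmoothImmersion.nullity_ne_bot_iff (hf : IsSmoothImmersion n f) {x : M}
    {η : EuclideanSpace ℝ (Fin d)} : nullity n f x η ≠ ⊥ ↔ nul n f x η ≠ ⊥ := by
  rw [Submodule.ne_bot_iff, Submodule.ne_bot_iff]
  constructor
  · rintro ⟨v, hv, hv0⟩
    refine ⟨mdiff n f x v, (hf.mem_nullity_iff v).1 hv, fun h => hv0 ?_⟩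
    exact hf.mdiff_injective x (h.trans (map_zero _).symm)
  · rintro ⟨a, ha, ha0⟩
    obtain ⟨v, rfl, -⟩ := id ha
    exact ⟨v, (hf.mem_nullity_iff v).2 ha, fun h => ha0 ((congrArg _ h).trans (map_zero _))⟩

/-- The restriction of the differential to the nullity. -/
def IsSmoothImmersion.nullityEquiv (hf : IsSmoothImmersion n f) (x : M)
    (η : EuclideanSpace ℝ (Fin d)) : nullity n f x η ≃ₗ[ℝ] nul n f x η :=
  LinearEquiv.ofBijective
    ({ toFun := fun v => ⟨mdiff n f x (v : TangentSpace (𝓡 n) x), (hf.mem_nullity_iff _).1 v.2⟩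
       map_add' := fun v w => Subtype.ext ((mdiff n f x).map_add _ _)
       map_smul' := fun c v => Subtype.ext ((mdiff n f x).map_smul c _) } :
      nullity n f x η →ₗ[ℝ] nul n f x η)
    ⟨fun v w h => Subtype.ext (hf.mdiff_injective x (congrArg Subtype.val h)), fun a => by
      obtain ⟨a, ha⟩ := a
      obtain ⟨v, rfl, -⟩ := id ha
      exact ⟨⟨v, (hf.mem_nullity_iff v).2 ha⟩, rfl⟩⟩

/-- α(v, v) = |v|² η is normal, and some v in the nullity is nonzero. -/
lemma IsSmoothImmersion.mem_normalSpace_of_nul_ne_bot (hf : IsSmoothImmersion n f) {x : M}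
    {η : EuclideanSpace ℝ (Fin d)} (h : nul n f x η ≠ ⊥) : η ∈ normalSpace n f x := by
  obtain ⟨_, ⟨v, rfl, hv⟩, h0⟩ := Submodule.exists_mem_ne_zero_of_ne_bot h
  have h1 := hf.nrm_mdiff_nrm_tangent x v v
  have h2 : inner ℝ (mdiff n f x v) (mdiff n f x v) ≠ 0 := fun h => h0 (inner_self_eq_zero.1 h)
  have h3 : nrm n f x η = η := by
    rw [hv, map_neg, map_smul] at h1
    exact smul_right_injective _ h2 (neg_injective h1)
  rw [← h3]
  exact nrm_mem _ _

/-- By symmetry of α, both ⟨a, b⟩ η and ⟨a, b⟩ ζ equal α(a, b). -/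
lemma IsSmoothImmersion.inner_eq_zero_of_mem_nul (hf : IsSmoothImmersion n f) {x : M}
    {η ζ a b : EuclideanSpace ℝ (Fin d)} (hne : η ≠ ζ) (ha : a ∈ nul n f x η)
    (hb : b ∈ nul n f x ζ) : inner ℝ a b = 0 := by
  obtain ⟨v, rfl, hv⟩ := ha
  obtain ⟨w, rfl, hw⟩ := hb
  have h1 := hf.mdiff_nrm_comm x v w
  rw [hv, hw, real_inner_comm, neg_inj] at h1
  by_contra h
  exact hne (smul_right_injective _ (by rwa [real_inner_comm]) h1)

/-- The shape operators are indexed by all ambient vectors ξ, acting through the normal part of ξ.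
They are symmetric, and flatness makes them commute. -/
lemma IsSmoothImmersion.iSup_nul (hf : IsSmoothImmersion n f) (hflat : HasFlatNormalBundle n f)
    (x : M) : ⨆ η, nul n f x η = LinearMap.range (mdiff n f x).toLinearMap := by
  set T := LinearMap.range (mdiff n f x).toLinearMap with hTdef
  let J := pseudoInverse (mdiff n f x)
  have hJ : ∀ a : T, mdiff n f x (J a) = a := by
    rintro ⟨_, v, rfl⟩
    exact congrArg (mdiff n f x) (pseudoInverse_apply (hf.mdiff_injective x) v)
  let B := mdiff n (nrm n f) x
  have hmem : ∀ (ξ : EuclideanSpace ℝ (Fin d)) (v : EuclideanSpace ℝ (Fin n)),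
      -(B v (nrm n f x ξ)) ∈ T := fun ξ v => by
    obtain ⟨w, hw⟩ := exists_mdiff_of_nrm_eq_zero
      (hf.nrm_mdiff_nrm_normal v (nrm_mem (n := n) (f := f) x ξ))
    exact T.neg_mem ⟨w, hw⟩
  let A : EuclideanSpace ℝ (Fin d) → T →ₗ[ℝ] T := fun ξ =>
    { toFun := fun a => ⟨-(B (J a) (nrm n f x ξ)), hmem ξ (J a)⟩
      map_add' := fun a b => Subtype.ext (by
        change -(B (J ((a : EuclideanSpace ℝ (Fin d)) + b)) (nrm n f x ξ))
          = -(B (J a) (nrm n f x ξ)) + -(B (J b) (nrm n f x ξ))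
        rw [map_add, map_add, add_apply, neg_add])
      map_smul' := fun c a => Subtype.ext (by
        change -(B (J (c • (a : EuclideanSpace ℝ (Fin d)))) (nrm n f x ξ))
          = c • -(B (J a) (nrm n f x ξ))
        rw [map_smul, map_smul, smul_apply, smul_neg]) }
  let β : T → T → EuclideanSpace ℝ (Fin d) := fun a b => -(B (J a) b)
  have hβ : ∀ ξ a b, inner ℝ (A ξ a) b = inner ℝ (β a b) ξ := fun ξ a b => by
    change inner ℝ (-(B (J a) (nrm n f x ξ))) (b : EuclideanSpace ℝ (Fin d))
      = inner ℝ (-(B (J a) b)) ξ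
    rw [inner_neg_left, inner_neg_left, hf.inner_mdiff_nrm, ← hJ b, inner_nrm,
      hf.nrm_mdiff_nrm_tangent, real_inner_comm]
  have hβs : ∀ a b, β a b = β b a := fun a b => by
    change -(B (J a) b) = -(B (J b) a)
    have h1 := hf.mdiff_nrm_comm x (J a) (J b)
    rw [hJ, hJ] at h1
    exact congrArg Neg.neg h1
  have hsymm : ∀ ξ a b, inner ℝ (A ξ a) b = inner ℝ a (A ξ b) := fun ξ a b => by
    rw [hβ, hβs, ← hβ, real_inner_comm]
  have hcomm : ∀ ξ ζ a b, inner ℝ (A ξ a) (A ζ b) = inner ℝ (A ζ a) (A ξ b) := fun ξ ζ a b => by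
    change inner ℝ (-(B (J a) (nrm n f x ξ))) (-(B (J b) (nrm n f x ζ)))
      = inner ℝ (-(B (J a) (nrm n f x ζ))) (-(B (J b) (nrm n f x ξ)))
    rw [inner_neg_neg, inner_neg_neg,
      hf.commute_of_flat hflat x (J a) (J b) (nrm_mem x ξ) (nrm_mem x ζ), real_inner_comm]
  have htop := iSup_eq_top_of_shape_commute A β hβ hsymm hcomm
    (fun η => (nul n f x η).comap T.subtype) (fun χ a h => by
      refine ⟨J a, hJ a, fun w => ?_⟩
      have h1 := h ⟨mdiff n f x w, w, rfl⟩
      rw [hJ a]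
      exact neg_eq_iff_eq_neg.1 h1)
  apply le_antisymm
  · refine iSup_le fun η => ?_
    rintro _ ⟨v, rfl, -⟩
    exact ⟨v, rfl⟩
  · calc T = (⊤ : Submodule ℝ T).map T.subtype := by simp
      _ = ⨆ η, ((nul n f x η).comap T.subtype).map T.subtype := by rw [← htop, Submodule.map_iSup]
      _ ≤ _ := iSup_mono fun η => Submodule.map_comap_le _ _

variable (n f) in
/-- `χ` enumerates the principal normals of `f` at `x`, and the nullities span the tangent space. -/
structure IsPrincipalFrame {k : ℕ} (x : M) (χ : Fin k → EuclideanSpace ℝ (Fin d)) : Prop where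
  injective : Function.Injective χ
  mem_normalSpace : ∀ i, χ i ∈ normalSpace n f x
  ne_bot : ∀ i, nul n f x (χ i) ≠ ⊥
  exists_eq : ∀ η, nul n f x η ≠ ⊥ → ∃ i, χ i = η
  iSup_eq : ⨆ i, nul n f x (χ i) = LinearMap.range (mdiff n f x).toLinearMap

lemma IsSmoothImmersion.exists_principalFrame (hf : IsSmoothImmersion n f)
    (hflat : HasFlatNormalBundle n f) {k : ℕ} {x : M} (hk : (principalNormalsAt n f x).encard = k) :
    ∃ χ : Fin k → EuclideanSpace ℝ (Fin d), IsPrincipalFrame n f x χ := by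
  have hfin : (principalNormalsAt n f x).Finite := Set.finite_of_encard_eq_coe hk
  have hcard : Nat.card (principalNormalsAt n f x) = k := by
    rw [Nat.card_coe_set_eq, Set.ncard, hk]; rfl
  have := hfin.to_subtype
  let e := (Finite.equivFinOfCardEq hcard).symm
  have hex : ∀ η, nul n f x η ≠ ⊥ → ∃ i, (e i : EuclideanSpace ℝ (Fin d)) = η := fun η hη =>
    ⟨e.symm ⟨η, hf.mem_normalSpace_of_nul_ne_bot hη, hf.nullity_ne_bot_iff.2 hη⟩, by simp⟩
  refine ⟨fun i => e i, fun i j h => e.injective (Subtype.ext h), fun i => (e i).2.1,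
    fun i => hf.nullity_ne_bot_iff.1 (e i).2.2, hex, ?_⟩
  rw [← hf.iSup_nul hflat]
  refine le_antisymm (iSup_le fun i => le_iSup (nul n f x) _) (iSup_le fun η => ?_)
  by_cases h : nul n f x η = ⊥
  · rw [h]; exact bot_le
  · obtain ⟨i, rfl⟩ := hex η h
    exact le_iSup (fun i => nul n f x (e i)) i

namespace IsPrincipalFrame

variable {k : ℕ} {x : M} {χ : Fin k → EuclideanSpace ℝ (Fin d)}

lemma comp_perm (h : IsPrincipalFrame n f x χ) (σ : Equiv.Perm (Fin k)) :
    IsPrincipalFrame n f x (χ ∘ σ) where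
  injective := h.injective.comp σ.injective
  mem_normalSpace i := h.mem_normalSpace _
  ne_bot i := h.ne_bot _
  exists_eq η hη := by
    obtain ⟨i, hi⟩ := h.exists_eq η hη
    exact ⟨σ.symm i, by simpa using hi⟩
  iSup_eq := by rw [← h.iSup_eq]; exact σ.iSup_comp (g := fun i => nul n f x (χ i))

lemma sum_proj (h : IsPrincipalFrame n f x χ) (hf : IsSmoothImmersion n f)
    (z : EuclideanSpace ℝ (Fin d)) : ∑ i, proj n f x (χ i) z = z - nrm n f x z := by
  have h1 := sum_starProjection (fun i j hij a ha b hb =>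
    hf.inner_eq_zero_of_mem_nul (h.injective.ne hij) ha hb) h.iSup_eq z
  have h2 : nrm n f x z = z - (LinearMap.range (mdiff n f x).toLinearMap).starProjection z := by
    change ((LinearMap.range (mdiff n f x).toLinearMap)ᗮ).starProjection z = _
    rw [Submodule.starProjection_orthogonal]
    rfl
  rw [h2, sub_sub_cancel]
  exact h1

lemma sum_proj_mdiff (h : IsPrincipalFrame n f x χ) (hf : IsSmoothImmersion n f)
    (v : EuclideanSpace ℝ (Fin n)) : ∑ i, proj n f x (χ i) (mdiff n f x v) = mdiff n f x v := by
  rw [h.sum_proj hf, nrm_mdiff, sub_zero]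

lemma proj_proj_of_ne (h : IsPrincipalFrame n f x χ) (hf : IsSmoothImmersion n f) {i j : Fin k}
    (hij : i ≠ j) (z : EuclideanSpace ℝ (Fin d)) :
    proj n f x (χ i) (proj n f x (χ j) z) = 0 :=
  proj_eq_zero_of_forall_inner fun _ ha =>
    hf.inner_eq_zero_of_mem_nul (h.injective.ne hij) ha (proj_mem _ _ _)

/-- The derivative of the Gauss map in terms of the principal normals. -/
lemma mdiff_nrm_eq (h : IsPrincipalFrame n f x χ) (hf : IsSmoothImmersion n f)
    (v : EuclideanSpace ℝ (Fin n)) (z : EuclideanSpace ℝ (Fin d)) :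
    mdiff n (nrm n f) x v z = -∑ i, (inner ℝ (proj n f x (χ i) (mdiff n f x v)) z • χ i
      + inner ℝ (χ i) z • proj n f x (χ i) (mdiff n f x v)) := by
  -- On tangent vectors the formula is the definition of the nullities, applied to the components of
  -- v.
  have htan : ∀ w, mdiff n (nrm n f) x v (mdiff n f x w)
      = -∑ i, inner ℝ (proj n f x (χ i) (mdiff n f x v)) (mdiff n f x w) • χ i := by
    intro w
    have hv : ∀ i, ∃ u, mdiff n f x u = proj n f x (χ i) (mdiff n f x v) ∧
        ∀ w, mdiff n (nrm n f) x u (mdiff n f x w)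
          = -(inner ℝ (mdiff n f x u) (mdiff n f x w) • χ i) := fun i => proj_mem _ _ _
    choose u hu hu' using hv
    have hsum : v = ∑ i, u i := hf.mdiff_injective x (by
      rw [map_sum, ← h.sum_proj_mdiff hf]; exact Finset.sum_congr rfl fun i _ => (hu i).symm)
    conv_lhs => rw [hsum, map_sum]
    rw [sum_apply, ← Finset.sum_neg_distrib]
    exact Finset.sum_congr rfl fun i _ => by rw [hu', hu]
  have hχ : ∀ i w, inner ℝ (χ i) (mdiff n f x w) = 0 := fun i w => by
    rw [real_inner_comm]
    exact DupinSubmanifold.mem_normalSpace.1 (h.mem_normalSpace i) w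
  have hq : ∀ i, ∀ ν ∈ normalSpace n f x, inner ℝ (proj n f x (χ i) (mdiff n f x v)) ν = 0 := by
    intro i ν hν
    obtain ⟨u, hu, -⟩ := proj_mem (n := n) (f := f) x (χ i) (mdiff n f x v)
    rw [← hu]
    exact DupinSubmanifold.mem_normalSpace.1 hν u
  -- Both diagonal blocks vanish, and the symmetry of ∂N reduces its action on normal vectors to
  -- `htan`.
  refine ext_inner_right ℝ fun b => ?_
  obtain ⟨w, hw⟩ := sub_nrm_eq (n := n) (f := f) x z
  obtain ⟨w', hw'⟩ := sub_nrm_eq (n := n) (f := f) x b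
  rw [sub_eq_iff_eq_add] at hw hw'
  set ν := nrm n f x z with hν
  set ν' := nrm n f x b with hν'
  have hνN : ν ∈ normalSpace n f x := nrm_mem x z
  have hνN' : ν' ∈ normalSpace n f x := nrm_mem x b
  have h1 : inner ℝ (mdiff n (nrm n f) x v ν) ν' = 0 := by
    rw [hν', ← inner_nrm, hf.nrm_mdiff_nrm_normal v hνN, inner_zero_left]
  have h2 : inner ℝ (mdiff n (nrm n f) x v (mdiff n f x w)) (mdiff n f x w') = 0 := by
    rw [htan, inner_neg_left, sum_inner]
    simp [real_inner_smul_left, hχ]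
  rw [hw, hw', map_add, inner_add_left, inner_add_right, inner_add_right, h1, h2, add_zero,
    zero_add, hf.inner_mdiff_nrm x v ν, htan, htan, inner_neg_left, inner_neg_right, sum_inner,
    inner_sum, inner_neg_left, sum_inner, ← neg_add, ← Finset.sum_add_distrib]
  congr 1
  refine Finset.sum_congr rfl fun i _ => ?_
  simp only [inner_add_left, inner_add_right, real_inner_smul_left, real_inner_smul_right,
    hq i ν hνN, hq i ν' hνN', hχ]
  rw [real_inner_comm ν (χ i)]
  ring

end IsPrincipalFrame

end Pointwise

/-! ### Smooth local enumeration of the principal normals. -/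

lemma exists_injective_inner {k : ℕ} {V : Type*} [NormedAddCommGroup V] [InnerProductSpace ℝ V]
    {χ : Fin k → V} (hχ : Function.Injective χ) :
    ∃ ξ : V, Function.Injective fun i => inner ℝ (χ i) ξ := by
  have h := Module.Dual.exists_forall_ne_zero_of_forall_exists (K := ℝ)
    (fun ij : {ij : Fin k × Fin k // ij.1 ≠ ij.2} => innerₛₗ ℝ (χ ij.1.1 - χ ij.1.2))
    (fun ij => ⟨χ ij.1.1 - χ ij.1.2, by
      rw [innerₛₗ_apply_apply]
      exact inner_self_ne_zero.2 (sub_ne_zero.2 (hχ.ne ij.2))⟩)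
  obtain ⟨ξ, hξ⟩ := h
  refine ⟨ξ, fun i j hij => ?_⟩
  by_contra hne
  apply hξ ⟨(i, j), hne⟩
  rw [innerₛₗ_apply_apply, inner_sub_left, sub_eq_zero]
  exact hij

lemma contDiffOn_flip {E G₁ G₂ G₃ : Type*} [NormedAddCommGroup E] [NormedSpace ℝ E]
    [NormedAddCommGroup G₁] [NormedSpace ℝ G₁] [FiniteDimensional ℝ G₁]
    [NormedAddCommGroup G₂] [NormedSpace ℝ G₂] [FiniteDimensional ℝ G₂]
    [NormedAddCommGroup G₃] [NormedSpace ℝ G₃] {T : E → G₁ →L[ℝ] G₂ →L[ℝ] G₃} {Ω : Set E}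
    (hT : ContDiffOn ℝ ∞ T Ω) : ContDiffOn ℝ ∞ (fun y => (T y).flip) Ω :=
  contDiffOn_clm_apply.2 fun _ => contDiffOn_clm_apply.2 fun _ =>
    (hT.clm_apply contDiffOn_const).clm_apply contDiffOn_const

section Local

variable {n d : ℕ} {M : Type*} [TopologicalSpace M] [ChartedSpace (EuclideanSpace ℝ (Fin n)) M]
  {f : M → EuclideanSpace ℝ (Fin d)}

/-- As a trace, the dimension of the nullity is continuous along a smooth family of projections;
being an integer, it is locally constant. -/
lemma trace_proj (x : M) (η : EuclideanSpace ℝ (Fin d)) :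
    LinearMap.trace ℝ _ (proj n f x η).toLinearMap = Module.finrank ℝ (nul n f x η) := by
  have h : LinearMap.IsProj (nul n f x η) (proj n f x η).toLinearMap :=
    ⟨fun z => proj_mem x η z, fun z hz => proj_eq_self hz⟩
  exact h.trace

variable [IsManifold (𝓡 n) ∞ M]

variable (n f) in
/-- `η` is a smooth enumeration, over the open subset `Ω` of the chart at `x₀`, of the principal
normals of `f`. -/
structure IsSmoothPrincipalFrame {k : ℕ} (x₀ : M) (Ω : Set (EuclideanSpace ℝ (Fin n)))
    (η : Fin k → EuclideanSpace ℝ (Fin n) → EuclideanSpace ℝ (Fin d)) : Prop where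
  isOpen : IsOpen Ω
  subset : Ω ⊆ (extChartAt (𝓡 n) x₀).target
  frame : ∀ y ∈ Ω, IsPrincipalFrame n f ((extChartAt (𝓡 n) x₀).symm y) fun i => η i y
  contDiffOn : ∀ i, ContDiffOn ℝ ∞ (η i) Ω
  contDiffOn_proj : ∀ i,
    ContDiffOn ℝ ∞ (fun y => proj n f ((extChartAt (𝓡 n) x₀).symm y) (η i y)) Ω
  finrank_eq : ∀ i, ∀ y ∈ Ω, ∀ y' ∈ Ω,
    Module.finrank ℝ (nul n f ((extChartAt (𝓡 n) x₀).symm y) (η i y))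
    = Module.finrank ℝ (nul n f ((extChartAt (𝓡 n) x₀).symm y') (η i y'))

lemma IsSmoothImmersion.apply_pseudoInverse_fderiv (hf : IsSmoothImmersion n f) {x : M}
    {y : EuclideanSpace ℝ (Fin n)} (hy : y ∈ (extChartAt (𝓡 n) x).target)
    (z : EuclideanSpace ℝ (Fin d)) :
    fderiv ℝ (inChart n f x) y (pseudoInverse (fderiv ℝ (inChart n f x) y) z)
      = z - inChart n (nrm n f) x y z := by
  rw [hf.inChart_nrm hy]
  simp

lemma IsSmoothImmersion.contDiffOn_pseudoInverse (hf : IsSmoothImmersion n f) (x : M) :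
    ContDiffOn ℝ ∞ (fun y => pseudoInverse (fderiv ℝ (inChart n f x) y))
      (extChartAt (𝓡 n) x).target := fun y hy =>
  ((contDiffAt_pseudoInverse (hf.fderiv_injective hy)).comp y
    ((hf.contDiffOn_fderiv x).contDiffAt ((isOpen_target x).mem_nhds hy))).contDiffWithinAt

lemma IsSmoothImmersion.fderiv_nrm_eq (hf : IsSmoothImmersion n f) {x : M}
    {y : EuclideanSpace ℝ (Fin n)} (hy : y ∈ (extChartAt (𝓡 n) x).target) (v) :
    fderiv ℝ (inChart n (nrm n f) x) y v
      = mdiff n (nrm n f) ((extChartAt (𝓡 n) x).symm y) (tangentChart n x y v) :=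
  fderiv_inChart hy (hf.mdifferentiableAt_nrm _) v

lemma IsPrincipalFrame.fderiv_nrm_eq {k : ℕ} {x : M} {y : EuclideanSpace ℝ (Fin n)}
    {χ : Fin k → EuclideanSpace ℝ (Fin d)}
    (h : IsPrincipalFrame n f ((extChartAt (𝓡 n) x).symm y) χ) (hf : IsSmoothImmersion n f)
    (hy : y ∈ (extChartAt (𝓡 n) x).target) (v : EuclideanSpace ℝ (Fin n))
    (z : EuclideanSpace ℝ (Fin d)) :
    fderiv ℝ (inChart n (nrm n f) x) y v z
      = -∑ i, (inner ℝ (proj n f ((extChartAt (𝓡 n) x).symm y) (χ i)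
            (fderiv ℝ (inChart n f x) y v)) z • χ i
        + inner ℝ (χ i) z •
          proj n f ((extChartAt (𝓡 n) x).symm y) (χ i) (fderiv ℝ (inChart n f x) y v)) := by
  rw [hf.fderiv_nrm_eq hy, h.mdiff_nrm_eq hf, hf.fderiv_eq hy]

/-- One shape operator suffices: if ξ separates the principal normals at x₀, the projections onto
the nullities are spectral projections of the shape operator in direction Nξ. They are smooth near
x₀ after renumbering, and the principal normals are recovered from them. -/
lemma exists_smoothPrincipalFrame (hf : IsSmoothImmersion n f) {k : ℕ}
    (h : ∀ x : M, ∃ χ : Fin k → EuclideanSpace ℝ (Fin d), IsPrincipalFrame n f x χ) (x₀ : M) :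
    ∃ Ω η, extChartAt (𝓡 n) x₀ x₀ ∈ Ω ∧ IsSmoothPrincipalFrame n f (k := k) x₀ Ω η := by
  choose χ hχ using h
  set φ := (extChartAt (𝓡 n) x₀).symm with hφ
  set y₀ := extChartAt (𝓡 n) x₀ x₀ with hy₀
  have hT := isOpen_target (n := n) x₀
  have hyT : y₀ ∈ (extChartAt (𝓡 n) x₀).target := mem_extChartAt_target x₀
  -- ξ avoids the finitely many hyperplanes orthogonal to differences of principal normals.
  obtain ⟨ξ, hξ⟩ := exists_injective_inner (hχ (φ y₀)).injective
  let J := fun y => pseudoInverse (fderiv ℝ (inChart n f x₀) y)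
  let N := inChart n (nrm n f) x₀
  have hJ : ContDiffOn ℝ ∞ J (extChartAt (𝓡 n) x₀).target := hf.contDiffOn_pseudoInverse x₀
  have hN : ContDiffOn ℝ ∞ N (extChartAt (𝓡 n) x₀).target := hf.contDiffOn_nrm x₀
  have hN' : ContDiffOn ℝ ∞ (fderiv ℝ N) (extChartAt (𝓡 n) x₀).target :=
    hN.fderiv_of_isOpen hT (by simp)
  -- The shape operator of Nξ, extended by zero to normal vectors: J y reads off the tangent part of
  -- its argument. Its eigenvalues on the nullities are the ⟨χ i, ξ⟩.
  let A := fun y => -((ContinuousLinearMap.flip (fderiv ℝ N y)) (N y ξ) ∘L J y)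
  let P := fun y => ContinuousLinearMap.id ℝ (EuclideanSpace ℝ (Fin d)) - N y
  have hA : ContDiffOn ℝ ∞ A (extChartAt (𝓡 n) x₀).target := by
    exact ((contDiffOn_flip hN').clm_apply (hN.clm_apply contDiffOn_const)).clm_comp hJ |>.neg
  have hP : ContDiffOn ℝ ∞ P (extChartAt (𝓡 n) x₀).target := contDiffOn_const.sub hN
  have hspec : ∀ y ∈ (extChartAt (𝓡 n) x₀).target, IsSpectralDecomposition (A y) (P y)
      (fun i => inner ℝ (χ (φ y) i) ξ) (fun i => proj n f (φ y) (χ (φ y) i)) := by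
    intro y hy
    refine ⟨fun i z => proj_eq_self (proj_mem _ _ _),
      fun i j hij z => (hχ (φ y)).proj_proj_of_ne hf hij z, fun z => (hχ (φ y)).sum_proj hf z,
      fun z => ?_⟩
    have h1 : A y z = -(fderiv ℝ N y (J y z) (N y ξ)) := rfl
    have h2 : fderiv ℝ (inChart n f x₀) y (J y z) = z - N y z :=
      hf.apply_pseudoInverse_fderiv hy z
    have h3 : ∀ i, proj n f (φ y) (χ (φ y) i) (N y z) = 0 := fun i => by
      refine proj_eq_zero_of_forall_inner fun a ha => ?_
      change inner ℝ a (nrm n f (φ y) z) = 0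
      rw [← inner_nrm, nrm_of_mem_nul ha, inner_zero_left]
    have h4 := (hχ (φ y)).fderiv_nrm_eq hf hy (J y z) (N y ξ)
    rw [h1, h4, neg_neg, h2]
    refine Finset.sum_congr rfl fun i _ => ?_
    have h5 : inner ℝ (χ (φ y) i) (N y ξ) = inner ℝ (χ (φ y) i) ξ := by
      change inner ℝ (χ (φ y) i) (nrm n f (φ y) ξ) = _
      rw [← inner_nrm, nrm_eq_self ((hχ (φ y)).mem_normalSpace i)]
    have h6 : ∀ w, inner ℝ (proj n f (φ y) (χ (φ y) i) w) (N y ξ) = 0 := fun w => by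
      change inner ℝ (proj n f (φ y) (χ (φ y) i) w) (nrm n f (φ y) ξ) = 0
      rw [← inner_nrm, nrm_of_mem_nul (proj_mem _ _ _), inner_zero_left]
    rw [h5, map_sub, h3, sub_zero, h6, zero_smul, zero_add]
  obtain ⟨Ω, hΩ, hΩo, hyΩ, σ, hσ⟩ := exists_contDiffOn_spectral hT hyT hA hP hspec hξ
    (fun i h0 => (hχ (φ y₀)).ne_bot i (by
      rw [Submodule.eq_bot_iff]
      intro a ha
      rw [← proj_eq_self ha, h0, zero_apply]))
  let η : Fin k → EuclideanSpace ℝ (Fin n) → EuclideanSpace ℝ (Fin d) := fun i y => χ (φ y) (σ y i)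
  have hframe : ∀ y, IsPrincipalFrame n f (φ y) fun i => η i y := fun y =>
    (hχ (φ y)).comp_perm (σ y)
  let Q := fun i y => proj n f (φ y) (η i y)
  have hQ : ∀ i, ContDiffOn ℝ ∞ (Q i) Ω := hσ
  have hb : ∀ i, ∃ b ∈ nul n f (φ y₀) (η i y₀), b ≠ 0 := fun i =>
    Submodule.exists_mem_ne_zero_of_ne_bot ((hframe y₀).ne_bot i)
  choose b hb hb0 using hb
  have hne : ∀ᶠ y in 𝓝 y₀, ∀ i, Q i y (b i) ≠ 0 := by
    refine Filter.eventually_all.2 fun i => ?_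
    refine ContinuousAt.eventually_ne
      (((hQ i).contDiffAt (hΩo.mem_nhds hyΩ)).continuousAt.clm_apply continuousAt_const) ?_
    exact (proj_eq_self (hb i)).trans_ne (hb0 i)
  have hrank : ∀ᶠ y in 𝓝 y₀, ∀ i, Module.finrank ℝ (nul n f (φ y) (η i y))
      = Module.finrank ℝ (nul n f (φ y₀) (η i y₀)) := by
    refine Filter.eventually_all.2 fun i => ?_
    let tr : (EuclideanSpace ℝ (Fin d) →L[ℝ] EuclideanSpace ℝ (Fin d)) →ₗ[ℝ] ℝ :=
      LinearMap.trace ℝ _ ∘ₗ ContinuousLinearMap.coeLM ℝ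
    have hc : ContinuousAt (fun y => tr (Q i y)) y₀ :=
      tr.continuous_of_finiteDimensional.continuousAt.comp
        ((hQ i).contDiffAt (hΩo.mem_nhds hyΩ)).continuousAt
    -- Two integers at distance less than one are equal.
    filter_upwards [hc.eventually (Metric.ball_mem_nhds _ one_pos)] with y hy
    have h1 : ∀ y, tr (Q i y) = Module.finrank ℝ (nul n f (φ y) (η i y)) := fun y => trace_proj _ _
    rw [h1, h1, Nat.dist_cast_real] at hy
    by_contra hne
    exact absurd (Nat.pairwise_one_le_dist hne) (not_le.2 hy)
  obtain ⟨Ω', hΩ', hΩo', hy'⟩ := eventually_nhds_iff.1 (hne.and (hrank.and (hΩo.eventually_mem hyΩ)))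
  refine ⟨Ω', η, hy', hΩo', fun y hy => hΩ (hΩ' y hy).2.2, fun y _ => hframe y, fun i => ?_,
    fun i => (hQ i).mono fun y hy => (hΩ' y hy).2.2, fun i y hy y' hy' =>
      ((hΩ' y hy).2.1 i).trans ((hΩ' y' hy').2.1 i).symm⟩
  have hsub : Ω' ⊆ (extChartAt (𝓡 n) x₀).target := fun y hy => hΩ (hΩ' y hy).2.2
  -- For q nonzero in the nullity, η = α(q, q) / |q|², which is smooth because q is.
  have hform : ∀ y ∈ Ω', η i y = (inner ℝ (Q i y (b i)) (Q i y (b i)))⁻¹ •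
      -(fderiv ℝ N y (J y (Q i y (b i))) (Q i y (b i))) := by
    intro y hy
    set q := Q i y (b i) with hq
    have hqm : q ∈ nul n f (φ y) (η i y) := proj_mem _ _ _
    have hq0 : q ≠ 0 := (hΩ' y hy).1 i
    have h2 : fderiv ℝ (inChart n f x₀) y (J y q) = q := by
      have h3 : N y q = 0 := nrm_of_mem_nul hqm
      have h4 := hf.apply_pseudoInverse_fderiv (hsub hy) q
      change _ = q - N y q at h4
      rwa [h3, sub_zero] at h4
    rw [hf.fderiv_eq (hsub hy)] at h2
    have h5 := hf.mdiff_mem_nul_iff.1 (h2 ▸ hqm) (tangentChart n x₀ y (J y q))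
    change mdiff n f (φ y) _ = _ at h2
    change mdiff n (nrm n f) (φ y) _ (mdiff n f (φ y) _)
      = -(inner ℝ (mdiff n f (φ y) _) (mdiff n f (φ y) _) • _) at h5
    rw [h2] at h5
    have h6 : fderiv ℝ N y (J y q) q = mdiff n (nrm n f) (φ y) (tangentChart n x₀ y (J y q)) q :=
      congrArg (fun L : EuclideanSpace ℝ (Fin d) →L[ℝ] EuclideanSpace ℝ (Fin d) => L q)
        (hf.fderiv_nrm_eq (hsub hy) (J y q))
    rw [h6, h5, neg_neg, smul_smul, inv_mul_cancel₀ (inner_self_ne_zero.2 hq0), one_smul]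
  have hq : ContDiffOn ℝ ∞ (fun y => Q i y (b i)) Ω' :=
    ((hQ i).mono fun y hy => (hΩ' y hy).2.2).clm_apply contDiffOn_const
  refine ContDiffOn.congr ?_ hform
  refine ((hq.inner ℝ hq).inv fun y hy => inner_self_ne_zero.2 ((hΩ' y hy).1 i)).smul ?_
  exact (((hN'.mono hsub).clm_apply ((hJ.mono hsub).clm_apply hq)).clm_apply hq).neg

end Local

/-! ### The Codazzi equation and its consequences. -/

/-- An immersion `g` of an open subset `Ω` of a vector space, with its normal projection `N`, its
principal normals `η i` and the orthogonal projections `Q i` onto their nullities. -/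
structure IsPrincipalData {k : ℕ} {E F : Type*} [NormedAddCommGroup E] [NormedSpace ℝ E]
    [NormedAddCommGroup F] [InnerProductSpace ℝ F] (Ω : Set E) (g : E → F) (N : E → F →L[ℝ] F)
    (η : Fin k → E → F) (Q : Fin k → E → F →L[ℝ] F) : Prop where
  isOpen : IsOpen Ω
  contDiffOn : ContDiffOn ℝ ∞ g Ω
  contDiffOn_normal : ContDiffOn ℝ ∞ N Ω
  contDiffOn_eta : ∀ i, ContDiffOn ℝ ∞ (η i) Ω
  contDiffOn_proj : ∀ i, ContDiffOn ℝ ∞ (Q i) Ω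
  fderiv_injective : ∀ y ∈ Ω, Function.Injective (fderiv ℝ g y)
  eta_injective : ∀ y ∈ Ω, Function.Injective fun i => η i y
  sub_normal : ∀ y ∈ Ω, ∀ z, ∃ v, z - N y z = fderiv ℝ g y v
  normal_fderiv : ∀ y ∈ Ω, ∀ v, N y (fderiv ℝ g y v) = 0
  normal_eta : ∀ y ∈ Ω, ∀ i, N y (η i y) = η i y
  inner_eta : ∀ y ∈ Ω, ∀ i v, inner ℝ (η i y) (fderiv ℝ g y v) = 0
  sum_proj : ∀ y ∈ Ω, ∀ z, ∑ i, Q i y z = z - N y z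
  proj_proj : ∀ y ∈ Ω, ∀ i z, Q i y (Q i y z) = Q i y z
  proj_proj_of_ne : ∀ y ∈ Ω, ∀ i j, i ≠ j → ∀ z, Q i y (Q j y z) = 0
  inner_proj : ∀ y ∈ Ω, ∀ i z w, inner ℝ (Q i y z) w = inner ℝ z (Q i y w)
  proj_ne_zero : ∀ y ∈ Ω, ∀ i, ∃ z, Q i y z ≠ 0
  fderiv_normal : ∀ y ∈ Ω, ∀ v z, fderiv ℝ N y v z
    = -∑ i, (inner ℝ (Q i y (fderiv ℝ g y v)) z • η i y
      + inner ℝ (η i y) z • Q i y (fderiv ℝ g y v))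

namespace IsPrincipalData

variable {k : ℕ} {E F : Type*} [NormedAddCommGroup E] [NormedSpace ℝ E]
    [NormedAddCommGroup F] [InnerProductSpace ℝ F] {Ω : Set E} {g : E → F} {N : E → F →L[ℝ] F}
    {η : Fin k → E → F} {Q : Fin k → E → F →L[ℝ] F} (h : IsPrincipalData Ω g N η Q) {y : E}
    (hy : y ∈ Ω)

lemma mono (h : IsPrincipalData Ω g N η Q) {Ω' : Set E} (hΩ' : IsOpen Ω') (hsub : Ω' ⊆ Ω) :
    IsPrincipalData Ω' g N η Q where
  isOpen := hΩ'
  contDiffOn := h.contDiffOn.mono hsub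
  contDiffOn_normal := h.contDiffOn_normal.mono hsub
  contDiffOn_eta i := (h.contDiffOn_eta i).mono hsub
  contDiffOn_proj i := (h.contDiffOn_proj i).mono hsub
  fderiv_injective y hy := h.fderiv_injective y (hsub hy)
  eta_injective y hy := h.eta_injective y (hsub hy)
  sub_normal y hy := h.sub_normal y (hsub hy)
  normal_fderiv y hy := h.normal_fderiv y (hsub hy)
  normal_eta y hy := h.normal_eta y (hsub hy)
  inner_eta y hy := h.inner_eta y (hsub hy)
  sum_proj y hy := h.sum_proj y (hsub hy)
  proj_proj y hy := h.proj_proj y (hsub hy)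
  proj_proj_of_ne y hy := h.proj_proj_of_ne y (hsub hy)
  inner_proj y hy := h.inner_proj y (hsub hy)
  proj_ne_zero y hy := h.proj_ne_zero y (hsub hy)
  fderiv_normal y hy := h.fderiv_normal y (hsub hy)

include h hy

lemma normal_proj (i : Fin k) (z : F) : N y (Q i y z) = 0 := by
  have h1 := h.sum_proj y hy (Q i y z)
  rw [Finset.sum_eq_single i (fun j _ hj => h.proj_proj_of_ne y hy j i hj z) (by simp),
    h.proj_proj y hy] at h1
  exact (sub_eq_self.1 h1.symm)

lemma sum_proj_fderiv (v : E) : ∑ i, Q i y (fderiv ℝ g y v) = fderiv ℝ g y v := by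
  rw [h.sum_proj y hy, h.normal_fderiv y hy, sub_zero]

lemma exists_fderiv_eq_proj (i : Fin k) (z : F) : ∃ v, fderiv ℝ g y v = Q i y z := by
  obtain ⟨v, hv⟩ := h.sub_normal y hy (Q i y z)
  exact ⟨v, by rw [← hv, h.normal_proj hy, sub_zero]⟩

lemma inner_eta_proj (i j : Fin k) (z : F) : inner ℝ (η i y) (Q j y z) = 0 := by
  obtain ⟨v, hv⟩ := h.exists_fderiv_eq_proj hy j z
  rw [← hv, h.inner_eta y hy]

lemma differentiableAt_eta (i : Fin k) : DifferentiableAt ℝ (η i) y :=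
  ((h.contDiffOn_eta i).contDiffAt (h.isOpen.mem_nhds hy)).differentiableAt (by simp)

lemma differentiableAt_proj (i : Fin k) : DifferentiableAt ℝ (Q i) y :=
  ((h.contDiffOn_proj i).contDiffAt (h.isOpen.mem_nhds hy)).differentiableAt (by simp)

lemma differentiableAt_normal : DifferentiableAt ℝ N y :=
  (h.contDiffOn_normal.contDiffAt (h.isOpen.mem_nhds hy)).differentiableAt (by simp)

lemma differentiableAt : DifferentiableAt ℝ g y :=
  (h.contDiffOn.contDiffAt (h.isOpen.mem_nhds hy)).differentiableAt (by simp)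

lemma differentiableAt_fderiv : DifferentiableAt ℝ (fderiv ℝ g) y :=
  ((h.contDiffOn.fderiv_of_isOpen h.isOpen (m := ∞) (by simp)).contDiffAt
    (h.isOpen.mem_nhds hy)).differentiableAt (by simp)

lemma fderiv_fderiv_comm (v w : E) :
    fderiv ℝ (fderiv ℝ g) y v w = fderiv ℝ (fderiv ℝ g) y w v :=
  ((h.contDiffOn.contDiffAt (h.isOpen.mem_nhds hy)).isSymmSndFDerivAt
    (by simp; exact ENat.LEInfty.out)).eq v w

lemma fderiv_fderiv_normal_comm (v w : E) :
    fderiv ℝ (fderiv ℝ N) y v w = fderiv ℝ (fderiv ℝ N) y w v :=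
  ((h.contDiffOn_normal.contDiffAt (h.isOpen.mem_nhds hy)).isSymmSndFDerivAt
    (by simp; exact ENat.LEInfty.out)).eq v w

lemma fderiv_normal_fderiv_comm (u v : E) :
    fderiv ℝ N y u (fderiv ℝ g y v) = fderiv ℝ N y v (fderiv ℝ g y u) := by
  rw [h.fderiv_normal y hy, h.fderiv_normal y hy]
  congr 1
  refine Finset.sum_congr rfl fun i _ => ?_
  rw [h.inner_eta y hy, h.inner_eta y hy, zero_smul, zero_smul, h.inner_proj y hy, real_inner_comm]

/-- Differentiate Q i ∘ Q j = 0. -/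
lemma fderiv_proj_proj_of_ne {i j : Fin k} (hij : i ≠ j) (u : E) (z : F) :
    Q i y (fderiv ℝ (Q j) y u z) = -fderiv ℝ (Q i) y u (Q j y z) := by
  have h0 : (fun y => Q i y (Q j y z)) =ᶠ[𝓝 y] fun _ => 0 := by
    filter_upwards [h.isOpen.mem_nhds hy] with y' hy' using h.proj_proj_of_ne y' hy' i j hij z
  have h1 : fderiv ℝ (fun y => Q i y (Q j y z)) y = fderiv ℝ (fun _ => (0 : F)) y := h0.fderiv_eq
  have hd : DifferentiableAt ℝ (fun y => Q j y z) y :=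
    (h.differentiableAt_proj hy j).clm_apply (differentiableAt_const z)
  rw [fderiv_clm_apply (h.differentiableAt_proj hy i) hd,
    fderiv_clm_apply (h.differentiableAt_proj hy j) (differentiableAt_const z)] at h1
  have h2 := congrArg (fun L : E →L[ℝ] F => L u) h1
  simp only [fderiv_fun_const, Pi.zero_apply, ContinuousLinearMap.comp_zero, zero_add, add_apply,
    ContinuousLinearMap.comp_apply, ContinuousLinearMap.flip_apply, zero_apply] at h2
  exact eq_neg_of_add_eq_zero_left h2

lemma sum_fderiv_proj (u : E) (z : F) : ∑ i, fderiv ℝ (Q i) y u z = -fderiv ℝ N y u z := by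
  have h0 : (fun y => ∑ i, Q i y) =ᶠ[𝓝 y] fun y => ContinuousLinearMap.id ℝ F - N y := by
    filter_upwards [h.isOpen.mem_nhds hy] with y' hy'
    ext z
    simpa using h.sum_proj y' hy' z
  have h1 : fderiv ℝ (fun y => ∑ i, Q i y) y = fderiv ℝ (fun y => ContinuousLinearMap.id ℝ F - N y) y :=
    h0.fderiv_eq
  rw [fderiv_fun_sum fun i _ => h.differentiableAt_proj hy i, fderiv_const_sub] at h1
  have h2 := congrArg (fun L : E →L[ℝ] F →L[ℝ] F => L u z) h1
  simpa using h2

lemma fderiv_fderiv_normal (u v : E) (z : F) :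
    fderiv ℝ (fderiv ℝ N) y u v z
      = -∑ i, (inner ℝ (fderiv ℝ (Q i) y u (fderiv ℝ g y v)
            + Q i y (fderiv ℝ (fderiv ℝ g) y u v)) z • η i y
          + inner ℝ (Q i y (fderiv ℝ g y v)) z • fderiv ℝ (η i) y u
          + inner ℝ (fderiv ℝ (η i) y u) z • Q i y (fderiv ℝ g y v)
          + inner ℝ (η i y) z • (fderiv ℝ (Q i) y u (fderiv ℝ g y v)
            + Q i y (fderiv ℝ (fderiv ℝ g) y u v))) := by
  have hN' : DifferentiableAt ℝ (fderiv ℝ N) y :=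
    ((h.contDiffOn_normal.fderiv_of_isOpen h.isOpen (m := ∞) (by simp)).contDiffAt
      (h.isOpen.mem_nhds hy)).differentiableAt (by simp)
  have hq : ∀ i, HasFDerivAt (fun y => Q i y (fderiv ℝ g y v))
      ((Q i y).comp ((fderiv ℝ (fderiv ℝ g) y).flip v)
        + (fderiv ℝ (Q i) y).flip (fderiv ℝ g y v)) y := fun i => by
    have h1 : HasFDerivAt (fun y => fderiv ℝ g y v) ((fderiv ℝ (fderiv ℝ g) y).flip v) y := by
      simpa using (h.differentiableAt_fderiv hy).hasFDerivAt.clm_apply (hasFDerivAt_const v y)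
    exact (h.differentiableAt_proj hy i).hasFDerivAt.clm_apply h1
  have hL : HasFDerivAt (fun y => fderiv ℝ N y v z)
      (((fderiv ℝ (fderiv ℝ N) y).flip v).flip z) y := by
    have h1 : HasFDerivAt (fun y => fderiv ℝ N y v) ((fderiv ℝ (fderiv ℝ N) y).flip v) y := by
      simpa using hN'.hasFDerivAt.clm_apply (hasFDerivAt_const v y)
    simpa using h1.clm_apply (hasFDerivAt_const z y)
  have hη := fun i => (h.differentiableAt_eta hy i).hasFDerivAt
  have hR := HasFDerivAt.fun_neg (HasFDerivAt.fun_sum (u := Finset.univ) fun i _ =>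
    (((hq i).inner ℝ (hasFDerivAt_const z y)).fun_smul (hη i)).fun_add
      (((hη i).inner ℝ (hasFDerivAt_const z y)).fun_smul (hq i)))
  have h0 : (fun y => fderiv ℝ N y v z) =ᶠ[𝓝 y]
      fun y => -∑ i, (inner ℝ (Q i y (fderiv ℝ g y v)) z • η i y
        + inner ℝ (η i y) z • Q i y (fderiv ℝ g y v)) := by
    filter_upwards [h.isOpen.mem_nhds hy] with y' hy' using h.fderiv_normal y' hy' v z
  have h3 := congrArg (fun L : E →L[ℝ] F => L u) (hL.unique (hR.congr_of_eventuallyEq h0))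
  simp only [ContinuousLinearMap.flip_apply] at h3
  rw [h3]
  simp only [neg_apply, sum_apply, add_apply, smul_apply, ContinuousLinearMap.smulRight_apply,
    ContinuousLinearMap.comp_apply, ContinuousLinearMap.prod_apply, fderivInnerCLM_apply,
    ContinuousLinearMap.flip_apply, zero_apply, inner_zero_right, zero_add]
  congr 1
  refine Finset.sum_congr rfl fun i _ => ?_
  rw [add_comm (Q i y _) (fderiv ℝ (Q i) y u _)]
  abel

/-- The Codazzi equation. -/
lemma codazzi (c : Fin k) (u v : E) (w : F) :
    ∑ i, inner ℝ (fderiv ℝ (Q c) y u (Q i y (fderiv ℝ g y v))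
        - fderiv ℝ (Q c) y v (Q i y (fderiv ℝ g y u))) w • (η i y - η c y)
      = inner ℝ (Q c y (fderiv ℝ g y v)) w • N y (fderiv ℝ (η c) y u)
        - inner ℝ (Q c y (fderiv ℝ g y u)) w • N y (fderiv ℝ (η c) y v) := by
  -- The alternating parts T i sum to zero because the second fundamental form is symmetric. This
  -- allows η i to be replaced by η i - η c in the final sum.
  set T : Fin k → F := fun i =>
    fderiv ℝ (Q i) y u (fderiv ℝ g y v) - fderiv ℝ (Q i) y v (fderiv ℝ g y u) with hT
  have hsum : ∑ i, T i = 0 := by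
    rw [hT, Finset.sum_sub_distrib, h.sum_fderiv_proj hy, h.sum_fderiv_proj hy,
      h.fderiv_normal_fderiv_comm hy u v, sub_self]
  -- The equation is the normal part of the symmetric second derivative of N, evaluated on a vector
  -- of E_c; this vector singles out the derivative of η c.
  have hone : ∀ (u v : E), N y (fderiv ℝ (fderiv ℝ N) y u v (Q c y w))
      = -(∑ i, inner ℝ (fderiv ℝ (Q i) y u (fderiv ℝ g y v)
            + Q i y (fderiv ℝ (fderiv ℝ g) y u v)) (Q c y w) • η i y
          + inner ℝ (Q c y (fderiv ℝ g y v)) w • N y (fderiv ℝ (η c) y u)) := by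
    intro u v
    rw [h.fderiv_fderiv_normal hy, map_neg, map_sum]
    congr 1
    have h1 : inner ℝ (Q c y (fderiv ℝ g y v)) w • N y (fderiv ℝ (η c) y u)
        = ∑ i, inner ℝ (Q i y (fderiv ℝ g y v)) (Q c y w) • N y (fderiv ℝ (η i) y u) := by
      rw [Finset.sum_eq_single c]
      · rw [← h.inner_proj y hy, h.proj_proj y hy]
      · intro i _ hi
        rw [← h.inner_proj y hy, h.proj_proj_of_ne y hy _ _ hi.symm, inner_zero_left, zero_smul]
      · simp
    rw [h1, ← Finset.sum_add_distrib]
    refine Finset.sum_congr rfl fun i _ => ?_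
    simp only [map_add, map_smul, h.normal_eta y hy, h.normal_proj hy, h.inner_eta_proj hy,
      smul_zero, zero_smul, add_zero]
  have h2 := congrArg (fun L : F →L[ℝ] F => N y (L (Q c y w))) (h.fderiv_fderiv_normal_comm hy u v)
  simp only [hone] at h2
  rw [neg_inj, h.fderiv_fderiv_comm hy v u, ← sub_eq_zero, add_sub_add_comm,
    ← Finset.sum_sub_distrib] at h2
  -- For i ≠ c, the E_c component of ∂Q_i on tangent vectors is turned into ∂Q_c on E_i; for i = c
  -- the factor η i - η c vanishes.
  have h3 : ∀ i, inner ℝ (fderiv ℝ (Q c) y u (Q i y (fderiv ℝ g y v))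
        - fderiv ℝ (Q c) y v (Q i y (fderiv ℝ g y u))) w • (η i y - η c y)
      = -(inner ℝ (T i) (Q c y w) • (η i y - η c y)) := by
    intro i
    by_cases hi : i = c
    · subst hi; simp
    · rw [← h.inner_proj y hy c (T i) w, hT, map_sub, h.fderiv_proj_proj_of_ne hy (Ne.symm hi),
        h.fderiv_proj_proj_of_ne hy (Ne.symm hi), ← neg_smul, ← inner_neg_left, neg_sub_neg,
        ← neg_sub (fderiv ℝ (Q c) y u _), neg_neg]
  rw [Finset.sum_congr rfl fun i _ => h3 i, Finset.sum_neg_distrib, neg_eq_iff_add_eq_zero]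
  rw [← h2]
  congr 1
  simp only [smul_sub, Finset.sum_sub_distrib, ← Finset.sum_smul, ← sum_inner, hsum,
    inner_zero_left, zero_smul, sub_zero]
  rw [← Finset.sum_sub_distrib]
  refine Finset.sum_congr rfl fun i _ => ?_
  rw [← sub_smul, ← inner_sub_left, add_sub_add_right_eq_sub]

/-- For u in E_b and v in E_a the right side of the Codazzi equation vanishes, and only the terms a
and b of the sum remain. -/
lemma codazzi_of_ne {a b c : Fin k} (ha : a ≠ c) (hb : b ≠ c) {u v : E}
    (hv : Q a y (fderiv ℝ g y v) = fderiv ℝ g y v) (hu : Q b y (fderiv ℝ g y u) = fderiv ℝ g y u)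
    (w : F) :
    inner ℝ (fderiv ℝ (Q c) y u (fderiv ℝ g y v)) w • (η a y - η c y)
      = inner ℝ (fderiv ℝ (Q c) y v (fderiv ℝ g y u)) w • (η b y - η c y) := by
  have h1 := h.codazzi hy c u v w
  rw [← hv, ← hu, h.proj_proj_of_ne y hy c a ha.symm, h.proj_proj_of_ne y hy c b hb.symm,
    inner_zero_left, zero_smul, zero_smul, sub_zero] at h1
  simp only [inner_sub_left, sub_smul, Finset.sum_sub_distrib] at h1
  rw [sub_eq_zero, Finset.sum_eq_single a, Finset.sum_eq_single b] at h1
  · rwa [h.proj_proj y hy, h.proj_proj y hy, hv, hu] at h1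
  · intro i _ hi
    rw [h.proj_proj_of_ne y hy _ _ hi, map_zero, inner_zero_left, zero_smul]
  · simp
  · intro i _ hi
    rw [h.proj_proj_of_ne y hy _ _ hi, map_zero, inner_zero_left, zero_smul]
  · simp

/-- If no two principal normals are collinear with `η c`, the derivative of the projection onto the
nullity of `η c` is symmetric on the conullity. -/
lemma fderiv_proj_comm_of_linearIndependent {c : Fin k}
    (hc : ∀ a b, a ≠ b → a ≠ c → b ≠ c → LinearIndependent ℝ ![η a y - η c y, η b y - η c y])
    {u v : E} (hu : Q c y (fderiv ℝ g y u) = 0) (hv : Q c y (fderiv ℝ g y v) = 0) :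
    fderiv ℝ (Q c) y u (fderiv ℝ g y v) = fderiv ℝ (Q c) y v (fderiv ℝ g y u) := by
  have hsplit : ∀ u : E, Q c y (fderiv ℝ g y u) = 0 → ∃ s : Fin k → E, u = ∑ i, s i ∧ s c = 0 ∧
      ∀ i, Q i y (fderiv ℝ g y (s i)) = fderiv ℝ g y (s i) := by
    intro u hu
    have h1 := fun i => h.exists_fderiv_eq_proj hy i (fderiv ℝ g y u)
    choose s hs using h1
    refine ⟨s, h.fderiv_injective y hy ?_, h.fderiv_injective y hy ?_, fun i => ?_⟩
    · rw [map_sum, Finset.sum_congr rfl fun i _ => hs i, h.sum_proj_fderiv hy]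
    · rw [hs, hu, map_zero]
    · rw [hs, h.proj_proj y hy]
  obtain ⟨s, rfl, hsc, hs⟩ := hsplit u hu
  obtain ⟨t, rfl, htc, ht⟩ := hsplit v hv
  simp only [map_sum, sum_apply]
  rw [Finset.sum_comm]
  refine Finset.sum_congr rfl fun a _ => Finset.sum_congr rfl fun b _ => ?_
  by_cases ha : a = c
  · subst ha; simp [hsc]
  by_cases hb : b = c
  · subst hb; simp [htc]
  refine ext_inner_right ℝ fun w => ?_
  have h1 := h.codazzi_of_ne hy hb ha (ht b) (hs a) w
  -- For a = b both coefficients multiply the same nonzero vector, hence agree. For a ≠ b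
  -- independence makes both of them zero.
  by_cases hab : a = b
  · subst hab
    exact smul_left_injective ℝ (sub_ne_zero.2 fun h0 => ha (h.eta_injective y hy h0)) h1
  · have h2 := LinearIndependent.pair_iff.1 (hc b a (Ne.symm hab) hb ha)
      (inner ℝ (fderiv ℝ (Q c) y (s a) (fderiv ℝ g y (t b))) w)
      (-inner ℝ (fderiv ℝ (Q c) y (t b) (fderiv ℝ g y (s a))) w) (by
        rw [neg_smul, h1, add_neg_cancel])
    rw [h2.1, neg_eq_zero.1 h2.2]

/-- The normal derivative of a Dupin principal normal lies in the span of the differences of the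
principal normals. -/
lemma normal_fderiv_eta_mem {c : Fin k}
    (hD : ∀ v, Q c y (fderiv ℝ g y v) = fderiv ℝ g y v → N y (fderiv ℝ (η c) y v) = 0) (v : E) :
    N y (fderiv ℝ (η c) y v) ∈ Submodule.span ℝ (Set.range fun i => η i y - η c y) := by
  have h1 := fun i => h.exists_fderiv_eq_proj hy i (fderiv ℝ g y v)
  choose s hs using h1
  have hv : v = ∑ i, s i := h.fderiv_injective y hy (by
    rw [map_sum, Finset.sum_congr rfl fun i _ => hs i, h.sum_proj_fderiv hy])
  rw [hv, map_sum, map_sum]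
  refine Submodule.sum_mem _ fun a _ => ?_
  have ha : Q a y (fderiv ℝ g y (s a)) = fderiv ℝ g y (s a) := by rw [hs, h.proj_proj y hy]
  by_cases hac : a = c
  · subst hac
    rw [hD _ ha]
    exact Submodule.zero_mem _
  · obtain ⟨z, hz⟩ := h.proj_ne_zero y hy c
    obtain ⟨u, hu⟩ := h.exists_fderiv_eq_proj hy c z
    -- With u in E_c and s a in E_a, the right side reduces to a nonzero multiple of the normal
    -- derivative of η c along s a. Along E_c itself the Dupin condition applies.
    have h2 := h.codazzi hy c u (s a) (Q c y z)
    rw [← ha, hu, h.proj_proj y hy, h.proj_proj_of_ne y hy c a (Ne.symm hac), inner_zero_left,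
      zero_smul, zero_sub] at h2
    have h3 : N y (fderiv ℝ (η c) y (s a)) = -((inner ℝ (Q c y z) (Q c y z))⁻¹ •
        -(inner ℝ (Q c y z) (Q c y z) • N y (fderiv ℝ (η c) y (s a)))) := by
      rw [smul_neg, neg_neg, smul_smul, inv_mul_cancel₀ (inner_self_ne_zero.2 hz), one_smul]
    rw [h3, ← h2]
    exact Submodule.neg_mem _ (Submodule.smul_mem _ _ (Submodule.sum_mem _ fun i _ =>
      Submodule.smul_mem _ _ (Submodule.subset_span ⟨i, rfl⟩)))

end IsPrincipalData

/-! ### Integrable conullity and collinear principal normals. -/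

section Transfer

variable {n d : ℕ} {M : Type*} [TopologicalSpace M] [ChartedSpace (EuclideanSpace ℝ (Fin n)) M]
  [IsManifold (𝓡 n) ∞ M] {f : M → EuclideanSpace ℝ (Fin d)} {k : ℕ} {x₀ : M}
  {Ω : Set (EuclideanSpace ℝ (Fin n))}
  {η : Fin k → EuclideanSpace ℝ (Fin n) → EuclideanSpace ℝ (Fin d)}

lemma mdifferentiableAt_comp_chart {G : Type*} [NormedAddCommGroup G] [NormedSpace ℝ G]
    {g : EuclideanSpace ℝ (Fin n) → G} (hΩ : IsOpen Ω) (hg : ContDiffOn ℝ ∞ g Ω)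
    (hsub : Ω ⊆ (extChartAt (𝓡 n) x₀).target) {y : EuclideanSpace ℝ (Fin n)} (hy : y ∈ Ω) :
    MDifferentiableAt (𝓡 n) 𝓘(ℝ, G) (g ∘ extChartAt (𝓡 n) x₀) ((extChartAt (𝓡 n) x₀).symm y) := by
  refine mdifferentiableAt_of_contMDiffOn (isOpen_source_inter hΩ x₀) (contMDiffOn_comp_chart hg x₀)
    ⟨(extChartAt (𝓡 n) x₀).map_target (hsub hy), ?_⟩
  rwa [Set.mem_preimage, (extChartAt (𝓡 n) x₀).right_inv (hsub hy)]

lemma mdiff_comp_chart {G : Type*} [NormedAddCommGroup G] [NormedSpace ℝ G]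
    {g : EuclideanSpace ℝ (Fin n) → G} (hΩ : IsOpen Ω) (hg : ContDiffOn ℝ ∞ g Ω)
    (hsub : Ω ⊆ (extChartAt (𝓡 n) x₀).target) {y : EuclideanSpace ℝ (Fin n)} (hy : y ∈ Ω)
    (v : EuclideanSpace ℝ (Fin n)) :
    mdiff n (g ∘ extChartAt (𝓡 n) x₀) ((extChartAt (𝓡 n) x₀).symm y) (tangentChart n x₀ y v)
      = fderiv ℝ g y v := by
  rw [← fderiv_inChart (hsub hy) (mdifferentiableAt_comp_chart hΩ hg hsub hy)]
  have h1 : inChart n (g ∘ extChartAt (𝓡 n) x₀) x₀ =ᶠ[𝓝 y] g := by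
    filter_upwards [hΩ.mem_nhds hy] with y' hy'
    exact congrArg g ((extChartAt (𝓡 n) x₀).right_inv (hsub hy'))
  rw [h1.fderiv_eq]

namespace IsSmoothPrincipalFrame

variable (hF : IsSmoothPrincipalFrame n f x₀ Ω η) (hf : IsSmoothImmersion n f)

include hF hf

lemma isPrincipalData : IsPrincipalData Ω (inChart n f x₀) (inChart n (nrm n f) x₀) η
    fun i y => proj n f ((extChartAt (𝓡 n) x₀).symm y) (η i y) where
  isOpen := hF.isOpen
  contDiffOn := (hf.contDiffOn_inChart x₀).mono hF.subset
  contDiffOn_normal := (hf.contDiffOn_nrm x₀).mono hF.subset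
  contDiffOn_eta := hF.contDiffOn
  contDiffOn_proj := hF.contDiffOn_proj
  fderiv_injective y hy := hf.fderiv_injective (hF.subset hy)
  eta_injective y hy := (hF.frame y hy).injective
  sub_normal y hy z := ⟨_, (hf.apply_pseudoInverse_fderiv (hF.subset hy) z).symm⟩
  normal_fderiv y hy v := by
    rw [hf.fderiv_eq (hF.subset hy)]
    exact nrm_mdiff _ _
  normal_eta y hy i := nrm_eq_self ((hF.frame y hy).mem_normalSpace i)
  inner_eta y hy i v := by
    rw [hf.fderiv_eq (hF.subset hy), real_inner_comm]
    exact mem_normalSpace.1 ((hF.frame y hy).mem_normalSpace i) _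
  sum_proj y hy z := (hF.frame y hy).sum_proj hf z
  proj_proj y hy i z := proj_eq_self (proj_mem _ _ _)
  proj_proj_of_ne y hy i j hij z := (hF.frame y hy).proj_proj_of_ne hf hij z
  inner_proj y hy i z w := inner_proj _ _ _ _
  proj_ne_zero y hy i := by
    obtain ⟨a, ha, ha0⟩ := Submodule.exists_mem_ne_zero_of_ne_bot ((hF.frame y hy).ne_bot i)
    exact ⟨a, by rwa [proj_eq_self ha]⟩
  fderiv_normal y hy v z := (hF.frame y hy).fderiv_nrm_eq hf (hF.subset hy) v z

lemma isPrincipalNormalOn {V : Set (EuclideanSpace ℝ (Fin n))} (hV : V ⊆ Ω)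
    {y : EuclideanSpace ℝ (Fin n)} (hy : y ∈ Ω) (c : Fin k) :
    IsPrincipalNormalOn n f (η c ∘ extChartAt (𝓡 n) x₀)
      ((extChartAt (𝓡 n) x₀).source ∩ extChartAt (𝓡 n) x₀ ⁻¹' V) := by
  refine ⟨⟨contMDiffOn_comp_chart ((hF.contDiffOn c).mono hV) x₀, fun x hx => ?_⟩,
    Module.finrank ℝ (nul n f ((extChartAt (𝓡 n) x₀).symm y) (η c y)), ?_, fun x hx => ?_⟩
  · have h1 := (hF.frame _ (hV hx.2)).mem_normalSpace c
    rwa [(extChartAt (𝓡 n) x₀).left_inv hx.1] at h1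
  · exact Submodule.one_le_finrank_iff.2 ((hF.frame y hy).ne_bot c)
  · rw [(hf.nullityEquiv x _).finrank_eq, ← hF.finrank_eq c _ (hV hx.2) y hy,
      (extChartAt (𝓡 n) x₀).left_inv hx.1]
    rfl

lemma mem_source_inter {V : Set (EuclideanSpace ℝ (Fin n))} (hV : V ⊆ Ω)
    {y : EuclideanSpace ℝ (Fin n)} (hy : y ∈ V) :
    (extChartAt (𝓡 n) x₀).symm y ∈
      (extChartAt (𝓡 n) x₀).source ∩ extChartAt (𝓡 n) x₀ ⁻¹' V := by
  refine ⟨(extChartAt (𝓡 n) x₀).map_target (hF.subset (hV hy)), ?_⟩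
  rwa [Set.mem_preimage, (extChartAt (𝓡 n) x₀).right_inv (hF.subset (hV hy))]

lemma normal_fderiv_eta (hD : ∀ (U : Set M) (ζ : M → EuclideanSpace ℝ (Fin d)), IsOpen U →
      IsPrincipalNormalOn n f ζ U → IsDupinOn n f ζ U)
    {y : EuclideanSpace ℝ (Fin n)} (hy : y ∈ Ω) (c : Fin k) {v : EuclideanSpace ℝ (Fin n)}
    (hv : proj n f ((extChartAt (𝓡 n) x₀).symm y) (η c y) (fderiv ℝ (inChart n f x₀) y v)
      = fderiv ℝ (inChart n f x₀) y v) :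
    inChart n (nrm n f) x₀ y (fderiv ℝ (η c) y v) = 0 := by
  have hηc : (η c ∘ extChartAt (𝓡 n) x₀) ((extChartAt (𝓡 n) x₀).symm y) = η c y :=
    congrArg (η c) ((extChartAt (𝓡 n) x₀).right_inv (hF.subset hy))
  have h1 := hD _ _ (isOpen_source_inter hF.isOpen x₀)
    (hF.isPrincipalNormalOn hf subset_rfl hy c) _ (hF.mem_source_inter hf subset_rfl hy)
    (tangentChart n x₀ y v) (by
      refine (hf.mem_nullity_iff _).2 ?_
      rw [hηc]
      have h2 := proj_mem (n := n) (f := f) ((extChartAt (𝓡 n) x₀).symm y) (η c y)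
        (fderiv ℝ (inChart n f x₀) y v)
      rwa [hv, hf.fderiv_eq (hF.subset hy)] at h2)
  rw [← mdiff_comp_chart hF.isOpen (hF.contDiffOn c) hF.subset hy]
  exact h1

/-- A principal normal which is not collinear with any two others has integrable conullity. -/
lemma hasIntegrableConullityOn {V : Set (EuclideanSpace ℝ (Fin n))} (hV : V ⊆ Ω) {c : Fin k}
    (hc : ∀ y ∈ V, ∀ a b, a ≠ b → a ≠ c → b ≠ c →
      LinearIndependent ℝ ![η a y - η c y, η b y - η c y]) :
    HasIntegrableConullityOn n f (η c ∘ extChartAt (𝓡 n) x₀)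
      ((extChartAt (𝓡 n) x₀).source ∩ extChartAt (𝓡 n) x₀ ⁻¹' V) := by
  intro U' hU' hsub X Y hX hY hXc hYc x hx w hw
  set y := extChartAt (𝓡 n) x₀ x with hydef
  have hyV : y ∈ V := (hsub hx).2
  have hxy : (extChartAt (𝓡 n) x₀).symm y = x := (extChartAt (𝓡 n) x₀).left_inv (hsub hx).1
  let Q : EuclideanSpace ℝ (Fin n) → EuclideanSpace ℝ (Fin d) →L[ℝ] EuclideanSpace ℝ (Fin d) :=
    fun y => proj n f ((extChartAt (𝓡 n) x₀).symm y) (η c y)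
  let q : M → EuclideanSpace ℝ (Fin d) →L[ℝ] EuclideanSpace ℝ (Fin d) :=
    Q ∘ extChartAt (𝓡 n) x₀
  have hqz : ∀ z ∈ U', q z = proj n f z ((η c ∘ extChartAt (𝓡 n) x₀) z) := fun z hz =>
    congrArg (fun z' => proj n f z' (η c (extChartAt (𝓡 n) x₀ z)))
      ((extChartAt (𝓡 n) x₀).left_inv (hsub hz).1)
  have hqmem : ∀ z ∈ U', ∀ a ∈ nul n f z ((η c ∘ extChartAt (𝓡 n) x₀) z),
      ∃ v ∈ nullity n f z ((η c ∘ extChartAt (𝓡 n) x₀) z), mdiff n f z v = a := by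
    rintro z hz a ha
    obtain ⟨v, rfl, -⟩ := id ha
    exact ⟨v, (hf.mem_nullity_iff v).2 ha, rfl⟩
  have hzero : ∀ (Z : (x : M) → TangentSpace (𝓡 n) x),
      (∀ x ∈ U', Z x ∈ conullity n f x ((η c ∘ extChartAt (𝓡 n) x₀) x)) →
      ∀ z ∈ U', q z (mdiff n f z (vec Z z)) = 0 := by
    intro Z hZ z hz
    rw [hqz z hz]
    refine proj_eq_zero_of_forall_inner fun a ha => ?_
    obtain ⟨v, hv, rfl⟩ := hqmem z hz a ha
    rw [real_inner_comm]
    exact hZ z hz v hv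
  have hqd : MDifferentiableAt (𝓡 n) 𝓘(ℝ, EuclideanSpace ℝ (Fin d) →L[ℝ] EuclideanSpace ℝ (Fin d)) q x := by
    have h1 := mdifferentiableAt_comp_chart (x₀ := x₀) hF.isOpen (hF.contDiffOn_proj c) hF.subset
      (hV hyV)
    rwa [hxy] at h1
  -- Differentiate q(df Z) = 0, where q projects onto the nullity of η c and Z lies in the
  -- conullity.
  have hder : ∀ (Z : (x : M) → TangentSpace (𝓡 n) x), IsSmoothVectorFieldOn n Z U' →
      (∀ x ∈ U', Z x ∈ conullity n f x ((η c ∘ extChartAt (𝓡 n) x₀) x)) → ∀ v,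
      q x (mdiff n (fun z => mdiff n f z (vec Z z)) x v)
        = -mdiff n q x v (mdiff n f x (vec Z x)) := by
    intro Z hZ hZc v
    have h1 := mdiff_clm_apply hqd (mdifferentiableAt_mdiff_apply hU' (hf.contMDiffOn U') hx
      (hZ.mdifferentiableAt hU' hx)) v
    have h2 : (fun z => q z (mdiff n f z (vec Z z))) =ᶠ[𝓝 x] fun _ => 0 := by
      filter_upwards [hU'.mem_nhds hx] with z hz using hzero Z hZc z hz
    rw [mdiff_congr h2, mdiff_const, zero_apply] at h1
    exact (neg_eq_of_add_eq_zero_right h1.symm).symm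
  have hqc : ∀ v, mdiff n q x (tangentChart n x₀ y v) = fderiv ℝ Q y v := fun v => by
    have h1 := mdiff_comp_chart (x₀ := x₀) hF.isOpen (hF.contDiffOn_proj c) hF.subset (hV hyV) v
    rw [hxy] at h1
    exact h1
  have hDf : ∀ v, fderiv ℝ (inChart n f x₀) y v = mdiff n f x (tangentChart n x₀ y v) := fun v => by
    rw [hf.fderiv_eq (hF.subset (hV hyV)), hxy]
  obtain ⟨u, hu⟩ := surjective_tangentChart (hF.subset (hV hyV)) (vec X x)
  obtain ⟨v, hv⟩ := surjective_tangentChart (hF.subset (hV hyV)) (vec Y x)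
  -- The nullity part of df [X, Y] is the alternation of ∂q on X and Y, which is zero by the
  -- symmetry obtained from the Codazzi equation.
  have hbr : q x (mdiff n f x (vec (VectorField.mlieBracket (𝓡 n) X Y) x)) = 0 := by
    rw [mdiff_mlieBracket hU' (hf.contMDiffOn U') hx (hY.mdifferentiableAt hU' hx)
      (hX.mdifferentiableAt hU' hx), map_sub, hder Y hY hYc, hder X hX hXc, ← hu, ← hv, hqc, hqc,
      ← hDf, ← hDf, sub_eq_zero, neg_inj]
    refine (hF.isPrincipalData hf).fderiv_proj_comm_of_linearIndependent (hV hyV) (hc y hyV) ?_ ?_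
    · rw [hDf, hu]; exact hzero X hXc x hx
    · rw [hDf, hv]; exact hzero Y hYc x hx
  have hw' : q x (mdiff n f x w) = mdiff n f x w := by
    rw [hqz x hx]
    exact proj_eq_self ((hf.mem_nullity_iff w).1 hw)
  change inner ℝ (mdiff n f x (vec (VectorField.mlieBracket (𝓡 n) X Y) x)) (mdiff n f x w) = 0
  rw [← hw', hqz x hx, ← inner_proj, ← hqz x hx, hbr, inner_zero_left]

/-- In a locally weakly irreducible submanifold, every principal normal lies on a line through two
others. -/
lemma exists_not_linearIndependent (hirr : IsLocallyWeaklyIrreducible n f)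
    {y : EuclideanSpace ℝ (Fin n)} (hy : y ∈ Ω) (c : Fin k) :
    ∃ a b, a ≠ b ∧ a ≠ c ∧ b ≠ c ∧ ¬ LinearIndependent ℝ ![η a y - η c y, η b y - η c y] := by
  by_contra! hcon
  have hcont : ∀ i, ContinuousAt (η i) y := fun i =>
    ((hF.contDiffOn i).contDiffAt (hF.isOpen.mem_nhds hy)).continuousAt
  -- Independence is an open condition, so at a single point it already produces an open set on
  -- which f is weakly reducible.
  have hev : ∀ᶠ y' in 𝓝 y, ∀ a b, a ≠ b → a ≠ c → b ≠ c →
      LinearIndependent ℝ ![η a y' - η c y', η b y' - η c y'] := by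
    refine Filter.eventually_all.2 fun a => Filter.eventually_all.2 fun b => ?_
    by_cases hab : a ≠ b ∧ a ≠ c ∧ b ≠ c
    · have h1 : ContinuousAt (fun y' => ![η a y' - η c y', η b y' - η c y']) y :=
        continuousAt_pi.2 fun i => by
          fin_cases i
          · exact (hcont a).sub (hcont c)
          · exact (hcont b).sub (hcont c)
      filter_upwards [h1.eventually (isOpen_setOfPred_linearIndependent.mem_nhds
        (hcon a b hab.1 hab.2.1 hab.2.2))] with y' hy' _ _ _ using hy'
    · exact Filter.Eventually.of_forall fun y' h1 h2 h3 => absurd ⟨h1, h2, h3⟩ hab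
  obtain ⟨V, hV, hVo, hyV⟩ := eventually_nhds_iff.1 (hev.and (hF.isOpen.eventually_mem hy))
  have hVΩ : V ⊆ Ω := fun y' hy' => (hV y' hy').2
  exact hirr _ (isOpen_source_inter hVo x₀) ⟨_, hF.mem_source_inter hf hVΩ hyV⟩
    ⟨_, hF.isPrincipalNormalOn hf hVΩ hy c,
      hF.hasIntegrableConullityOn hf hVΩ fun y' hy' => (hV y' hy').1⟩

end IsSmoothPrincipalFrame

end Transfer

/-! ### Reduction of the conformal codimension. -/

lemma eventually_mem_of_fderiv_mem {E G : Type*} [NormedAddCommGroup E] [NormedSpace ℝ E]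
    [NormedAddCommGroup G] [NormedSpace ℝ G] [FiniteDimensional ℝ G] {W : Submodule ℝ G}
    {H : E → G} {y₀ : E} (h₀ : H y₀ ∈ W) (hd : ∀ᶠ y in 𝓝 y₀, DifferentiableAt ℝ H y)
    (hW : ∀ᶠ y in 𝓝 y₀, ∀ v, fderiv ℝ H y v ∈ W) : ∀ᶠ y in 𝓝 y₀, H y ∈ W := by
  obtain ⟨ε, hε, hball⟩ := Metric.eventually_nhds_iff_ball.1 (hd.and hW)
  filter_upwards [Metric.ball_mem_nhds y₀ hε] with y hy
  -- Every linear functional vanishing on W is constant along H.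
  refine (Subspace.forall_mem_dualAnnihilator_apply_eq_zero_iff W _).1 fun φ hφ => ?_
  have hφ' := (Submodule.mem_dualAnnihilator φ).1 hφ
  let L : G →L[ℝ] ℝ := LinearMap.toContinuousLinearMap φ
  have h1 : L (H y) = L (H y₀) := by
    refine (convex_ball y₀ ε).is_const_of_fderivWithin_eq_zero (𝕜 := ℝ) (f := fun y => L (H y))
      (fun z hz => (L.differentiableAt.comp z (hball z hz).1).differentiableWithinAt)
      (fun z hz => ?_) hy (Metric.mem_ball_self hε)
    rw [fderivWithin_of_isOpen Metric.isOpen_ball hz]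
    ext v
    rw [fderiv_fun_comp z L.differentiableAt (hball z hz).1, L.fderiv]
    exact hφ' _ ((hball z hz).2 v)
  exact h1.trans (hφ' _ h₀)

/-- The linear map of `F × ℝ` induced by a translation in the light cone model. -/
def coneShear {F : Type*} [NormedAddCommGroup F] [InnerProductSpace ℝ F] (p : F) :
    F × ℝ →ₗ[ℝ] F × ℝ where
  toFun z := (z.1, 2 * inner ℝ p z.1 + 2 * z.2)
  map_add' z w := by
    refine Prod.ext rfl ?_
    simp only [Prod.fst_add, Prod.snd_add, inner_add_right]
    ring
  map_smul' c z := by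
    refine Prod.ext rfl ?_
    simp only [Prod.smul_fst, Prod.smul_snd, inner_smul_right, smul_eq_mul, RingHom.id_apply]
    ring

lemma coneShear_injective {F : Type*} [NormedAddCommGroup F] [InnerProductSpace ℝ F] (p : F) :
    Function.Injective (coneShear p) := by
  rintro ⟨z, s⟩ ⟨w, t⟩ h
  obtain ⟨h1, h2⟩ := Prod.ext_iff.1 h
  have h1 : z = w := h1
  have h2 : 2 * inner ℝ p z + 2 * s = 2 * inner ℝ p w + 2 * t := h2
  subst h1
  exact Prod.ext rfl (by linarith)

namespace IsPrincipalData

variable {k : ℕ} {E F : Type*} [NormedAddCommGroup E] [NormedSpace ℝ E] [FiniteDimensional ℝ E]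
    [NormedAddCommGroup F] [InnerProductSpace ℝ F] [FiniteDimensional ℝ F]
    {Ω : Set E} {g : E → F} {N : E → F →L[ℝ] F}
    {η : Fin k → E → F} {Q : Fin k → E → F →L[ℝ] F}

/-- The second fundamental form in terms of principal normals, from differentiating N(∂_u g) = 0. -/
lemma normal_fderiv_fderiv (h : IsPrincipalData Ω g N η Q) {y : E} (hy : y ∈ Ω) (u v : E) :
    N y (fderiv ℝ (fderiv ℝ g) y v u)
      = ∑ i, inner ℝ (Q i y (fderiv ℝ g y v)) (fderiv ℝ g y u) • η i y := by
  have h0 : (fun y => N y (fderiv ℝ g y u)) =ᶠ[𝓝 y] fun _ => 0 := by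
    filter_upwards [h.isOpen.mem_nhds hy] with y' hy' using h.normal_fderiv y' hy' u
  have h1 : fderiv ℝ (fun y => N y (fderiv ℝ g y u)) y = fderiv ℝ (fun _ => (0 : F)) y :=
    h0.fderiv_eq
  have hd : DifferentiableAt ℝ (fun y => fderiv ℝ g y u) y :=
    (h.differentiableAt_fderiv hy).clm_apply (differentiableAt_const u)
  rw [fderiv_clm_apply (h.differentiableAt_normal hy) hd,
    fderiv_clm_apply (h.differentiableAt_fderiv hy) (differentiableAt_const u)] at h1
  have h2 := congrArg (fun L : E →L[ℝ] F => L v) h1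
  simp only [fderiv_fun_const, Pi.zero_apply, ContinuousLinearMap.comp_zero, zero_add, add_apply,
    ContinuousLinearMap.comp_apply, ContinuousLinearMap.flip_apply, zero_apply] at h2
  rw [eq_neg_of_add_eq_zero_left h2, h.fderiv_normal y hy, neg_neg]
  refine Finset.sum_congr rfl fun i _ => ?_
  rw [h.inner_eta y hy, zero_smul, add_zero]

/-- The augmented osculating space. -/
def augmented (g : E → F) (η : Fin k → E → F) (y : E) : Submodule ℝ (F × ℝ) :=
  (LinearMap.range (fderiv ℝ g y).toLinearMap).map (LinearMap.inl ℝ F ℝ) ⊔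
    Submodule.span ℝ (Set.range fun i => (η i y, (1 : ℝ)))

lemma fderiv_mem_augmented (y v : E) : (fderiv ℝ g y v, (0 : ℝ)) ∈ augmented g η y :=
  Submodule.mem_sup_left ⟨_, ⟨v, rfl⟩, rfl⟩

lemma eta_mem_augmented (y : E) (i : Fin k) : (η i y, (1 : ℝ)) ∈ augmented g η y :=
  Submodule.mem_sup_right (Submodule.subset_span ⟨i, rfl⟩)

/-- The normal part of the Hessian is a combination of the η i whose coefficients add up to ⟨∂_v g,
∂_u g⟩, since the Q i sum to the identity on tangent vectors. This is why the second coordinate is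
the metric. -/
lemma fderiv_fderiv_mem_augmented (h : IsPrincipalData Ω g N η Q) {y : E} (hy : y ∈ Ω) (u v : E) :
    (fderiv ℝ (fderiv ℝ g) y v u, inner ℝ (fderiv ℝ g y v) (fderiv ℝ g y u))
      ∈ augmented g η y := by
  obtain ⟨w, hw⟩ := h.sub_normal y hy (fderiv ℝ (fderiv ℝ g) y v u)
  have h1 : (fderiv ℝ (fderiv ℝ g) y v u, inner ℝ (fderiv ℝ g y v) (fderiv ℝ g y u))
      = (fderiv ℝ g y w, (0 : ℝ))
        + ∑ i, inner ℝ (Q i y (fderiv ℝ g y v)) (fderiv ℝ g y u) • (η i y, (1 : ℝ)) := by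
    refine Prod.ext ?_ ?_
    · rw [Prod.fst_add, Prod.fst_sum, ← hw, h.normal_fderiv_fderiv hy]
      simp
    · rw [Prod.snd_add, Prod.snd_sum]
      simp only [Prod.smul_snd, smul_eq_mul, mul_one, zero_add]
      rw [← sum_inner, h.sum_proj_fderiv hy]
  rw [h1]
  exact Submodule.add_mem _ (fderiv_mem_augmented y w) (Submodule.sum_mem _ fun i _ =>
    Submodule.smul_mem _ _ (eta_mem_augmented y i))

/-- Differences η i - η c lift to (η i, 1) - (η c, 1), whose last coordinate is 0, the derivative of
the constant 1. -/
lemma fderiv_eta_mem_augmented (h : IsPrincipalData Ω g N η Q) {y : E} (hy : y ∈ Ω) {c : Fin k}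
    {v : E} (hpar : N y (fderiv ℝ (η c) y v)
      ∈ Submodule.span ℝ (Set.range fun i => η i y - η c y)) :
    (fderiv ℝ (η c) y v, (0 : ℝ)) ∈ augmented g η y := by
  obtain ⟨w, hw⟩ := h.sub_normal y hy (fderiv ℝ (η c) y v)
  have h1 : (fderiv ℝ (η c) y v, (0 : ℝ)) = (fderiv ℝ g y w, (0 : ℝ))
      + LinearMap.inl ℝ F ℝ (N y (fderiv ℝ (η c) y v)) := by
    refine Prod.ext ?_ ?_
    · simp [← hw]
    · simp
  rw [h1]
  refine Submodule.add_mem _ (fderiv_mem_augmented y w) ?_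
  have h2 : Submodule.span ℝ (Set.range fun i => η i y - η c y)
      ≤ (augmented g η y).comap (LinearMap.inl ℝ F ℝ) := by
    rw [Submodule.span_le]
    rintro _ ⟨i, rfl⟩
    have h3 : LinearMap.inl ℝ F ℝ (η i y - η c y) = (η i y, (1 : ℝ)) - (η c y, (1 : ℝ)) := by simp
    rw [SetLike.mem_coe, Submodule.mem_comap, h3]
    exact Submodule.sub_mem _ (eta_mem_augmented y i) (eta_mem_augmented y c)
  exact h2 hpar

/-- Parametrization of the augmented osculating space. -/
def augmentedMap (g : E → F) (η : Fin k → E → F) {κ : Type*} [Fintype κ] (a : κ → Fin k) (y : E) :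
    E × (κ → ℝ) →ₗ[ℝ] F × ℝ :=
  (LinearMap.inl ℝ F ℝ ∘ₗ (fderiv ℝ g y).toLinearMap).coprod
    (Fintype.linearCombination ℝ fun i => (η (a i) y, (1 : ℝ)))

lemma augmentedMap_apply {κ : Type*} [Fintype κ] (a : κ → Fin k) (y : E) (w : E × (κ → ℝ)) :
    augmentedMap g η a y w
      = (fderiv ℝ g y w.1 + ∑ i, w.2 i • η (a i) y, ∑ i, w.2 i) := by
  refine Prod.ext ?_ ?_
  · simp [augmentedMap, Fintype.linearCombination_apply, Prod.fst_sum]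
  · simp [augmentedMap, Fintype.linearCombination_apply, Prod.snd_sum]

lemma range_augmentedMap {κ : Type*} [Fintype κ] {a : κ → Fin k} {y : E}
    (ha : Submodule.span ℝ (Set.range fun i => (η (a i) y, (1 : ℝ)))
      = Submodule.span ℝ (Set.range fun i => (η i y, (1 : ℝ)))) :
    LinearMap.range (augmentedMap g η a y) = augmented g η y := by
  rw [augmentedMap, LinearMap.range_coprod, LinearMap.range_comp, Fintype.range_linearCombination,
    ha]
  rfl

lemma augmentedMap_injective (h : IsPrincipalData Ω g N η Q) {y : E} (hy : y ∈ Ω) {κ : Type*}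
    [Fintype κ] {a : κ → Fin k} (ha : LinearIndependent ℝ fun i => (η (a i) y, (1 : ℝ))) :
    Function.Injective (augmentedMap g η a y) := by
  rw [← LinearMap.ker_eq_bot, LinearMap.ker_eq_bot']
  rintro ⟨u, c⟩ huc
  rw [augmentedMap_apply] at huc
  obtain ⟨h1, h2⟩ := Prod.ext_iff.1 huc
  have h1 : fderiv ℝ g y u + ∑ i, c i • η (a i) y = 0 := h1
  have h2 : ∑ i, c i = 0 := h2
  have h3 := congrArg (N y) h1
  simp only [map_add, h.normal_fderiv y hy, map_sum, map_smul, h.normal_eta y hy, zero_add,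
    map_zero] at h3
  rw [h3, add_zero] at h1
  have hu : u = 0 := h.fderiv_injective y hy (h1.trans (map_zero _).symm)
  have hc : c = 0 := by
    funext i
    refine Fintype.linearIndependent_iff.1 ha c (Prod.ext ?_ ?_) i
    · simpa [Prod.fst_sum] using h3
    · simpa [Prod.snd_sum] using h2
  rw [hu, hc, Prod.mk_zero_zero]

/-- Reduction of the codimension: near some point, the lift of `g` to the light cone stays in a
subspace whose dimension is determined by the affine span of the principal normals. -/
theorem exists_lift_mem (h : IsPrincipalData Ω g N η Q) (hne : Ω.Nonempty)
    (hpar : ∀ y ∈ Ω, ∀ c v, N y (fderiv ℝ (η c) y v)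
      ∈ Submodule.span ℝ (Set.range fun i => η i y - η c y)) :
    ∃ y₁ ∈ Ω, ∃ W : Submodule ℝ (F × ℝ), Module.finrank ℝ W = Module.finrank ℝ E
        + Module.finrank ℝ (Submodule.span ℝ (Set.range fun i => (η i y₁, (1 : ℝ)))) ∧
      ∀ᶠ y in 𝓝 y₁, (g y - g y₁, ‖g y - g y₁‖ ^ 2) ∈ W := by
  -- At a maximum over Ω the rank, being lower semicontinuous, is locally constant.
  let r : E → ℕ := fun y =>
    Module.finrank ℝ (Submodule.span ℝ (Set.range fun i => (η i y, (1 : ℝ))))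
  obtain ⟨y₁, hy₁, hmax⟩ : ∃ y₁ ∈ Ω, ∀ y ∈ Ω, r y ≤ r y₁ := by
    have hb : BddAbove (r '' Ω) := ⟨Module.finrank ℝ (F × ℝ), by
      rintro _ ⟨y, -, rfl⟩
      exact Submodule.finrank_le _⟩
    obtain ⟨y₁, hy₁, hr⟩ := Nat.sSup_mem (hne.image r) hb
    exact ⟨y₁, hy₁, fun y hy => hr ▸ le_csSup hb ⟨y, hy, rfl⟩⟩
  -- A subfamily forming a basis at y₁ remains a basis nearby, so the augmented spaces have an
  -- injective smooth parametrization by a fixed space.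
  obtain ⟨κ, a, ha, hspan, hli⟩ := exists_linearIndependent' ℝ fun i => (η i y₁, (1 : ℝ))
  have : Finite κ := Finite.of_injective a ha
  have := Fintype.ofFinite κ
  have hcard : r y₁ = Fintype.card κ := by
    change Module.finrank ℝ (Submodule.span ℝ (Set.range fun i => (η i y₁, (1 : ℝ)))) = _
    rw [← hspan, finrank_span_eq_card hli]
  have hΩ : ∀ᶠ y in 𝓝 y₁, y ∈ Ω := h.isOpen.eventually_mem hy₁
  have hliev : ∀ᶠ y in 𝓝 y₁, LinearIndependent ℝ fun i => (η (a i) y, (1 : ℝ)) := by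
    have h1 : ContinuousAt (fun y => fun i => (η (a i) y, (1 : ℝ))) y₁ :=
      continuousAt_pi.2 fun i => (h.differentiableAt_eta hy₁ (a i)).continuousAt.prodMk
        continuousAt_const
    exact h1.eventually (isOpen_setOfPred_linearIndependent.mem_nhds hli)
  have hspanev : ∀ᶠ y in 𝓝 y₁, Submodule.span ℝ (Set.range fun i => (η (a i) y, (1 : ℝ)))
      = Submodule.span ℝ (Set.range fun i => (η i y, (1 : ℝ))) := by
    filter_upwards [hliev, hΩ] with y hy hyΩ
    refine Submodule.eq_of_le_of_finrank_le (Submodule.span_mono ?_) ?_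
    · rintro _ ⟨i, rfl⟩
      exact ⟨a i, rfl⟩
    · rw [finrank_span_eq_card hy, ← hcard]
      exact hmax y hyΩ
  -- The shear by g y - g y₁ makes the augmented space contain the derivative of the lift of g; the
  -- sheared family is the parallel one.
  let S : E → E × (κ → ℝ) →L[ℝ] F × ℝ := fun y =>
    LinearMap.toContinuousLinearMap (coneShear (g y - g y₁) ∘ₗ augmentedMap g η a y)
  have hSapp : ∀ y w, S y w = coneShear (g y - g y₁) (augmentedMap g η a y w) := fun _ _ => rfl
  have hder : ∀ y ∈ Ω, ∀ w : E × (κ → ℝ), HasFDerivAt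
      (fun y => fderiv ℝ g y w.1 + ∑ i, w.2 i • η (a i) y)
      ((fderiv ℝ (fderiv ℝ g) y).flip w.1 + ∑ i, w.2 i • fderiv ℝ (η (a i)) y) y := by
    intro y hy w
    have h1 : HasFDerivAt (fun y => fderiv ℝ g y w.1) ((fderiv ℝ (fderiv ℝ g) y).flip w.1) y := by
      simpa using (h.differentiableAt_fderiv hy).hasFDerivAt.clm_apply (hasFDerivAt_const w.1 y)
    exact h1.fun_add (HasFDerivAt.fun_sum fun i _ =>
      (h.differentiableAt_eta hy (a i)).hasFDerivAt.const_smul (w.2 i))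
  have hSc : ContDiffOn ℝ ∞ S Ω := by
    refine contDiffOn_clm_apply.2 fun w => ?_
    have hz : ContDiffOn ℝ ∞ (fun y => fderiv ℝ g y w.1 + ∑ i, w.2 i • η (a i) y) Ω :=
      ((h.contDiffOn.fderiv_of_isOpen h.isOpen (by simp)).clm_apply contDiffOn_const).add
        (ContDiffOn.sum fun i _ => (h.contDiffOn_eta (a i)).const_smul _)
    have h1 : (fun y => S y w) = fun y => (fderiv ℝ g y w.1 + ∑ i, w.2 i • η (a i) y,
        2 * inner ℝ (g y - g y₁) (fderiv ℝ g y w.1 + ∑ i, w.2 i • η (a i) y)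
          + 2 * ∑ i, w.2 i) := by
      funext y
      rw [hSapp, augmentedMap_apply]
      rfl
    rw [h1]
    exact hz.prodMk ((contDiffOn_const.mul ((h.contDiffOn.sub contDiffOn_const).inner ℝ hz)).add
      contDiffOn_const)
  have hSd : ∀ y ∈ Ω, DifferentiableAt ℝ S y := fun y hy =>
    (hSc.contDiffAt (h.isOpen.mem_nhds hy)).differentiableAt (by simp)
  -- Differentiating the shear adds 2⟨∂_v g, z⟩, z being the first component of the augmented
  -- vector. The factor 2 in the last coordinate of `coneShear` absorbs it, and only the tangent
  -- part of z contributes.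
  have hSder : ∀ y ∈ Ω, ∀ v w, fderiv ℝ S y v w = coneShear (g y - g y₁)
      (fderiv ℝ (fderiv ℝ g) y v w.1 + ∑ i, w.2 i • fderiv ℝ (η (a i)) y v,
        inner ℝ (fderiv ℝ g y v) (fderiv ℝ g y w.1)) := by
    intro y hy v w
    have h1 : HasFDerivAt (fun y => S y w) ((fderiv ℝ S y).flip w) y := by
      simpa using (hSd y hy).hasFDerivAt.clm_apply (hasFDerivAt_const w y)
    have hz := hder y hy w
    have h2 := hz.prodMk (((((h.differentiableAt hy).hasFDerivAt.sub_const (g y₁)).inner ℝ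
      hz).const_mul 2).add_const (2 * ∑ i, w.2 i))
    have h3 : (fun y => S y w) = fun y => (fderiv ℝ g y w.1 + ∑ i, w.2 i • η (a i) y,
        2 * inner ℝ (g y - g y₁) (fderiv ℝ g y w.1 + ∑ i, w.2 i • η (a i) y)
          + 2 * ∑ i, w.2 i) := by
      funext y
      rw [hSapp, augmentedMap_apply]
      rfl
    rw [h3] at h1
    have h4 := congrArg (fun L : E →L[ℝ] F × ℝ => L v) (h1.unique h2)
    have h5 : inner ℝ (fderiv ℝ g y v) (∑ i, w.2 i • η (a i) y) = 0 := by
      rw [inner_sum]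
      refine Finset.sum_eq_zero fun i _ => ?_
      rw [inner_smul_right, real_inner_comm, h.inner_eta y hy, mul_zero]
    simp only [ContinuousLinearMap.flip_apply] at h4
    rw [h4]
    refine Prod.ext ?_ ?_
    · simp [coneShear]
    · simp only [ContinuousLinearMap.prod_apply, smul_apply, ContinuousLinearMap.comp_apply,
        fderivInnerCLM_apply, add_apply, ContinuousLinearMap.flip_apply, sum_apply, coneShear,
        LinearMap.coe_mk, AddHom.coe_mk, smul_eq_mul]
      rw [inner_add_right (fderiv ℝ g y v), h5, add_zero]
      ring
  have hinj : Function.Injective (S y₁) :=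
    (coneShear_injective _).comp (h.augmentedMap_injective hy₁ hli)
  have hmem := eventually_range_le_of_parallel (hΩ.mono hSd) hinj (by
    filter_upwards [hspanev, hΩ] with y hy hyΩ v w
    have hr : LinearMap.range (S y).toLinearMap
        = (augmented g η y).map (coneShear (g y - g y₁)) := by
      rw [← range_augmentedMap hy, ← LinearMap.range_comp]
      rfl
    rw [hr, hSder y hyΩ]
    refine Submodule.mem_map_of_mem ?_
    have h1 : (fderiv ℝ (fderiv ℝ g) y v w.1 + ∑ i, w.2 i • fderiv ℝ (η (a i)) y v,
          inner ℝ (fderiv ℝ g y v) (fderiv ℝ g y w.1))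
        = (fderiv ℝ (fderiv ℝ g) y v w.1, inner ℝ (fderiv ℝ g y v) (fderiv ℝ g y w.1))
          + ∑ i, w.2 i • (fderiv ℝ (η (a i)) y v, (0 : ℝ)) := by
      refine Prod.ext ?_ ?_
      · simp [Prod.fst_sum]
      · simp [Prod.snd_sum]
    rw [h1]
    exact Submodule.add_mem _ (h.fderiv_fderiv_mem_augmented hyΩ _ _) (Submodule.sum_mem _
      fun i _ => Submodule.smul_mem _ _ (h.fderiv_eta_mem_augmented hyΩ (hpar y hyΩ _ _))))
  refine ⟨y₁, hy₁, LinearMap.range (S y₁).toLinearMap, ?_, ?_⟩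
  · rw [LinearMap.finrank_range_of_inj hinj, Module.finrank_prod, Module.finrank_fintype_fun_eq_card,
      ← hcard]
  · have hH : ∀ y ∈ Ω, HasFDerivAt (fun y => (g y - g y₁, ‖g y - g y₁‖ ^ 2))
        ((fderiv ℝ g y).prod (2 • (innerSL ℝ (g y - g y₁)).comp (fderiv ℝ g y))) y := by
      intro y hy
      have h1 := (h.differentiableAt hy).hasFDerivAt.sub_const (g y₁)
      exact h1.prodMk h1.norm_sq
    refine eventually_mem_of_fderiv_mem ?_ (hΩ.mono fun y hy => (hH y hy).differentiableAt) ?_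
    · have h0 : (g y₁ - g y₁, ‖g y₁ - g y₁‖ ^ 2) = (0 : F × ℝ) := by simp
      rw [h0]
      exact Submodule.zero_mem _
    -- The derivative of the lift along v is the value of S y at (v, 0).
    · filter_upwards [hmem, hΩ] with y hy hyΩ v
      convert hy (v, 0) using 1
      rw [(hH y hyΩ).fderiv, hSapp, augmentedMap_apply]
      refine Prod.ext ?_ ?_
      · simp [coneShear]
      · simp [coneShear, inner_sub_left]

end IsPrincipalData

/-! ### The bound on the conformal codimension. -/

lemma mem_span_pair_of_not_linearIndependent {V : Type*} [AddCommGroup V] [Module ℝ V] {a b c : V}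
    (hab : a ≠ b) (h : ¬ LinearIndependent ℝ ![a - c, b - c]) :
    ((c, 1) : V × ℝ) ∈ Submodule.span ℝ {((a, 1) : V × ℝ), (b, 1)} := by
  rw [LinearIndependent.pair_iff] at h
  push Not at h
  obtain ⟨s, t, hst, hne⟩ := h
  -- With s + t = 0 the relation would read s (a - b) = 0, which a ≠ b forbids; so c is the
  -- barycenter of a and b with weights s and t.
  have hst0 : s + t ≠ 0 := by
    intro h0
    have h1 : s • (a - b) = 0 := by
      rw [← hst, eq_neg_of_add_eq_zero_right h0]
      module
    rcases smul_eq_zero.1 h1 with h2 | h2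
    · exact hne h2 (by rw [h2, zero_add] at h0; exact h0)
    · exact hab (sub_eq_zero.1 h2)
  rw [Submodule.mem_span_pair]
  refine ⟨(s + t)⁻¹ * s, (s + t)⁻¹ * t, Prod.ext ?_ ?_⟩
  · have h1 : s • a + t • b = (s + t) • c := by
      rw [← sub_eq_zero, ← hst]
      module
    simp only [Prod.fst_add, Prod.smul_fst, mul_smul]
    rw [← smul_add, h1, smul_smul, inv_mul_cancel₀ hst0, one_smul]
  · simp only [Prod.snd_add, Prod.smul_snd, smul_eq_mul, mul_one]
    rw [← mul_add, inv_mul_cancel₀ hst0]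

lemma LiesInSphereOrAffine.mono {d m : ℕ} {S T : Set (EuclideanSpace ℝ (Fin d))}
    (h : LiesInSphereOrAffine m T) (hST : S ⊆ T) : LiesInSphereOrAffine m S := by
  rcases h with ⟨A, hA, hT⟩ | ⟨A, hA, c, hc, r, hr, hT⟩
  · exact Or.inl ⟨A, hA, hST.trans hT⟩
  · exact Or.inr ⟨A, hA, c, hc, r, hr, hST.trans hT⟩

section Bound

variable {n d k : ℕ} {M : Type*} [TopologicalSpace M] [ChartedSpace (EuclideanSpace ℝ (Fin n)) M]
  [IsManifold (𝓡 n) ∞ M] {f : M → EuclideanSpace ℝ (Fin d)}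

/-- W has dimension n + r, and passing from lifts to points lowers the dimension by one, so s = r -
1; the inequality 3 (s + 1) ≤ 2k is the rank estimate. -/
lemma IsKDupin.exists_liesInSphereOrAffine (hf : IsKDupin n k f)
    (hirr : IsLocallyWeaklyIrreducible n f) (hn : 1 ≤ n) {U : Set M} (hU : IsOpen U)
    (hne : U.Nonempty) : ∃ V ⊆ U, IsOpen V ∧ V.Nonempty ∧
      ∃ s, 3 * (s + 1) ≤ 2 * k ∧ LiesInSphereOrAffine (n + s) (f '' V) := by
  obtain ⟨himm, hflat, hk, hD⟩ := hf
  obtain ⟨x₀, hx₀⟩ := hne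
  obtain ⟨Ω, η, hyΩ, hF⟩ := exists_smoothPrincipalFrame himm
    (fun x => himm.exists_principalFrame hflat (hk x)) x₀
  have hP := hF.isPrincipalData himm
  let Ω' := Ω ∩ ((extChartAt (𝓡 n) x₀).target ∩ (extChartAt (𝓡 n) x₀).symm ⁻¹' U)
  have hΩ' : IsOpen Ω' := hF.isOpen.inter (isOpen_target_inter hU x₀)
  have hP' : IsPrincipalData Ω' (inChart n f x₀) (inChart n (nrm n f) x₀) η
      fun i y => proj n f ((extChartAt (𝓡 n) x₀).symm y) (η i y) := hP.mono hΩ' Set.inter_subset_left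
  obtain ⟨y₁, hy₁, W, hW, hmem⟩ := hP'.exists_lift_mem
    ⟨_, hyΩ, mem_extChartAt_target x₀, mem_preimage_symm hx₀⟩ fun y hy c =>
      hP.normal_fderiv_eta_mem hy.1 fun v hv => hF.normal_fderiv_eta himm hD hy.1 c hv
  rw [finrank_euclideanSpace_fin] at hW
  set r := Module.finrank ℝ (Submodule.span ℝ (Set.range fun i => (η i y₁, (1 : ℝ)))) with hr
  have h3r : 3 * r ≤ 2 * k := three_mul_finrank_span_le _ fun c => by
    obtain ⟨a, b, hab, hac, hbc, hli⟩ := hF.exists_not_linearIndependent himm hirr hy₁.1 c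
    exact ⟨a, b, hab, hac, hbc, mem_span_pair_of_not_linearIndependent
      ((hP.eta_injective y₁ hy₁.1).ne hab) hli⟩
  have hinj := hP.fderiv_injective y₁ hy₁.1
  have := Fin.pos_iff_nonempty.1 hn
  obtain ⟨v, hv⟩ := exists_ne (0 : EuclideanSpace ℝ (Fin n))
  -- Needed for the subtraction r - 1. As n ≥ 1, the tangent space is not zero, so there is a
  -- principal normal.
  have hr1 : 1 ≤ r := by
    have hk0 : ∃ i : Fin k, True := by
      by_contra! hcon
      have : IsEmpty (Fin k) := ⟨fun i => hcon i⟩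
      have h1 := hP.sum_proj_fderiv hy₁.1 v
      rw [Finset.univ_eq_empty, Finset.sum_empty] at h1
      exact hv (hinj (h1.symm.trans (map_zero _).symm))
    obtain ⟨i, -⟩ := hk0
    refine Submodule.one_le_finrank_iff.2 fun h0 => ?_
    have h1 : (η i y₁, (1 : ℝ)) ∈ (⊥ : Submodule ℝ (EuclideanSpace ℝ (Fin d) × ℝ)) := by
      rw [← h0]
      exact Submodule.subset_span ⟨i, rfl⟩
    exact one_ne_zero (Prod.ext_iff.1 ((Submodule.mem_bot ℝ).1 h1)).2
  obtain ⟨B, hB, hBo, hy₁B⟩ := eventually_nhds_iff.1 (hmem.and (hΩ'.eventually_mem hy₁))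
  -- A second image point, which keeps the radius of the sphere positive; an immersion of positive
  -- dimension is not locally constant.
  have hne : ∃ y₂ ∈ B, inChart n f x₀ y₂ ≠ inChart n f x₀ y₁ := by
    by_contra! hcon
    have h1 : inChart n f x₀ =ᶠ[𝓝 y₁] fun _ => inChart n f x₀ y₁ := by
      filter_upwards [hBo.mem_nhds hy₁B] with y hy using hcon y hy
    have h2 : fderiv ℝ (inChart n f x₀) y₁ = fderiv ℝ (fun _ => inChart n f x₀ y₁) y₁ := h1.fderiv_eq
    rw [fderiv_fun_const] at h2
    refine hv (hinj ?_)
    rw [h2]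
    simp
  obtain ⟨y₂, hy₂, hne⟩ := hne
  have hmemV : ∀ y ∈ B, (extChartAt (𝓡 n) x₀).symm y ∈
      (extChartAt (𝓡 n) x₀).source ∩ extChartAt (𝓡 n) x₀ ⁻¹' B := fun y hy =>
    hF.mem_source_inter himm (fun y hy => (hB y hy).2.1) hy
  refine ⟨(extChartAt (𝓡 n) x₀).source ∩ extChartAt (𝓡 n) x₀ ⁻¹' B, fun x hx => ?_,
    isOpen_source_inter hBo x₀, ⟨_, hmemV y₁ hy₁B⟩, r - 1, by omega, ?_⟩
  · have h1 := (hB _ hx.2).2.2.2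
    rwa [Set.mem_preimage, (extChartAt (𝓡 n) x₀).left_inv hx.1] at h1
  · refine liesInSphereOrAffine_of_lift (x₀ := inChart n f x₀ y₁) (x₁ := inChart n f x₀ y₂)
      ⟨_, hmemV y₂ hy₂, rfl⟩ hne W (by omega) ?_
    rintro _ ⟨x, hx, rfl⟩
    have h1 := (hB _ hx.2).1
    have h2 : inChart n f x₀ (extChartAt (𝓡 n) x₀ x) = f x :=
      congrArg f ((extChartAt (𝓡 n) x₀).left_inv hx.1)
    rwa [h2] at h1

/-- A locally weakly irreducible `k`-Dupin submanifold has conformal codimension at most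
`2k/3 - 1` on the components of an open dense subset. -/
theorem IsKDupin.exists_dense_conformalCodim_le (hf : IsKDupin n k f)
    (hirr : IsLocallyWeaklyIrreducible n f) (hn : 1 ≤ n) : ∃ W : Set M, IsOpen W ∧ Dense W ∧
      ∀ x ∈ W, (conformalCodim n f (connectedComponentIn W x) : ℝ) ≤ (2 / 3 : ℝ) * k - 1 := by
  obtain ⟨W, hW, hWd, hcomp⟩ := exists_isOpen_dense_components
    (fun V : Set M => ∃ s, 3 * (s + 1) ≤ 2 * k ∧ LiesInSphereOrAffine (n + s) (f '' V))
    fun U hU hne => hf.exists_liesInSphereOrAffine hirr hn hU hne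
  refine ⟨W, hW, hWd, fun x hx => ?_⟩
  obtain ⟨V, -, ⟨s, hs, hlies⟩, hsub⟩ := hcomp x hx
  have h1 : sInf {m : ℕ | LiesInSphereOrAffine m (f '' connectedComponentIn W x)} ≤ n + s :=
    Nat.sInf_le (hlies.mono (Set.image_mono hsub))
  have h2 : conformalCodim n f (connectedComponentIn W x) ≤ s := by
    rw [conformalCodim]
    omega
  have h3 : (conformalCodim n f (connectedComponentIn W x) : ℝ) ≤ s := by exact_mod_cast h2
  have h4 : (3 : ℝ) * (s + 1) ≤ 2 * k := by exact_mod_cast hs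
  linarith

end Bound

/-! ### Immersions of ℝ^n given by a frame of principal directions. -/

lemma mdiff_eq_fderiv_of_model {n : ℕ} {G : Type*} [NormedAddCommGroup G] [NormedSpace ℝ G]
    (h : EuclideanSpace ℝ (Fin n) → G) (x : EuclideanSpace ℝ (Fin n)) :
    mdiff n h x = fderiv ℝ h x := mfderiv_eq_fderiv

/-- An immersion `f` of `ℝ^n` with an orthonormal frame `e a = df (Y a)` of principal directions
and with pairwise distinct Dupin principal normals `η a`. -/
structure IsDupinFrame {n d : ℕ} {ι : Type*} [DecidableEq ι]
    (f : EuclideanSpace ℝ (Fin n) → EuclideanSpace ℝ (Fin d))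
    (Y : ι → EuclideanSpace ℝ (Fin n) → EuclideanSpace ℝ (Fin n))
    (e η : ι → EuclideanSpace ℝ (Fin n) → EuclideanSpace ℝ (Fin d)) : Prop where
  contDiff : ContDiff ℝ ∞ f
  contDiff_field : ∀ a, ContDiff ℝ ∞ (Y a)
  contDiff_frame : ∀ a, ContDiff ℝ ∞ (e a)
  contDiff_eta : ∀ a, ContDiff ℝ ∞ (η a)
  fderiv_field : ∀ a x, fderiv ℝ f x (Y a x) = e a x
  orthonormal : ∀ x, Orthonormal ℝ fun a => e a x
  inner_eta : ∀ a b x, inner ℝ (e a x) (η b x) = 0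
  fderiv_frame : ∀ a b x, fderiv ℝ (e a) x (Y b x) - (if a = b then η a x else 0)
    ∈ Submodule.span ℝ (Set.range fun a => e a x)
  fderiv_eta : ∀ a x, fderiv ℝ (η a) x (Y a x) ∈ Submodule.span ℝ (Set.range fun a => e a x)
  injective : ∀ x, Function.Injective fun a => η a x

namespace IsDupinFrame

variable {n d : ℕ} {ι : Type*} [Fintype ι] [DecidableEq ι]
  {f : EuclideanSpace ℝ (Fin n) → EuclideanSpace ℝ (Fin d)}
  {Y : ι → EuclideanSpace ℝ (Fin n) → EuclideanSpace ℝ (Fin n)}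
  {e η : ι → EuclideanSpace ℝ (Fin n) → EuclideanSpace ℝ (Fin d)}
  (h : IsDupinFrame f Y e η) (hι : Fintype.card ι = n)

include h

lemma mdiff_field (a : ι) (x : EuclideanSpace ℝ (Fin n)) : mdiff n f x (Y a x) = e a x := by
  rw [mdiff_eq_fderiv_of_model, h.fderiv_field]

lemma inner_frame (a b : ι) (x : EuclideanSpace ℝ (Fin n)) :
    inner ℝ (e a x) (e b x) = if a = b then 1 else 0 :=
  orthonormal_iff_ite.1 (h.orthonormal x) a b

include hι

lemma exists_eq_sum (x v : EuclideanSpace ℝ (Fin n)) : ∃ c : ι → ℝ, v = ∑ a, c a • Y a x := by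
  have hli : LinearIndependent ℝ fun a => Y a x := by
    refine LinearIndependent.of_comp (fderiv ℝ f x).toLinearMap ?_
    have h1 : (fderiv ℝ f x).toLinearMap ∘ (fun a => Y a x) = fun a => e a x :=
      funext fun a => h.fderiv_field a x
    rw [h1]
    exact (h.orthonormal x).linearIndependent
  have hspan := hli.span_eq_top_of_card_eq_finrank' (by rw [hι, finrank_euclideanSpace_fin])
  obtain ⟨c, hc⟩ := (Submodule.mem_span_range_iff_exists_fun ℝ).1
    (hspan ▸ Submodule.mem_top : v ∈ Submodule.span ℝ (Set.range fun a => Y a x))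
  exact ⟨c, hc.symm⟩

lemma mdiff_eq_sum {x : EuclideanSpace ℝ (Fin n)} (c : ι → ℝ) :
    mdiff n f x (∑ a, c a • Y a x) = ∑ a, c a • e a x := by
  simp [map_sum, h.mdiff_field]

lemma isSmoothImmersion : IsSmoothImmersion n f := by
  refine ⟨contMDiff_iff_contDiff.2 h.contDiff, fun x => ?_⟩
  change Function.Injective (mdiff n f x)
  rw [injective_iff_map_eq_zero]
  intro v hv
  obtain ⟨c, rfl⟩ := h.exists_eq_sum hι x v
  rw [h.mdiff_eq_sum hι] at hv
  have hc := Fintype.linearIndependent_iff.1 (h.orthonormal x).linearIndependent c hv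
  simp [hc]

lemma mem_normalSpace_iff {x : EuclideanSpace ℝ (Fin n)} {z : EuclideanSpace ℝ (Fin d)} :
    z ∈ normalSpace n f x ↔ ∀ a, inner ℝ (e a x) z = 0 := by
  rw [DupinSubmanifold.mem_normalSpace]
  constructor
  · intro hz a
    rw [← h.mdiff_field]
    exact hz _
  · intro hz v
    obtain ⟨c, rfl⟩ := h.exists_eq_sum hι x v
    rw [h.mdiff_eq_sum hι, sum_inner]
    exact Finset.sum_eq_zero fun a _ => by rw [real_inner_smul_left, hz, mul_zero]

lemma nrm_eta (a : ι) (x : EuclideanSpace ℝ (Fin n)) : nrm n f x (η a x) = η a x :=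
  nrm_eq_self ((h.mem_normalSpace_iff hι).2 fun b => h.inner_eta b a x)

lemma nrm_of_mem_span {x : EuclideanSpace ℝ (Fin n)} {z : EuclideanSpace ℝ (Fin d)}
    (hz : z ∈ Submodule.span ℝ (Set.range fun a => e a x)) : nrm n f x z = 0 := by
  obtain ⟨c, rfl⟩ := (Submodule.mem_span_range_iff_exists_fun ℝ).1 hz
  rw [← h.mdiff_eq_sum hι, nrm_mdiff]

/-- Differentiate N(e a) = 0 along Y b. -/
lemma mdiff_nrm_frame (a b : ι) (x : EuclideanSpace ℝ (Fin n)) :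
    mdiff n (nrm n f) x (Y b x) (e a x) = -(if a = b then η a x else 0) := by
  have hf := h.isSmoothImmersion hι
  have hd : MDifferentiableAt (𝓡 n) 𝓘(ℝ, EuclideanSpace ℝ (Fin d)) (e a) x :=
    ((h.contDiff_frame a).differentiable (by simp) x).mdifferentiableAt
  have h1 := mdiff_clm_apply (hf.mdifferentiableAt_nrm x) hd (Y b x)
  have h2 : (fun z => nrm n f z (e a z)) = fun _ => 0 := funext fun z =>
    h.nrm_of_mem_span hι (Submodule.subset_span ⟨a, rfl⟩)
  have h3 : nrm n f x (fderiv ℝ (e a) x (Y b x)) = if a = b then η a x else 0 := by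
    have h4 := h.nrm_of_mem_span hι (h.fderiv_frame a b x)
    rw [map_sub, sub_eq_zero] at h4
    rw [h4]
    split_ifs
    · exact h.nrm_eta hι a x
    · exact map_zero _
  rw [h2, mdiff_const, zero_apply, mdiff_eq_fderiv_of_model (e a), h3] at h1
  exact eq_neg_of_add_eq_zero_left h1.symm

lemma mdiff_nrm_sum (x : EuclideanSpace ℝ (Fin n)) (c : ι → ℝ) (b : ι) :
    mdiff n (nrm n f) x (∑ a, c a • Y a x) (e b x) = -(c b • η b x) := by
  rw [map_sum, sum_apply, Finset.sum_eq_single b]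
  · rw [map_smul, smul_apply, h.mdiff_nrm_frame hι, if_pos rfl, smul_neg]
  · intro a _ hab
    rw [map_smul, smul_apply, h.mdiff_nrm_frame hι, if_neg (Ne.symm hab), neg_zero, smul_zero]
  · simp

/-- The second fundamental form is diagonal in the frame with entries η b, so a vector lies in the
nullity of ζ exactly when all its nonzero components belong to ζ. -/
lemma sum_mem_nul_iff {x : EuclideanSpace ℝ (Fin n)} {c : ι → ℝ} {ζ : EuclideanSpace ℝ (Fin d)} :
    mdiff n f x (∑ a, c a • Y a x) ∈ nul n f x ζ ↔ ∀ b, c b ≠ 0 → η b x = ζ := by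
  have hinner : ∀ b, inner ℝ (∑ a, c a • e a x) (e b x) = c b := fun b => by
    rw [sum_inner, Finset.sum_eq_single b]
    · rw [real_inner_smul_left, h.inner_frame, if_pos rfl, mul_one]
    · intro a _ hab
      rw [real_inner_smul_left, h.inner_frame, if_neg hab, mul_zero]
    · simp
  rw [(h.isSmoothImmersion hι).mdiff_mem_nul_iff]
  constructor
  · intro hc b hb
    have h1 := hc (Y b x)
    rw [h.mdiff_field, h.mdiff_nrm_sum hι, h.mdiff_eq_sum hι, hinner, neg_inj] at h1
    exact smul_right_injective _ hb h1
  · intro hc w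
    obtain ⟨c', rfl⟩ := h.exists_eq_sum hι x w
    rw [h.mdiff_eq_sum hι c', h.mdiff_eq_sum hι, map_sum, inner_sum, Finset.sum_smul,
      ← Finset.sum_neg_distrib]
    refine Finset.sum_congr rfl fun b _ => ?_
    rw [map_smul, h.mdiff_nrm_sum hι, inner_smul_right, hinner, smul_neg, smul_smul]
    by_cases hb : c b = 0
    · simp [hb]
    · rw [hc b hb]

lemma frame_mem_nul (a : ι) (x : EuclideanSpace ℝ (Fin n)) : e a x ∈ nul n f x (η a x) := by
  have h1 : e a x = mdiff n f x (∑ b, (if b = a then (1 : ℝ) else 0) • Y b x) := by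
    rw [h.mdiff_eq_sum hι]
    simp
  rw [h1, h.sum_mem_nul_iff hι]
  intro b hb
  by_cases hba : b = a
  · rw [hba]
  · exact absurd (if_neg hba) hb

lemma exists_eq_eta {x : EuclideanSpace ℝ (Fin n)} {ζ : EuclideanSpace ℝ (Fin d)}
    (hζ : nul n f x ζ ≠ ⊥) : ∃ a, η a x = ζ := by
  obtain ⟨_, ⟨v, rfl, hv⟩, hv0⟩ := Submodule.exists_mem_ne_zero_of_ne_bot hζ
  have hmem : mdiff n f x v ∈ nul n f x ζ := ⟨v, rfl, hv⟩
  obtain ⟨c, rfl⟩ := h.exists_eq_sum hι x v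
  by_contra! hcon
  refine hv0 ?_
  rw [h.mdiff_eq_sum hι]
  refine Finset.sum_eq_zero fun a _ => ?_
  by_cases hca : c a = 0
  · rw [hca, zero_smul]
  · exact absurd ((h.sum_mem_nul_iff hι).1 hmem a hca) (hcon a)

lemma nul_eta_ne_bot (a : ι) (x : EuclideanSpace ℝ (Fin n)) : nul n f x (η a x) ≠ ⊥ :=
  (Submodule.ne_bot_iff _).2 ⟨_, h.frame_mem_nul hι a x, (h.orthonormal x).ne_zero a⟩

lemma principalNormalsAt_eq (x : EuclideanSpace ℝ (Fin n)) :
    principalNormalsAt n f x = Set.range fun a => η a x := by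
  have hf := h.isSmoothImmersion hι
  ext ζ
  constructor
  · intro hζ
    exact h.exists_eq_eta hι (hf.nullity_ne_bot_iff.1 hζ.2)
  · rintro ⟨a, rfl⟩
    exact ⟨hf.mem_normalSpace_of_nul_ne_bot (h.nul_eta_ne_bot hι a x),
      hf.nullity_ne_bot_iff.2 (h.nul_eta_ne_bot hι a x)⟩

/-- The result is symmetric in c and c', so the two terms of the Ricci equation cancel. -/
lemma nrm_mdiff_nrm_mdiff_nrm {x : EuclideanSpace ℝ (Fin n)} {ξ : EuclideanSpace ℝ (Fin d)}
    (hξ : ξ ∈ normalSpace n f x) (c c' : ι → ℝ) :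
    nrm n f x (mdiff n (nrm n f) x (∑ a, c a • Y a x)
        (mdiff n (nrm n f) x (∑ a, c' a • Y a x) ξ))
      = ∑ a, (c a * c' a * inner ℝ ξ (η a x)) • η a x := by
  have hf := h.isSmoothImmersion hι
  obtain ⟨w, hw⟩ := exists_mdiff_of_nrm_eq_zero
    (hf.nrm_mdiff_nrm_normal (∑ a, c' a • Y a x) hξ)
  obtain ⟨w', rfl⟩ := h.exists_eq_sum hι x w
  have hw' : ∀ a, w' a = -(c' a * inner ℝ ξ (η a x)) := fun a => by
    have h1 := congrArg (fun z => inner ℝ z (e a x)) hw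
    simp only [hf.inner_mdiff_nrm, h.mdiff_nrm_sum hι, h.mdiff_eq_sum hι] at h1
    rw [sum_inner, Finset.sum_eq_single a] at h1
    · rw [real_inner_smul_left, h.inner_frame, if_pos rfl, mul_one, inner_neg_right,
        inner_smul_right] at h1
      exact h1
    · intro b _ hab
      rw [real_inner_smul_left, h.inner_frame, if_neg hab, mul_zero]
    · simp
  rw [← hw, h.mdiff_eq_sum hι, map_sum, map_sum]
  refine Finset.sum_congr rfl fun a _ => ?_
  rw [map_smul, h.mdiff_nrm_sum hι, hw', map_smul, map_neg, map_smul, h.nrm_eta hι, smul_neg,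
    neg_smul, neg_neg, smul_smul]
  congr 1
  ring

lemma hasFlatNormalBundle : HasFlatNormalBundle n f := by
  intro U hU X Z hX hZ ξ hξ x hx
  have hf := h.isSmoothImmersion hι
  rw [hf.normalCurvature_eq hU hξ hx hX hZ]
  obtain ⟨c, hc⟩ := h.exists_eq_sum hι x (vec X x)
  obtain ⟨c', hc'⟩ := h.exists_eq_sum hι x (vec Z x)
  rw [hc, hc', h.nrm_mdiff_nrm_mdiff_nrm hι (hξ.2 x hx), h.nrm_mdiff_nrm_mdiff_nrm hι (hξ.2 x hx),
    sub_eq_zero]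
  refine Finset.sum_congr rfl fun a _ => ?_
  rw [mul_comm (c a)]

/-- A principal normal takes at each point one of finitely many distinct continuous values, so by
continuity it follows one of them. -/
lemma eventually_eq_eta {U : Set (EuclideanSpace ℝ (Fin n))} (hU : IsOpen U)
    {ζ : EuclideanSpace ℝ (Fin n) → EuclideanSpace ℝ (Fin d)} (hζ : IsPrincipalNormalOn n f ζ U)
    {x : EuclideanSpace ℝ (Fin n)} (hx : x ∈ U) : ∃ b, ζ =ᶠ[𝓝 x] η b := by
  obtain ⟨⟨hs, -⟩, s, hs1, hdim⟩ := hζ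
  have hf := h.isSmoothImmersion hι
  have hex : ∀ y ∈ U, ∃ b, η b y = ζ y := fun y hy =>
    h.exists_eq_eta hι (hf.nullity_ne_bot_iff.1 fun h0 => by
      have h1 := hdim y hy
      rw [h0, finrank_bot] at h1
      omega)
  obtain ⟨b, hb⟩ := hex x hx
  refine ⟨b, ?_⟩
  have hc : ContinuousAt ζ x := (hs.continuousOn).continuousAt (hU.mem_nhds hx)
  have hev : ∀ᶠ y in 𝓝 x, ∀ c, c ≠ b → ζ y ≠ η c y := by
    refine Filter.eventually_all.2 fun c => ?_
    by_cases hcb : c = b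
    · exact Filter.Eventually.of_forall fun y h1 => absurd hcb h1
    · have h1 : ∀ᶠ y in 𝓝 x, ζ y - η c y ≠ 0 := by
        refine (hc.sub (h.contDiff_eta c).continuous.continuousAt).eventually_ne ?_
        rw [Pi.sub_apply, ← hb]
        exact sub_ne_zero.2 fun h0 => hcb (h.injective x h0).symm
      filter_upwards [h1] with y hy _ using sub_ne_zero.1 hy
  filter_upwards [hev, hU.mem_nhds hx] with y hy hyU
  obtain ⟨c, hc⟩ := hex y hyU
  by_cases hcb : c = b
  · rw [← hcb, hc]
  · exact absurd hc.symm (hy c hcb)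

lemma isKDupin : IsKDupin n n f := by
  have hf := h.isSmoothImmersion hι
  refine ⟨hf, h.hasFlatNormalBundle hι, fun x => ?_, fun U ζ hU hζ x hx v hv => ?_⟩
  · rw [h.principalNormalsAt_eq hι, ← Set.image_univ, (h.injective x).encard_image, Set.encard_univ,
      ENat.card_eq_coe_fintype_card, hι]
  · obtain ⟨b, hb⟩ := h.eventually_eq_eta hι hU hζ hx
    have hv' := (hf.mem_nullity_iff v).1 hv
    rw [hb.self_of_nhds] at hv'
    obtain ⟨c, hc⟩ := h.exists_eq_sum hι x v
    have h1 : mdiff n ζ x v = c b • fderiv ℝ (η b) x (Y b x) := by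
      rw [mdiff_congr hb, mdiff_eq_fderiv_of_model]
      rw [hc] at hv'
      rw [hc, map_sum, Finset.sum_eq_single b]
      · rw [map_smul]
      · intro a _ hab
        have h2 : c a = 0 := by
          by_contra h0
          exact hab (h.injective x ((h.sum_mem_nul_iff hι).1 hv' a h0))
        rw [h2, zero_smul, map_zero]
      · simp
    change nrm n f x (mdiff n ζ x v) = 0
    rw [h1, map_smul, h.nrm_of_mem_span hι (h.fderiv_eta b x), smul_zero]

/-- df [Y a, Y b] = ∂_{Y a} e_b - ∂_{Y b} e_a. A nonzero component along e c shows that the bracket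
of two fields in the conullity of η c leaves it. -/
lemma isLocallyWeaklyIrreducible (hirr : ∀ c x, ∃ a b, a ≠ c ∧ b ≠ c ∧
      inner ℝ (e c x) (fderiv ℝ (e b) x (Y a x) - fderiv ℝ (e a) x (Y b x)) ≠ 0) :
    IsLocallyWeaklyIrreducible n f := by
  rintro U hU ⟨x, hx⟩ ⟨ζ, hζ, hint⟩
  have hf := h.isSmoothImmersion hι
  obtain ⟨c, hc⟩ := h.eventually_eq_eta hι hU hζ hx
  obtain ⟨U', hU', hU'o, hxU'⟩ := eventually_nhds_iff.1 (hc.and (hU.eventually_mem hx))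
  obtain ⟨a, b, ha, hb, hne⟩ := hirr c x
  have hYs : ∀ a, IsSmoothVectorFieldOn n
      (fun z => (Y a z : TangentSpace (𝓡 n) z)) U' := fun a =>
    contMDiffOn_vectorSpace_iff_contDiffOn.2 (h.contDiff_field a).contDiffOn
  have hcon : ∀ a ≠ c, ∀ z ∈ U', (Y a z : TangentSpace (𝓡 n) z) ∈ conullity n f z (ζ z) := by
    intro a ha z hz w hw
    have hw' := (hf.mem_nullity_iff w).1 hw
    have hza : η a z ≠ ζ z := by
      rw [(hU' z hz).1]
      exact fun h0 => ha (h.injective z h0)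
    change inner ℝ (mdiff n f z (Y a z)) (mdiff n f z w) = 0
    rw [h.mdiff_field]
    exact hf.inner_eq_zero_of_mem_nul hza (h.frame_mem_nul hι a z) hw'
  have h1 := hint U' hU'o (fun z hz => (hU' z hz).2) _ _ (hYs a) (hYs b) (hcon a ha) (hcon b hb)
    x hxU' (Y c x) ((hf.mem_nullity_iff _).2 (by
      rw [h.mdiff_field, hc.self_of_nhds]
      exact h.frame_mem_nul hι c x))
  have h2 := mdiff_mlieBracket hU'o (hf.contMDiffOn U') hxU' ((hYs b).mdifferentiableAt hU'o hxU')
    ((hYs a).mdifferentiableAt hU'o hxU')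
  have h3 : ∀ b, (fun z => mdiff n f z (vec (fun z => (Y b z : TangentSpace (𝓡 n) z)) z)) = e b :=
    fun b => funext fun z => h.mdiff_field b z
  rw [h3, h3, mdiff_eq_fderiv_of_model (e b), mdiff_eq_fderiv_of_model (e a)] at h2
  apply hne
  rw [real_inner_comm, ← h.mdiff_field c x]
  exact (congrArg (fun z => inner ℝ z (mdiff n f x (Y c x))) h2).symm.trans h1

/-- A vector z orthogonal to an affine subspace containing f(U) is orthogonal to the first
derivatives e a and then to the second derivatives, hence to the η a; so z = 0. Only all of ℝ^d
contains f(U), while the sphere of radius r has dimension d - 1. -/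
lemma conformalCodim_eq [Nonempty ι] {r : ℝ} (hr : 0 < r) (hnorm : ∀ x, ‖f x‖ = r)
    (htop : ∀ x z, (∀ a, inner ℝ (e a x) z = 0) → (∀ a, inner ℝ (η a x) z = 0) → z = 0)
    {U : Set (EuclideanSpace ℝ (Fin n))} (hU : IsOpen U) (hne : U.Nonempty) :
    conformalCodim n f U = (d : ℤ) - 1 - n := by
  obtain ⟨x, hx⟩ := hne
  have hd : 0 < d := by
    rw [Nat.pos_iff_ne_zero]
    rintro rfl
    obtain ⟨a⟩ := ‹Nonempty ι›
    exact (h.orthonormal x).ne_zero a (Subsingleton.elim _ _)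
  have hfull : ∀ A : AffineSubspace ℝ (EuclideanSpace ℝ (Fin d)), f '' U ⊆ A →
      d ≤ Module.finrank ℝ A.direction := by
    intro A hA
    by_contra hlt
    have hA' : A.direction ≠ ⊤ := fun h0 => hlt (by
      rw [h0, finrank_top, finrank_euclideanSpace_fin])
    obtain ⟨z, hz, hz0⟩ := Submodule.exists_mem_ne_zero_of_ne_bot
      (fun h0 => hA' ((Submodule.orthogonal_eq_bot_iff).1 h0) : A.directionᗮ ≠ ⊥)
    have hconst : ∀ y ∈ U, inner ℝ (f y) z = inner ℝ (f x) z := fun y hy => by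
      rw [← sub_eq_zero, ← inner_sub_left]
      exact (Submodule.mem_orthogonal _ _).1 hz _
        (AffineSubspace.vsub_mem_direction (hA ⟨y, hy, rfl⟩) (hA ⟨x, hx, rfl⟩))
    have hder : ∀ (g : EuclideanSpace ℝ (Fin n) → EuclideanSpace ℝ (Fin d)) (t : ℝ),
        ContDiff ℝ ∞ g → (∀ y ∈ U, inner ℝ (g y) z = t) →
        ∀ y ∈ U, ∀ v, inner ℝ (fderiv ℝ g y v) z = 0 := by
      intro g t hg hgt y hy v
      have h1 : (fun y => inner ℝ (g y) z) =ᶠ[𝓝 y] fun _ => t := by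
        filter_upwards [hU.mem_nhds hy] with y' hy' using hgt y' hy'
      have h2 : fderiv ℝ (fun y => inner ℝ (g y) z) y = fderiv ℝ (fun _ => t) y := h1.fderiv_eq
      have h3 := fderiv_inner_apply ℝ (hg.differentiable (by simp) y) (differentiableAt_const z) v
      rw [h2] at h3
      simpa using h3.symm
    have he : ∀ a, ∀ y ∈ U, inner ℝ (e a y) z = 0 := fun a y hy => by
      rw [← h.fderiv_field]
      exact hder f _ h.contDiff hconst y hy _
    refine hz0 (htop x z (fun a => he a x hx) fun a => ?_)
    have h1 := hder (e a) 0 (h.contDiff_frame a) (he a) x hx (Y a x)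
    have h2 := h.fderiv_frame a a x
    rw [if_pos rfl] at h2
    obtain ⟨c, hc⟩ := (Submodule.mem_span_range_iff_exists_fun ℝ).1 h2
    have h3 : inner ℝ (∑ b, c b • e b x) z = 0 := by
      rw [sum_inner]
      exact Finset.sum_eq_zero fun b _ => by rw [real_inner_smul_left, he b x hx, mul_zero]
    rw [hc, inner_sub_left, h1, zero_sub, neg_eq_zero] at h3
    exact h3
  have hmem : LiesInSphereOrAffine (d - 1) (f '' U) := by
    refine Or.inr ⟨⊤, ?_, 0, AffineSubspace.mem_top _ _ _, r, hr, ?_⟩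
    · rw [AffineSubspace.direction_top, finrank_top, finrank_euclideanSpace_fin]
      omega
    · rintro _ ⟨y, -, rfl⟩
      exact ⟨AffineSubspace.mem_top _ _ _, by rw [mem_sphere_zero_iff_norm, hnorm]⟩
  have hinf : sInf {m : ℕ | LiesInSphereOrAffine m (f '' U)} = d - 1 := by
    refine le_antisymm (Nat.sInf_le hmem) (le_csInf ⟨_, hmem⟩ ?_)
    -- An m-sphere spans an affine subspace of dimension m + 1, so m + 1 ≥ d; an affine subspace
    -- even requires m ≥ d.
    rintro m (⟨A, hA, hsub⟩ | ⟨A, hA, c, hc, r, hr, hsub⟩)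
    · have := hfull A hsub
      omega
    · have := hfull A fun y hy => (hsub hy).1
      omega
  rw [conformalCodim, hinf]
  omega

end IsDupinFrame

/-! ### Products of immersions. -/

section Product

/-- A decomposition of a Euclidean space into orthogonal copies of another one. -/
structure IsOrthogonalDecomposition {l m N : ℕ}
    (j : Fin l → EuclideanSpace ℝ (Fin m) →L[ℝ] EuclideanSpace ℝ (Fin N)) : Prop where
  inner_eq : ∀ s t a b, inner ℝ (j s a) (j t b) = if s = t then inner ℝ a b else 0
  eq_zero : ∀ z, (∀ s a, inner ℝ (j s a) z = 0) → z = 0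

/-- N is kept separate from l * m because the target of the example has its dimension written as n +
p. -/
lemma exists_isOrthogonalDecomposition {l m N : ℕ} (hN : N = l * m) :
    ∃ j : Fin l → EuclideanSpace ℝ (Fin m) →L[ℝ] EuclideanSpace ℝ (Fin N),
      IsOrthogonalDecomposition j := by
  subst hN
  let q : Fin (l * m) ≃ Fin l × Fin m := finProdFinEquiv.symm
  let j : Fin l → EuclideanSpace ℝ (Fin m) →ₗ[ℝ] EuclideanSpace ℝ (Fin (l * m)) := fun s =>
    { toFun := fun a => WithLp.toLp 2 fun i => if (q i).1 = s then a (q i).2 else 0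
      map_add' := fun a b => by
        ext i
        by_cases h : (q i).1 = s <;> simp [h]
      map_smul' := fun c a => by
        ext i
        by_cases h : (q i).1 = s <;> simp [h] }
  have hj : ∀ s a i, j s a i = if (q i).1 = s then a (q i).2 else 0 := fun _ _ _ => rfl
  have hinner : ∀ s a z, inner ℝ (j s a) z = ∑ i, a i * z (q.symm (s, i)) := by
    intro s a z
    have h1 : inner ℝ (j s a) z = ∑ p : Fin l × Fin m, j s a (q.symm p) * z (q.symm p) := by
      rw [q.symm.sum_comp (fun i => j s a i * z i), PiLp.inner_apply]
      exact Finset.sum_congr rfl fun i _ => mul_comm _ _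
    rw [h1, Fintype.sum_prod_type, Finset.sum_eq_single s]
    · simp [hj]
    · intro t _ hts
      simp [hj, hts]
    · simp
  refine ⟨fun s => LinearMap.toContinuousLinearMap (j s), fun s t a b => ?_, fun z hz => ?_⟩
  · change inner ℝ (j s a) (j t b) = _
    rw [hinner]
    by_cases hst : s = t
    · subst hst
      rw [if_pos rfl, PiLp.inner_apply]
      exact Finset.sum_congr rfl fun i _ => by simp [hj, mul_comm]
    · rw [if_neg hst]
      exact Finset.sum_eq_zero fun i _ => by simp [hj, hst]
  · ext i
    have h1 : inner ℝ (j (q i).1 (EuclideanSpace.single (q i).2 1)) z = 0 := hz _ _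
    rw [hinner, Finset.sum_eq_single (q i).2] at h1
    · simpa using h1
    · intro b _ hb
      simp [hb]
    · simp

variable {l m N m' N' : ℕ} {i : Fin l → EuclideanSpace ℝ (Fin m) →L[ℝ] EuclideanSpace ℝ (Fin N)}
  {j : Fin l → EuclideanSpace ℝ (Fin m') →L[ℝ] EuclideanSpace ℝ (Fin N')}

lemma IsOrthogonalDecomposition.adjoint_apply (hi : IsOrthogonalDecomposition i) (s t : Fin l)
    (a : EuclideanSpace ℝ (Fin m)) : (i s).adjoint (i t a) = if s = t then a else 0 := by
  refine ext_inner_left ℝ fun b => ?_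
  rw [ContinuousLinearMap.adjoint_inner_right, hi.inner_eq]
  split_ifs <;> simp

variable (i j) in
/-- The map `g` acting on one of the factors. -/
def onFactor (s t : Fin l) (g : EuclideanSpace ℝ (Fin m) → EuclideanSpace ℝ (Fin m')) :
    EuclideanSpace ℝ (Fin N) → EuclideanSpace ℝ (Fin N') := fun x => j t (g ((i s).adjoint x))

lemma contDiff_onFactor (s t : Fin l)
    {g : EuclideanSpace ℝ (Fin m) → EuclideanSpace ℝ (Fin m')} (hg : ContDiff ℝ ∞ g) :
    ContDiff ℝ ∞ (onFactor i j s t g) :=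
  (j t).contDiff.comp (hg.comp (i s).adjoint.contDiff)

lemma fderiv_onFactor (s t : Fin l)
    {g : EuclideanSpace ℝ (Fin m) → EuclideanSpace ℝ (Fin m')} (hg : ContDiff ℝ ∞ g) (x v) :
    fderiv ℝ (onFactor i j s t g) x v
      = j t (fderiv ℝ g ((i s).adjoint x) ((i s).adjoint v)) := by
  have h1 := (hg.differentiable (by simp) ((i s).adjoint x)).hasFDerivAt.comp x
    (i s).adjoint.hasFDerivAt
  have h2 := (j t).hasFDerivAt.comp x h1
  change fderiv ℝ (j t ∘ g ∘ (i s).adjoint) x v = _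
  rw [h2.fderiv]
  rfl

/-- The product of `l` copies of an immersion with a Dupin frame. -/
lemma IsDupinFrame.product {ι : Type*} [Fintype ι] [DecidableEq ι]
    {f : EuclideanSpace ℝ (Fin m) → EuclideanSpace ℝ (Fin m')}
    {Y : ι → EuclideanSpace ℝ (Fin m) → EuclideanSpace ℝ (Fin m)}
    {e η : ι → EuclideanSpace ℝ (Fin m) → EuclideanSpace ℝ (Fin m')}
    (h : IsDupinFrame f Y e η) (hη : ∀ a x, η a x ≠ 0) (hi : IsOrthogonalDecomposition i)
    (hj : IsOrthogonalDecomposition j) :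
    IsDupinFrame (ι := Fin l × ι) (fun x => ∑ s, onFactor i j s s f x)
      (fun a => onFactor i i a.1 a.1 (Y a.2)) (fun a => onFactor i j a.1 a.1 (e a.2))
      (fun a => onFactor i j a.1 a.1 (η a.2)) where
  contDiff := ContDiff.sum fun s _ => contDiff_onFactor s s h.contDiff
  contDiff_field a := contDiff_onFactor _ _ (h.contDiff_field a.2)
  contDiff_frame a := contDiff_onFactor _ _ (h.contDiff_frame a.2)
  contDiff_eta a := contDiff_onFactor _ _ (h.contDiff_eta a.2)
  fderiv_field a x := by
    rw [fderiv_fun_sum fun s _ =>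
      (contDiff_onFactor s s h.contDiff).differentiable (by simp) x, sum_apply,
      Finset.sum_eq_single a.1]
    · rw [fderiv_onFactor _ _ h.contDiff, onFactor, hi.adjoint_apply, if_pos rfl, h.fderiv_field]
      rfl
    · intro s _ hs
      rw [fderiv_onFactor _ _ h.contDiff, onFactor, hi.adjoint_apply, if_neg hs, map_zero, map_zero]
    · simp
  orthonormal x := by
    rw [orthonormal_iff_ite]
    rintro ⟨s, a⟩ ⟨t, b⟩
    simp only [onFactor, hj.inner_eq, Prod.mk.injEq]
    by_cases hst : s = t
    · subst hst
      simp [h.inner_frame]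
    · simp [hst]
  inner_eta a b x := by
    simp only [onFactor, hj.inner_eq]
    split_ifs with hab
    · rw [hab, h.inner_eta]
    · rfl
  fderiv_frame := by
    rintro ⟨s, a⟩ ⟨t, b⟩ x
    rw [fderiv_onFactor _ _ (h.contDiff_frame a), onFactor, hi.adjoint_apply]
    by_cases hst : s = t
    · subst hst
      rw [if_pos rfl]
      have h1 : (if ((s, a) : Fin l × ι) = (s, b) then onFactor i j s s (η a) x else 0)
          = j s (if a = b then η a ((i s).adjoint x) else 0) := by
        by_cases hab : a = b <;> simp [hab, onFactor]
      rw [h1, ← map_sub]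
      refine Submodule.span_mono ?_ ((Submodule.map_span (j s).toLinearMap _).le
        (Submodule.mem_map_of_mem (h.fderiv_frame a b ((i s).adjoint x))))
      rintro _ ⟨_, ⟨c, rfl⟩, rfl⟩
      exact ⟨(s, c), rfl⟩
    · rw [if_neg hst, map_zero, map_zero, if_neg (by simp [hst]), sub_zero]
      exact Submodule.zero_mem _
  fderiv_eta := by
    rintro ⟨s, a⟩ x
    rw [fderiv_onFactor _ _ (h.contDiff_eta a), onFactor, hi.adjoint_apply, if_pos rfl]
    refine Submodule.span_mono ?_ ((Submodule.map_span (j s).toLinearMap _).le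
      (Submodule.mem_map_of_mem (h.fderiv_eta a ((i s).adjoint x))))
    rintro _ ⟨_, ⟨c, rfl⟩, rfl⟩
    exact ⟨(s, c), rfl⟩
  injective x := by
    rintro ⟨s, a⟩ ⟨t, b⟩ hst
    have h1 : ∀ w, inner ℝ (j s w) (onFactor i j s s (η a) x)
        = inner ℝ (j s w) (onFactor i j t t (η b) x) := fun w => congrArg _ hst
    simp only [onFactor, hj.inner_eq] at h1
    by_cases hst' : s = t
    · subst hst'
      simp only [if_true] at h1
      rw [h.injective _ (ext_inner_left ℝ h1)]
    -- Normals from different factors are orthogonal; being nonzero, they are distinct.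
    · simp only [if_true, if_neg hst'] at h1
      exact absurd (inner_self_eq_zero.1 (h1 _)) (hη a _)

lemma norm_sq_sum_onFactor (hj : IsOrthogonalDecomposition j)
    {f : EuclideanSpace ℝ (Fin m) → EuclideanSpace ℝ (Fin m')} {r : ℝ} (hf : ∀ x, ‖f x‖ ^ 2 = r)
    (x : EuclideanSpace ℝ (Fin N)) : ‖∑ s, onFactor i j s s f x‖ ^ 2 = l * r := by
  rw [← real_inner_self_eq_norm_sq, sum_inner]
  have h1 : ∀ s, inner ℝ (onFactor i j s s f x) (∑ t, onFactor i j t t f x) = r := by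
    intro s
    rw [inner_sum, Finset.sum_eq_single s]
    · rw [onFactor, hj.inner_eq, if_pos rfl, real_inner_self_eq_norm_sq, hf]
    · intro t _ hts
      rw [onFactor, onFactor, hj.inner_eq, if_neg (Ne.symm hts)]
    · simp
  simp [h1]

end Product

/-! ### The Cartan hypersurface in the 4-sphere. -/

section Model

/-- The numerators and the denominator of the Cayley parametrization are quadratic along lines,
which turns their derivatives into polynomial identities. -/
lemma fderiv_eq_of_quadratic {E F : Type*} [NormedAddCommGroup E] [NormedSpace ℝ E]
    [NormedAddCommGroup F] [NormedSpace ℝ F] {g : E → F} {w v : E} {A C : F}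
    (hg : DifferentiableAt ℝ g w) (h : ∀ t : ℝ, g (w + t • v) = g w + t • A + t ^ 2 • C) :
    fderiv ℝ g w v = A := by
  rw [← hg.lineDeriv_eq_fderiv, lineDeriv]
  simp only [h]
  have h1 : HasDerivAt (fun t : ℝ => g w + t • A + t ^ 2 • C) ((1 : ℝ) • A + (0 : ℝ) • C) 0 := by
    refine (((hasDerivAt_id (0 : ℝ)).smul_const A).const_add (g w)).add ?_
    simpa using ((hasDerivAt_pow 2 (0 : ℝ)).smul_const C)
  rw [h1.deriv, one_smul, zero_smul, add_zero]

/-- The left invariant fields of the rotation group in the Cayley parametrization. -/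
def cayleyField (a : Fin 3) (w : EuclideanSpace ℝ (Fin 3)) : EuclideanSpace ℝ (Fin 3) :=
  ![!₂[1 + w 0 ^ 2, w 0 * w 1 + w 2, w 0 * w 2 - w 1],
    !₂[w 0 * w 1 - w 2, 1 + w 1 ^ 2, w 1 * w 2 + w 0],
    !₂[w 0 * w 2 + w 1, w 1 * w 2 - w 0, 1 + w 2 ^ 2]] a

/-- The denominator of the Cayley parametrization. -/
def cayleyDenom (w : EuclideanSpace ℝ (Fin 3)) : ℝ := 1 + w 0 ^ 2 + w 1 ^ 2 + w 2 ^ 2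

/-- The numerators of the columns of a rotation matrix in the Cayley parametrization. -/
def cayleyNum (a : Fin 3) (w : EuclideanSpace ℝ (Fin 3)) : EuclideanSpace ℝ (Fin 3) :=
  (2 : ℝ) • cayleyField a w - cayleyDenom w • EuclideanSpace.single a 1

/-- The columns of a rotation matrix in the Cayley parametrization. -/
def rotationFrame (a : Fin 3) (w : EuclideanSpace ℝ (Fin 3)) : EuclideanSpace ℝ (Fin 3) :=
  (cayleyDenom w)⁻¹ • cayleyNum a w

/-- The Levi-Civita symbol. -/
def leviCivita (a b c : Fin 3) : ℝ :=
  ![![![0, 0, 0], ![0, 0, 1], ![0, -1, 0]], ![![0, 0, -1], ![0, 0, 0], ![1, 0, 0]],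
    ![![0, 1, 0], ![-1, 0, 0], ![0, 0, 0]]] a b c

lemma cayleyDenom_pos (w : EuclideanSpace ℝ (Fin 3)) : 0 < cayleyDenom w := by
  unfold cayleyDenom; positivity

lemma contDiff_cayleyField (a : Fin 3) : ContDiff ℝ ∞ (cayleyField a) := by
  refine contDiff_euclidean.2 fun b => ?_
  fin_cases a <;> fin_cases b <;> simp [cayleyField] <;> fun_prop

lemma contDiff_cayleyDenom : ContDiff ℝ ∞ cayleyDenom := by
  unfold cayleyDenom; fun_prop

lemma contDiff_cayleyNum (a : Fin 3) : ContDiff ℝ ∞ (cayleyNum a) :=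
  ((contDiff_cayleyField a).const_smul _).sub (contDiff_cayleyDenom.smul contDiff_const)

lemma contDiff_rotationFrame (a : Fin 3) : ContDiff ℝ ∞ (rotationFrame a) :=
  (contDiff_cayleyDenom.inv fun w => (cayleyDenom_pos w).ne').smul (contDiff_cayleyNum a)

lemma inner_cayleyNum (a b : Fin 3) (w : EuclideanSpace ℝ (Fin 3)) :
    inner ℝ (cayleyNum a w) (cayleyNum b w) = if a = b then cayleyDenom w ^ 2 else 0 := by
  fin_cases a <;> fin_cases b <;>
    simp [-inner_self_eq_norm_sq_to_K, cayleyNum, cayleyField, cayleyDenom, PiLp.inner_apply, Fin.sum_univ_three] <;> ring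

lemma inner_rotationFrame (a b : Fin 3) (w : EuclideanSpace ℝ (Fin 3)) :
    inner ℝ (rotationFrame a w) (rotationFrame b w) = if a = b then 1 else 0 := by
  have h := (cayleyDenom_pos w).ne'
  rw [rotationFrame, rotationFrame, real_inner_smul_left, real_inner_smul_right, inner_cayleyNum]
  split_ifs
  · field_simp
  · simp

lemma fderiv_cayleyDenom (a : Fin 3) (w : EuclideanSpace ℝ (Fin 3)) :
    fderiv ℝ cayleyDenom w (cayleyField a w) = 2 * w a * cayleyDenom w := by
  -- This value of C is forced by t = 1.
  refine fderiv_eq_of_quadratic (C := cayleyDenom (w + cayleyField a w) - cayleyDenom w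
    - 2 * w a * cayleyDenom w) (contDiff_cayleyDenom.differentiable (by simp) w) fun t => ?_
  fin_cases a <;> simp [cayleyDenom, cayleyField] <;> ring

lemma fderiv_cayleyNum (a b : Fin 3) (w : EuclideanSpace ℝ (Fin 3)) :
    fderiv ℝ (cayleyNum b) w (cayleyField a w)
      = (2 * w a) • cayleyNum b w + ∑ c, (2 * leviCivita a b c) • cayleyNum c w := by
  refine fderiv_eq_of_quadratic (C := cayleyNum b (w + cayleyField a w) - cayleyNum b w
    - ((2 * w a) • cayleyNum b w + ∑ c, (2 * leviCivita a b c) • cayleyNum c w))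
    ((contDiff_cayleyNum b).differentiable (by simp) w) fun t => ?_
  ext i
  fin_cases a <;> fin_cases b <;> fin_cases i <;>
    simp [cayleyNum, cayleyDenom, cayleyField, leviCivita, Fin.sum_univ_three] <;> ring

/-- The structure equations of the rotation group: along a left invariant field, the columns of the
rotation matrix turn into one another with constant coefficients. -/
lemma fderiv_rotationFrame (a b : Fin 3) (w : EuclideanSpace ℝ (Fin 3)) :
    fderiv ℝ (rotationFrame b) w (cayleyField a w)
      = ∑ c, (2 * leviCivita a b c) • rotationFrame c w := by
  have h0 := (cayleyDenom_pos w).ne'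
  have h1 := (contDiff_cayleyDenom.differentiable (by simp) w).hasFDerivAt (x := w)
  have h2 := ((contDiff_cayleyNum b).differentiable (by simp) w).hasFDerivAt (x := w)
  have h3 : fderiv ℝ (rotationFrame b) w = _ :=
    (((hasDerivAt_inv h0).comp_hasFDerivAt w h1).fun_smul h2).fderiv
  rw [h3]
  simp only [add_apply, smul_apply, ContinuousLinearMap.smulRight_apply, fderiv_cayleyNum,
    fderiv_cayleyDenom, rotationFrame, smul_add, Finset.smul_sum, Function.comp_apply]
  -- The derivative of the denominator cancels the multiple 2 w_a of the numerator itself.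
  have h4 : (cayleyDenom w)⁻¹ • (2 * w a) • cayleyNum b w
      + (-(cayleyDenom w ^ 2)⁻¹ • (2 * w a * cayleyDenom w)) • cayleyNum b w = 0 := by
    rw [smul_smul, ← add_smul]
    convert zero_smul ℝ _ using 2
    rw [smul_eq_mul]
    field_simp
    ring
  rw [add_right_comm, h4, zero_add]
  exact Finset.sum_congr rfl fun c _ => smul_comm _ _ _

/-- The trace free symmetric product of two vectors of `ℝ^3`. -/
def symProdFun (a b : EuclideanSpace ℝ (Fin 3)) : EuclideanSpace ℝ (Fin 5) :=
  !₂[a 0 * b 1 + a 1 * b 0, a 1 * b 2 + a 2 * b 1, a 0 * b 2 + a 2 * b 0, a 0 * b 0 - a 1 * b 1,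
    (a 0 * b 0 + a 1 * b 1 - 2 * (a 2 * b 2)) / √3]

/-- The trace free symmetric product as a continuous bilinear map. -/
def symProd : EuclideanSpace ℝ (Fin 3) →L[ℝ] EuclideanSpace ℝ (Fin 3) →L[ℝ]
    EuclideanSpace ℝ (Fin 5) :=
  (LinearMap.mk₂ ℝ symProdFun
    (fun a a' b => by ext i; fin_cases i <;> simp [symProdFun] <;> ring)
    (fun c a b => by ext i; fin_cases i <;> simp [symProdFun] <;> ring)
    (fun a b b' => by ext i; fin_cases i <;> simp [symProdFun] <;> ring)
    (fun c a b => by ext i; fin_cases i <;> simp [symProdFun] <;> ring)).toContinuousBilinearMap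

lemma symProd_apply (a b : EuclideanSpace ℝ (Fin 3)) : symProd a b = symProdFun a b := rfl

lemma symProd_comm (a b : EuclideanSpace ℝ (Fin 3)) : symProd a b = symProd b a := by
  rw [symProd_apply, symProd_apply]
  ext i
  fin_cases i <;> simp [symProdFun] <;> ring

/-- The five coordinates, normalized by √3, make this half the trace form on the matrices a bᵀ + b
aᵀ - (2/3)⟨a, b⟩ I. Hence products of an orthonormal frame have constant inner products. -/
lemma inner_symProd (a b c d : EuclideanSpace ℝ (Fin 3)) :
    inner ℝ (symProd a b) (symProd c d) = inner ℝ a c * inner ℝ b d + inner ℝ a d * inner ℝ b c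
      - 2 / 3 * (inner ℝ a b * inner ℝ c d) := by
  have h3 : √3 ^ 2 = (3 : ℝ) := Real.sq_sqrt (by norm_num)
  have h : ∀ s t : ℝ, t / √3 * (s / √3) = s * t / 3 := fun s t => by
    rw [div_mul_div_comm, ← pow_two, h3, mul_comm]
  rw [symProd_apply, symProd_apply]
  simp [symProdFun, PiLp.inner_apply, Fin.sum_univ_five, Fin.sum_univ_three, h]
  ring

/-- The products of the vectors of the moving frame. -/
def frameProd (a b : Fin 3) (w : EuclideanSpace ℝ (Fin 3)) : EuclideanSpace ℝ (Fin 5) :=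
  symProd (rotationFrame a w) (rotationFrame b w)

lemma frameProd_comm (a b : Fin 3) : frameProd a b = frameProd b a :=
  funext fun _ => symProd_comm _ _

lemma contDiff_frameProd (a b : Fin 3) : ContDiff ℝ ∞ (frameProd a b) :=
  (symProd.contDiff.comp (contDiff_rotationFrame a)).clm_apply (contDiff_rotationFrame b)

lemma differentiableAt_frameProd (a b : Fin 3) (w : EuclideanSpace ℝ (Fin 3)) :
    DifferentiableAt ℝ (frameProd a b) w := (contDiff_frameProd a b).differentiable (by simp) w

lemma inner_frameProd (a b c d : Fin 3) (w : EuclideanSpace ℝ (Fin 3)) :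
    inner ℝ (frameProd a b w) (frameProd c d w)
      = (if a = c then 1 else 0) * (if b = d then 1 else 0)
        + (if a = d then 1 else 0) * (if b = c then 1 else 0)
        - 2 / 3 * ((if a = b then 1 else 0) * (if c = d then 1 else 0)) := by
  simp only [frameProd, inner_symProd, inner_rotationFrame]

lemma fderiv_frameProd (a b c : Fin 3) (w : EuclideanSpace ℝ (Fin 3)) :
    fderiv ℝ (frameProd b c) w (cayleyField a w)
      = ∑ k, ((2 * leviCivita a b k) • frameProd k c w
        + (2 * leviCivita a c k) • frameProd b k w) := by
  have h1 := (contDiff_rotationFrame b).differentiable (by simp) w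
  have h2 := (contDiff_rotationFrame c).differentiable (by simp) w
  have h3 : fderiv ℝ (frameProd b c) w = _ :=
    (symProd.hasFDerivAt_of_bilinear h1.hasFDerivAt h2.hasFDerivAt).fderiv
  rw [h3]
  simp only [add_apply, ContinuousLinearMap.precompR_apply, ContinuousLinearMap.precompL_apply,
    ContinuousLinearMap.compL_apply, ContinuousLinearMap.comp_apply,
    fderiv_rotationFrame, map_sum, map_smul, sum_apply, smul_apply, frameProd]
  rw [← Finset.sum_add_distrib]
  exact Finset.sum_congr rfl fun k _ => add_comm _ _

/-- A minimal isoparametric hypersurface of the sphere `S^4`, parametrized by rotations. -/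
def cartanImmersion (w : EuclideanSpace ℝ (Fin 3)) : EuclideanSpace ℝ (Fin 5) :=
  frameProd 0 0 w - frameProd 2 2 w

/-- The tangent fields sent to an orthonormal frame by the differential of `cartanImmersion`. -/
def cartanField (a : Fin 3) (w : EuclideanSpace ℝ (Fin 3)) : EuclideanSpace ℝ (Fin 3) :=
  (![1 / 4, -1 / 8, 1 / 4] a : ℝ) • cayleyField a w

/-- The orthonormal frame of principal directions of `cartanImmersion`. -/
def cartanFrame (a : Fin 3) : EuclideanSpace ℝ (Fin 3) → EuclideanSpace ℝ (Fin 5) :=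
  ![frameProd 1 2, frameProd 0 2, frameProd 0 1] a

/-- The principal normals of `cartanImmersion`. -/
def cartanNormal (a : Fin 3) (w : EuclideanSpace ℝ (Fin 3)) : EuclideanSpace ℝ (Fin 5) :=
  (![1 / 2, 1 / 4, 1 / 2] a : ℝ) •
    (frameProd (![2, 2, 1] a) (![2, 2, 1] a) w - frameProd (![1, 0, 0] a) (![1, 0, 0] a) w)

/-- The coefficients of the derivative of the frame of principal directions. -/
def cartanConnection (a b : Fin 3) : ℝ :=
  ![![0, -1 / 4, -1 / 2], ![-1 / 2, 0, 1 / 2], ![1 / 2, 1 / 4, 0]] a b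

lemma contDiff_cartanFrame (a : Fin 3) : ContDiff ℝ ∞ (cartanFrame a) := by
  fin_cases a <;> exact contDiff_frameProd _ _

/-- For a ≠ b, -a - b in `Fin 3` is the third index; for a = b it is a, and its coefficient is 0. -/
lemma fderiv_cartanFrame (a b : Fin 3) (w : EuclideanSpace ℝ (Fin 3)) :
    fderiv ℝ (cartanFrame a) w (cartanField b w)
      = (if a = b then cartanNormal a w else 0)
        + cartanConnection a b • cartanFrame (-a - b) w := by
  have e2 : (-2 : Fin 3) = 1 := by decide
  have e3 : (-1 : Fin 3) = 2 := by decide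
  rw [cartanField, map_smul]
  fin_cases a <;> fin_cases b <;>
    simp [cartanFrame, cartanNormal, cartanConnection, fderiv_frameProd, leviCivita,
      Fin.sum_univ_three, frameProd_comm 1 0, frameProd_comm 2 1, e2, e3] <;>
    module

lemma inner_cartanFrame (a b : Fin 3) (w : EuclideanSpace ℝ (Fin 3)) :
    inner ℝ (cartanFrame a w) (cartanFrame b w) = if a = b then 1 else 0 := by
  fin_cases a <;> fin_cases b <;> simp [-inner_self_eq_norm_sq_to_K, cartanFrame, inner_frameProd]

/-- The middle row is the mean of the outer ones: the second principal normal is the midpoint of the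
other two, and the three are collinear. -/
lemma inner_cartanNormal (a b : Fin 3) (w : EuclideanSpace ℝ (Fin 3)) :
    inner ℝ (cartanNormal a w) (cartanNormal b w)
      = ![![1, 1 / 4, -1 / 2], ![1 / 4, 1 / 4, 1 / 4], ![-1 / 2, 1 / 4, 1]] a b := by
  fin_cases a <;> fin_cases b <;>
    simp [-inner_self_eq_norm_sq_to_K, cartanNormal, inner_sub_left, inner_sub_right,
      inner_smul_left, inner_smul_right, inner_frameProd] <;> norm_num

lemma inner_cartanFrame_cartanNormal (a b : Fin 3) (w : EuclideanSpace ℝ (Fin 3)) :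
    inner ℝ (cartanFrame a w) (cartanNormal b w) = 0 := by
  fin_cases a <;> fin_cases b <;>
    simp [cartanFrame, cartanNormal, inner_sub_right, inner_smul_right, inner_frameProd]

/-- The coefficients are -|η a|²: along its own direction, a Dupin principal normal changes only
tangentially. -/
lemma fderiv_cartanNormal (a : Fin 3) (w : EuclideanSpace ℝ (Fin 3)) :
    fderiv ℝ (cartanNormal a) w (cartanField a w)
      = (![-1, -1 / 4, -1] a : ℝ) • cartanFrame a w := by
  have h : fderiv ℝ (cartanNormal a) w = _ :=
    (((differentiableAt_frameProd (![2, 2, 1] a) (![2, 2, 1] a) w).hasFDerivAt.fun_sub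
      (differentiableAt_frameProd (![1, 0, 0] a) (![1, 0, 0] a) w).hasFDerivAt).fun_const_smul
        (![1 / 2, 1 / 4, 1 / 2] a : ℝ)).fderiv
  rw [h, cartanField, map_smul]
  fin_cases a <;>
    simp [cartanFrame, fderiv_frameProd, leviCivita, Fin.sum_univ_three, frameProd_comm 1 0,
      frameProd_comm 2 0, frameProd_comm 2 1] <;>
    module

/-- The left invariant fields are mapped to 4, -8 and 4 times the frame, whence the factors 1/4,
-1/8 and 1/4 in `cartanField`. -/
lemma fderiv_cartanImmersion (a : Fin 3) (w : EuclideanSpace ℝ (Fin 3)) :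
    fderiv ℝ cartanImmersion w (cartanField a w) = cartanFrame a w := by
  have h : fderiv ℝ cartanImmersion w = _ :=
    ((differentiableAt_frameProd 0 0 w).hasFDerivAt.fun_sub
      (differentiableAt_frameProd 2 2 w).hasFDerivAt).fderiv
  rw [h, cartanField, map_smul]
  fin_cases a <;>
    simp [cartanFrame, fderiv_frameProd, leviCivita, Fin.sum_univ_three, frameProd_comm 1 0,
      frameProd_comm 2 0, frameProd_comm 2 1] <;>
    module

lemma isDupinFrame_cartan :
    IsDupinFrame cartanImmersion cartanField cartanFrame cartanNormal where
  contDiff := (contDiff_frameProd 0 0).sub (contDiff_frameProd 2 2)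
  contDiff_field a := (contDiff_cayleyField a).const_smul _
  contDiff_frame := contDiff_cartanFrame
  contDiff_eta a := ((contDiff_frameProd _ _).sub (contDiff_frameProd _ _)).const_smul _
  fderiv_field := fderiv_cartanImmersion
  orthonormal x := orthonormal_iff_ite.2 fun a b => inner_cartanFrame a b x
  inner_eta := inner_cartanFrame_cartanNormal
  fderiv_frame a b x := by
    rw [fderiv_cartanFrame, add_sub_cancel_left]
    exact Submodule.smul_mem _ _ (Submodule.subset_span ⟨_, rfl⟩)
  fderiv_eta a x := by
    rw [fderiv_cartanNormal]
    exact Submodule.smul_mem _ _ (Submodule.subset_span ⟨_, rfl⟩)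
  injective x a b hab := by
    have h1 := inner_cartanNormal a a x
    have h2 := inner_cartanNormal a b x
    have h3 := inner_cartanNormal b b x
    have hab : cartanNormal a x = cartanNormal b x := hab
    rw [hab] at h1 h2
    rw [h3] at h1 h2
    revert h1 h2
    fin_cases a <;> fin_cases b <;> norm_num

lemma cartanNormal_ne_zero (a : Fin 3) (w : EuclideanSpace ℝ (Fin 3)) : cartanNormal a w ≠ 0 := by
  intro h0
  have h := inner_cartanNormal a a w
  rw [h0, inner_zero_left] at h
  revert h
  fin_cases a <;> norm_num

lemma norm_sq_cartanImmersion (w : EuclideanSpace ℝ (Fin 3)) : ‖cartanImmersion w‖ ^ 2 = 4 := by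
  rw [← real_inner_self_eq_norm_sq, cartanImmersion]
  simp [-inner_self_eq_norm_sq_to_K, inner_sub_left, inner_sub_right, inner_frameProd]
  norm_num

lemma eq_zero_of_inner_cartan {w : EuclideanSpace ℝ (Fin 3)} {z : EuclideanSpace ℝ (Fin 5)}
    (h₁ : ∀ a, inner ℝ (cartanFrame a w) z = 0) (h₂ : ∀ a, inner ℝ (cartanNormal a w) z = 0) :
    z = 0 := by
  -- The middle normal depends on the outer two and is left out; 3 + 2 vectors then form a basis of
  -- ℝ^5.
  let b : Fin 3 ⊕ Fin 2 → EuclideanSpace ℝ (Fin 5) :=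
    Sum.elim (fun a => cartanFrame a w) fun i => cartanNormal (![0, 2] i) w
  have hli : LinearIndependent ℝ b := by
    rw [Fintype.linearIndependent_iff]
    intro c hc
    rw [Fintype.sum_sum_type] at hc
    have k1 : ∀ a, c (Sum.inl a) = 0 := fun a => by
      have h := congrArg (inner ℝ (cartanFrame a w)) hc
      simpa [b, inner_add_right, inner_sum, inner_smul_right, inner_cartanFrame,
        inner_cartanFrame_cartanNormal] using h
    simp only [k1, zero_smul, Finset.sum_const_zero, zero_add, b, Sum.elim_inr,
      Fin.sum_univ_two] at hc
    have k2 := congrArg (inner ℝ (cartanNormal 0 w)) hc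
    have k3 := congrArg (inner ℝ (cartanNormal 2 w)) hc
    simp [-inner_self_eq_norm_sq_to_K, inner_add_right, inner_smul_right, inner_cartanNormal] at k2 k3
    rintro (a | i)
    · exact k1 a
    · fin_cases i
      · change c (Sum.inr 0) = 0
        linarith
      · change c (Sum.inr 1) = 0
        linarith
  have hspan := hli.span_eq_top_of_card_eq_finrank' (by simp)
  refine ext_inner_left ℝ fun y => ?_
  rw [inner_zero_right]
  have hy : y ∈ Submodule.span ℝ (Set.range b) := hspan ▸ Submodule.mem_top
  obtain ⟨c, rfl⟩ := (Submodule.mem_span_range_iff_exists_fun ℝ).1 hy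
  rw [sum_inner]
  refine Finset.sum_eq_zero ?_
  rintro (a | i) -
  · rw [real_inner_smul_left, show b (Sum.inl a) = cartanFrame a w from rfl, h₁, mul_zero]
  · rw [real_inner_smul_left, show b (Sum.inr i) = cartanNormal (![0, 2] i) w from rfl, h₂,
      mul_zero]

/-- With the other two indices, the component is a difference of two entries of `cartanConnection`:
-1/4, -1 and -1/4 for c = 0, 1 and 2. -/
lemma exists_cartanFrame_bracket (c : Fin 3) (w : EuclideanSpace ℝ (Fin 3)) :
    ∃ a b, a ≠ c ∧ b ≠ c ∧ inner ℝ (cartanFrame c w)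
      (fderiv ℝ (cartanFrame b) w (cartanField a w)
        - fderiv ℝ (cartanFrame a) w (cartanField b w)) ≠ 0 := by
  refine ⟨c + 1, c + 2, by simp, by simp, ?_⟩
  have h1 : -(c + 2) - (c + 1) = c := by revert c; decide
  have h2 : -(c + 1) - (c + 2) = c := by revert c; decide
  rw [fderiv_cartanFrame, fderiv_cartanFrame, h1, h2, if_neg (by revert c; decide),
    if_neg (by revert c; decide), zero_add, zero_add, ← sub_smul, inner_smul_right,
    inner_cartanFrame, if_pos rfl, mul_one]
  fin_cases c <;> simp [cartanConnection] <;> norm_num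

end Model

/-! ### The sharp examples and the conclusion. -/

/-- Products of the Cartan hypersurface attain the bound on the conformal codimension. -/
theorem exists_sharp_example {l : ℕ} (hl : 1 ≤ l) :
    ∃ f : EuclideanSpace ℝ (Fin (l * 3)) → EuclideanSpace ℝ (Fin (l * 3 + l * 2)),
      IsKDupin (l * 3) (l * 3) f ∧ IsLocallyWeaklyIrreducible (l * 3) f ∧
      ∀ U : Set (EuclideanSpace ℝ (Fin (l * 3))), IsOpen U → U.Nonempty →
        conformalCodim (l * 3) f U = 2 * (l : ℤ) - 1 := by
  obtain ⟨i, hi⟩ := exists_isOrthogonalDecomposition (l := l) (m := 3) rfl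
  obtain ⟨j, hj⟩ := exists_isOrthogonalDecomposition (l := l) (m := 5) (N := l * 3 + l * 2) (by ring)
  have h := isDupinFrame_cartan.product cartanNormal_ne_zero hi hj
  have hι : Fintype.card (Fin l × Fin 3) = l * 3 := by simp
  have hl' : (0 : ℝ) < l := by exact_mod_cast hl
  have : Nonempty (Fin l × Fin 3) := ⟨(⟨0, hl⟩, 0)⟩
  refine ⟨_, h.isKDupin hι, h.isLocallyWeaklyIrreducible hι ?_, fun U hU hne => ?_⟩
  · rintro ⟨s, c⟩ x
    obtain ⟨a, b, ha, hb, hne⟩ := exists_cartanFrame_bracket c ((i s).adjoint x)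
    refine ⟨(s, a), (s, b), by simpa using ha, by simpa using hb, ?_⟩
    rw [fderiv_onFactor _ _ (contDiff_cartanFrame b), fderiv_onFactor _ _ (contDiff_cartanFrame a),
      ← map_sub]
    simp only [onFactor]
    rw [hj.inner_eq, if_pos rfl, hi.adjoint_apply, hi.adjoint_apply, if_pos rfl, if_pos rfl]
    exact hne
  · rw [h.conformalCodim_eq hι (r := √(l * 4)) (by positivity) (fun x => ?_) (fun x z h₁ h₂ => ?_)
      hU hne]
    -- The codimension in the sphere is (3l + 2l) - 1 - 3l.
    · push_cast
      ring
    · rw [← norm_sq_sum_onFactor hj norm_sq_cartanImmersion x, Real.sqrt_sq (norm_nonneg _)]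
    · refine hj.eq_zero z fun s a => ?_
      have hz : (j s).adjoint z = 0 := eq_zero_of_inner_cartan (w := (i s).adjoint x)
        (fun a => by rw [ContinuousLinearMap.adjoint_inner_right]; exact h₁ (s, a))
        (fun a => by rw [ContinuousLinearMap.adjoint_inner_right]; exact h₂ (s, a))
      rw [← ContinuousLinearMap.adjoint_inner_right, hz, inner_zero_right]

end DupinSubmanifold

end

theorem mainTheorem8 :
    -- the bound
    (∀ (n p k : ℕ), 1 ≤ n →
      ∀ (M : Type*) [TopologicalSpace M] [ChartedSpace (EuclideanSpace ℝ (Fin n)) M]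
        [IsManifold (𝓡 n) ∞ M] [T2Space M] [SecondCountableTopology M]
        (f : M → EuclideanSpace ℝ (Fin (n + p))),
      DupinSubmanifold.IsKDupin n k f →
      DupinSubmanifold.IsLocallyWeaklyIrreducible n f →
      ∃ W : Set M, IsOpen W ∧ Dense W ∧ ∀ x ∈ W,
        (DupinSubmanifold.conformalCodim n f (connectedComponentIn W x) : ℝ)
          ≤ (2 / 3 : ℝ) * k - 1) ∧
    -- its sharpness
    (∀ l : ℕ, 1 ≤ l →
      ∃ (n p : ℕ) (M : Type) (_ : TopologicalSpace M)
        (_ : ChartedSpace (EuclideanSpace ℝ (Fin n)) M) (_ : IsManifold (𝓡 n) ∞ M)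
        (f : M → EuclideanSpace ℝ (Fin (n + p))),
        1 ≤ n ∧ Nonempty M ∧ T2Space M ∧ SecondCountableTopology M ∧
        DupinSubmanifold.IsKDupin n (3 * l) f ∧
        DupinSubmanifold.IsLocallyWeaklyIrreducible n f ∧
        ∀ U : Set M, IsOpen U → U.Nonempty →
          (DupinSubmanifold.conformalCodim n f U : ℝ)
            = (2 / 3 : ℝ) * (3 * l : ℕ) - 1) := by
  refine ⟨?_, ?_⟩
  · intro n p k hn M _ _ _ _ _ f hf hirr
    exact hf.exists_dense_conformalCodim_le hirr hn
  · intro l hl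
    obtain ⟨f, hf, hirr, hcod⟩ := DupinSubmanifold.exists_sharp_example hl
    refine ⟨l * 3, l * 2, EuclideanSpace ℝ (Fin (l * 3)), inferInstance, inferInstance,
      inferInstance, f, by omega, inferInstance, inferInstance, inferInstance, ?_, hirr,
      fun U hU hne => ?_⟩
    · rwa [mul_comm 3 l]
    · rw [hcod U hU hne]
      push_cast
      ring
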